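/- **Setting.** Let $B\ge 4$, $G=I_B-\frac1B\mathbf 1\mathbf 1^{T}\in\mathbb R^{B\times B}$, $\mathsf n(x)=\sqrt B\,x/\|x\|$, and for $\phi:\mathbb R\to\mathbb R$ let $\mathcal B_\phi(h)=\phi(\mathsf n(Gh))$ with $\phi$ applied coordinatewise. For $\Phi:\mathbb R^B\to\mathbb R^B$ and positive semidefinite $\Sigma$ put $\mathrm V_\Phi(\Sigma)=\mathbb E[\Phi(h)\Phi(h)^{T}:h\sim\mathcal N(0,\Sigma)]$. Let $\mathcal H$ be the space of symmetric $B\times B$ matrices, $\mathcal H^G=\{\Sigma\in\mathcal H:G\Sigma G=\Sigma\}$, $G^{\otimes2}\{\Sigma\}=G\Sigma G$, and $$\mathbb L=\{GDG: D\text{ diagonal},\ \operatorname{tr}D=0\},\qquad \mathbb M=\{\Sigma\in\mathcal H^G:\operatorname{Diag}\Sigma=0\}.$$ Let $(a)_b=\Gamma(a+b)/\Gamma(a)$, and for $\alpha>-\frac12$ let $\mathsf c_\alpha=\frac1{\sqrt\pi}2^{\alpha-1}\Gamma(\alpha+\frac12)$ and $$\mathrm J_\alpha(\cos\theta)=\frac{(\sin\theta)^{2\alpha+1}\Gamma(\alpha+1)}{2\pi\mathsf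 c_\alpha}\int_0^{\pi/2}\frac{\cos^\alpha\eta\,d\eta}{(1-\cos\theta\cos\eta)^{1+\alpha}}\quad(0<\theta\le\pi),\qquad \mathrm J_\alpha(1)=1.$$ **General statement.** Let $\alpha>-\frac12$, $\frac{B-1}2>\alpha$, and let $\phi$ be positive-homogeneous of degree $\alpha$ (that is, $\phi(rx)=r^\alpha\phi(x)$ for all $r>0$ and $x\in\mathbb R$), not constant on $\mathbb R\setminus\{0\}$. With $a=\phi(1)$ and $b=-\phi(-1)$ put $\mathrm J_\phi(c)=(a^2+b^2)\mathrm J_\alpha(c)-2ab\,\mathrm J_\alpha(-c)$; put $c_B=\frac{-1}{B-1}$, $K=\mathsf c_\alpha\left(\frac{B-1}2\right)_\alpha^{-1}\left(\frac{B-1}2\right)^\alpha$ and $\upsilon^*=K(\mathrm J_\phi(1)-\mathrm J_\phi(c_B))$. The matrix $\Sigma^*$ with diagonal entries $K\mathrm J_\phi(1)$ and off-diagonal entries $K\mathrm J_\phi(c_B)$ is the unique fixed point of $\Sigma\mapsto\mathrm V_{\mathcal B_\phi}(\Sigma)$ among the positive semidefinite matrices that have one common diagonal entry and one common, different, off-diagonal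 entry (the BSB1 fixed point). Moreover $\upsilon^*>0$ and $G\Sigma^*G=\upsilon^*G$. On $\mathcal H^G$, the map $\mathrm V_{\phi\circ\mathsf n}:\Sigma\mapsto\mathrm V_{\phi\circ\mathsf n}(\Sigma)$ is defined near $\upsilon^*G$ and differentiable at $\upsilon^*G$, and $\mathrm J_\phi$ is differentiable at $c_B$. Let $\mathcal U=G^{\otimes 2}\circ D\mathrm V_{\phi\circ\mathsf n}(\upsilon^*G):\mathcal H^G\to\mathcal H^G$. Then $\mathcal H^G=\mathbb RG\oplus\mathbb L\oplus\mathbb M$ with summands of dimensions $1$, $B-1$, $\frac{B(B-3)}2$, and $\mathcal U$ acts on $\mathbb RG$ as $0$, on $\mathbb L$ as $\lambda^\uparrow_{\mathbb L}$ and on $\mathbb M$ as $\lambda^\uparrow_{\mathbb M}$, where $$\lambda^\uparrow_{\mathbb M}=B^\alpha\upsilon^{*-1}2^{-\alpha}\left(\tfrac{B+1}2\right)_\alpha^{-1}\cdot\mathsf c_\alpha\left(\tfrac{B-1}B\right)^{\alpha-1}\mathrm J_\phi'(c_B)=\mathsf c_\alpha B(B-1)^{\alpha-1}\upsilon^{*-1}2^{-\alpha}\left(\tfrac{B+1}2\right)_\alpha^{-1}\mathrm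 J_\phi'(c_B),$$ $$\begin{aligned}\lambda^\uparrow_{\mathbb L}&=B^\alpha\upsilon^{*-1}2^{-\alpha}\left(\tfrac{B+1}2\right)_\alpha^{-1}\cdot\mathsf c_\alpha\left(\tfrac{B-1}B\right)^{\alpha-1}\tfrac1B\left((B-2)\alpha[\mathrm J_\phi(1)-\mathrm J_\phi(c_B)]+\tfrac B{B-1}\mathrm J_\phi'(c_B)\right)\\&=\mathsf c_\alpha(B-1)^{\alpha-1}\upsilon^{*-1}2^{-\alpha}\left(\tfrac{B+1}2\right)_\alpha^{-1}\left((B-2)\alpha[\mathrm J_\phi(1)-\mathrm J_\phi(c_B)]+\tfrac B{B-1}\mathrm J_\phi'(c_B)\right).\end{aligned}$$ Thus the eigenvalues of $\mathcal U$ are exactly $0,\lambda^\uparrow_{\mathbb L},\lambda^\uparrow_{\mathbb M}$; if these three numbers are distinct, their eigenspaces are exactly $\mathbb RG$, $\mathbb L$, $\mathbb M$. **ReLU.** The function $\phi=\mathrm{relu}$ is positive-homogeneous of degree $1$, and $\mathrm J_1(c)=\frac1\pi\left(\sqrt{1-c^2}+(\pi-\arccos c)c\right)$ on $[-1,1]$.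 For $\phi=\mathrm{relu}$ and every $B>3$ one has $\upsilon^*=\frac12\left(1-\mathrm J_1\left(\frac{-1}{B-1}\right)\right)$ and $$\lambda^\uparrow_{\mathbb L}=\frac1{2(B+1)\upsilon^*}\left((B-2)\left[1-\mathrm J_1\left(\tfrac{-1}{B-1}\right)\right]+\tfrac B{B-1}\mathrm J_1'\left(\tfrac{-1}{B-1}\right)\right),\qquad \lambda^\uparrow_{\mathbb M}=\frac B{2(B+1)\upsilon^*}\mathrm J_1'\left(\tfrac{-1}{B-1}\right).$$ The numbers $0,\lambda^\uparrow_{\mathbb L},\lambda^\uparrow_{\mathbb M}$ are distinct, and $\mathbb L$, $\mathbb M$ are exactly the eigenspaces of $G^{\otimes2}\circ D\mathrm V_{\phi\circ\mathsf n}(\upsilon^*G)\circ G^{\otimes2}:\mathcal H\to\mathcal H$ for $\lambda^\uparrow_{\mathbb L}$, $\lambda^\uparrow_{\mathbb M}$. As functions of the integer $B\ge4$, $\lambda^\uparrow_{\mathbb L}$ and $\lambda^\uparrow_{\mathbb M}$ are strictly increasing, and as $B\to\infty$ they tend to $1$ and to $\frac{\pi}{2(\pi-1)}$ respectively. -/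

import Mathlib

open MeasureTheory ProbabilityTheory Filter Topology

noncomputable section

namespace BatchNorm

/-! ### Matrices -/

/-- The centering projection `G = I - (1/B) 𝟙𝟙ᵀ`. -/
def gMat (B : ℕ) : Matrix (Fin B) (Fin B) ℝ :=
  1 - (B : ℝ)⁻¹ • Matrix.of (fun _ _ => (1 : ℝ))

theorem gMat_transpose (B : ℕ) : (gMat B).transpose = gMat B := by
  ext i j
  simp [gMat, Matrix.one_apply, eq_comm]

theorem gMat_mul_gMat (B : ℕ) : gMat B * gMat B = gMat B := by
  rcases Nat.eq_zero_or_pos B with rfl | hB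
  · ext i
    exact i.elim0
  · have hB' : (B : ℝ) ≠ 0 := by positivity
    have h1 : (Matrix.of (fun _ _ => (1 : ℝ)) : Matrix (Fin B) (Fin B) ℝ) *
        Matrix.of (fun _ _ => (1 : ℝ)) = (B : ℝ) • Matrix.of (fun _ _ => (1 : ℝ)) := by
      ext i j
      simp [Matrix.mul_apply]
    simp only [gMat, sub_mul, mul_sub, one_mul, mul_one, smul_mul_assoc, mul_smul_comm, h1,
      smul_smul]
    rw [inv_mul_cancel₀ hB', one_smul, sub_self, smul_zero, sub_zero]

/-- The space of real symmetric `B × B` matrices. -/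
def Sym (B : ℕ) : Submodule ℝ (Matrix (Fin B) (Fin B) ℝ) where
  carrier := {S | S.IsSymm}
  add_mem' := fun ha hb => Matrix.IsSymm.add ha hb
  zero_mem' := Matrix.isSymm_zero
  smul_mem' := fun c _ ha => Matrix.IsSymm.smul ha c

/-- The space of symmetric matrices `S` with `G S G = S`. -/
def SymG (B : ℕ) : Submodule ℝ (Matrix (Fin B) (Fin B) ℝ) where
  carrier := {S | S.IsSymm ∧ gMat B * S * gMat B = S}
  add_mem' := fun ha hb =>
    ⟨Matrix.IsSymm.add ha.1 hb.1, by rw [mul_add, add_mul, ha.2, hb.2]⟩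
  zero_mem' := ⟨Matrix.isSymm_zero, by simp⟩
  smul_mem' := fun c _ ha =>
    ⟨Matrix.IsSymm.smul ha.1 c, by rw [mul_smul_comm, smul_mul_assoc, ha.2]⟩

theorem SymG_le_Sym (B : ℕ) : SymG B ≤ Sym B := fun _ h => h.1

/-- The inclusion of `SymG B` into `Sym B`. -/
def inclG (B : ℕ) : SymG B →ₗ[ℝ] Sym B := Submodule.inclusion (SymG_le_Sym B)

/-- The operator `G^{⊗2} : S ↦ G S G`, from symmetric matrices to `SymG`. -/
def centerSym (B : ℕ) : Sym B →ₗ[ℝ] SymG B where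
  toFun S := ⟨gMat B * (S : Matrix (Fin B) (Fin B) ℝ) * gMat B, by
    refine ⟨?_, ?_⟩
    · have hS : (S : Matrix (Fin B) (Fin B) ℝ).transpose = S := S.2
      rw [Matrix.IsSymm, Matrix.transpose_mul, Matrix.transpose_mul, hS, gMat_transpose, mul_assoc]
    · rw [mul_assoc, mul_assoc, mul_assoc, gMat_mul_gMat, ← mul_assoc, ← mul_assoc,
        gMat_mul_gMat]⟩
  map_add' := fun S T => Subtype.ext (by simp [mul_add, add_mul])
  map_smul' := fun c S => Subtype.ext (by simp)

/-- `G` as an element of `SymG`. -/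
def gElt (B : ℕ) : SymG B :=
  ⟨gMat B, gMat_transpose B, by rw [gMat_mul_gMat, gMat_mul_gMat]⟩

/-- The matrix with `a` on the diagonal and `b` off the diagonal. -/
def bsb1 (B : ℕ) (a b : ℝ) : Sym B :=
  ⟨Matrix.of fun i j => if i = j then a else b, by
    ext i j
    simp [eq_comm]⟩

/-- The line `ℝ G`. -/
def lineG (B : ℕ) : Submodule ℝ (SymG B) := Submodule.span ℝ {gElt B}

/-- `𝕃 = {G D G : D diagonal, tr D = 0}`. -/
def LSpace (B : ℕ) : Submodule ℝ (SymG B) where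
  carrier := {S | ∃ d : Fin B → ℝ, ∑ i, d i = 0 ∧
    (S : Matrix (Fin B) (Fin B) ℝ) = gMat B * Matrix.diagonal d * gMat B}
  add_mem' := by
    rintro S T ⟨d, hd, hS⟩ ⟨e, he, hT⟩
    refine ⟨d + e, by simp [Finset.sum_add_distrib, hd, he], ?_⟩
    have h : Matrix.diagonal (d + e) = Matrix.diagonal d + Matrix.diagonal e :=
      (Matrix.diagonal_add d e).symm
    rw [h, mul_add, add_mul, ← hS, ← hT]
    rfl
  zero_mem' := ⟨0, by simp, by simp⟩
  smul_mem' := by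
    rintro c S ⟨d, hd, hS⟩
    refine ⟨c • d, by simp [← Finset.mul_sum, hd], ?_⟩
    rw [Matrix.diagonal_smul, mul_smul_comm, smul_mul_assoc, ← hS]
    rfl

/-- `𝕄 = {S ∈ SymG : Diag S = 0}`. -/
def MSpace (B : ℕ) : Submodule ℝ (SymG B) where
  carrier := {S | ∀ i, (S : Matrix (Fin B) (Fin B) ℝ) i i = 0}
  add_mem' := fun {S T} hS hT i => by
    have h1 := hS i
    have h2 := hT i
    simp [h1, h2]
  zero_mem' := fun i => by simp
  smul_mem' := fun c S hS i => by
    have h1 := hS i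
    simp [h1]

/-! ### Batch normalization and the integral transform `V` -/

/-- `𝗇(x) = √B x / ‖x‖` followed by the coordinatewise application of `φ`. -/
def phiN {B : ℕ} (φ : ℝ → ℝ) (x : EuclideanSpace ℝ (Fin B)) (i : Fin B) : ℝ :=
  φ (√(B : ℝ) * x i / ‖x‖)

/-- `B_φ(h) = φ(√B G h / ‖G h‖)`, batchnorm followed by `φ` in each coordinate. -/
def batchnorm {B : ℕ} (φ : ℝ → ℝ) (h : EuclideanSpace ℝ (Fin B)) : Fin B → ℝ :=
  phiN φ (WithLp.toLp 2 ((gMat B).mulVec h.ofLp))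

/-- `V_Φ(Σ) = E[Φ(h) Φ(h)ᵀ : h ∼ N(0, Σ)]`, for positive semidefinite `Σ`. -/
def vt {B : ℕ} (Φ : EuclideanSpace ℝ (Fin B) → Fin B → ℝ) (S : Matrix (Fin B) (Fin B) ℝ) :
    Sym B :=
  ⟨Matrix.of fun i j => ∫ h, Φ h i * Φ h j ∂(multivariateGaussian 0 S), by
    ext i j
    simp [mul_comm]⟩

/-- `V_Φ(Σ)` makes sense: `Σ` is positive semidefinite and the expectations exist. -/
def VtDefined {B : ℕ} (Φ : EuclideanSpace ℝ (Fin B) → Fin B → ℝ)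
    (S : Matrix (Fin B) (Fin B) ℝ) : Prop :=
  S.PosSemidef ∧ ∀ i j, Integrable (fun h => Φ h i * Φ h j) (multivariateGaussian 0 S)

/-- `S` is a BSB1 fixed point of the recursion `Σ ↦ V_{B_φ}(Σ)`. A BSB1 matrix whose diagonal and
off-diagonal entries agree is excluded: a Gaussian vector with that covariance is almost surely
constant over the batch, where batch normalization is undefined. -/
def IsBSB1FixedPoint {B : ℕ} (φ : ℝ → ℝ) (S : Sym B) : Prop :=
  (∃ a b : ℝ, a ≠ b ∧ S = bsb1 B a b) ∧
    VtDefined (batchnorm φ) (S : Matrix (Fin B) (Fin B) ℝ) ∧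
    vt (batchnorm φ) (S : Matrix (Fin B) (Fin B) ℝ) = S

/-- The map `Σ^G ↦ V_{φ ∘ 𝗇}(Σ^G)` from `SymG` to symmetric matrices. -/
def vtG (B : ℕ) (φ : ℝ → ℝ) (S : SymG B) : Sym B :=
  vt (phiN φ) (S : Matrix (Fin B) (Fin B) ℝ)

/-- `U = G^{⊗2} ∘ (d V_{φ∘𝗇}(Σ^G) / d Σ^G) |_{Σ^G = G Σ G} : SymG → SymG`. -/
def forwardOp {B : ℕ} (φ : ℝ → ℝ) (S : Sym B) : SymG B →ₗ[ℝ] SymG B :=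
  centerSym B ∘ₗ (fderiv ℝ (vtG B φ) (centerSym B S)).toLinearMap

/-- `G^{⊗2} ∘ (d V_{φ∘𝗇}(Σ^G) / d Σ^G) |_{Σ^G = G Σ G} ∘ G^{⊗2}`, on all symmetric matrices. -/
def forwardOpSym {B : ℕ} (φ : ℝ → ℝ) (S : Sym B) : Sym B →ₗ[ℝ] Sym B :=
  inclG B ∘ₗ forwardOp φ S ∘ₗ centerSym B

/-! ### Positive-homogeneous functions and the constants of the closed forms -/

/-- `φ` is positive-homogeneous of degree `α`. -/
def IsPosHom (α : ℝ) (φ : ℝ → ℝ) : Prop := ∀ r x : ℝ, 0 < r → φ (r * x) = r ^ α * φ x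

def relu (x : ℝ) : ℝ := max x 0

/-- Pochhammer symbol `Γ(a + b) / Γ(a)`. -/
def poch (a b : ℝ) : ℝ := Real.Gamma (a + b) / Real.Gamma a

/-- `c_α = 2^{α-1} Γ(α + 1/2) / √π`. -/
def cAlpha (α : ℝ) : ℝ := 1 / √Real.pi * (2 : ℝ) ^ (α - 1) * Real.Gamma (α + 1 / 2)

/-- `J_α` as a function of the angle `θ`. -/
def jAngle (α θ : ℝ) : ℝ :=
  1 / (2 * Real.pi * cAlpha α) * Real.sin θ ^ (2 * α + 1) * Real.Gamma (α + 1) *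
    ∫ η in (0 : ℝ)..(Real.pi / 2), Real.cos η ^ α / (1 - Real.cos θ * Real.cos η) ^ (1 + α)

/-- `J_α(c) = J_α(arccos c)`. At `c = 1` the integral expression is of the form `0 · ∞`, and the
value is the limit `1`. -/
def jAlpha (α c : ℝ) : ℝ := if c = 1 then 1 else jAngle α (Real.arccos c)

/-- `J_φ(c) = (a² + b²) J_α(c) - 2 a b J_α(-c)`, where `φ(x) = a ρ_α(x) - b ρ_α(-x)` for `x ≠ 0`
with the `α`-ReLU `ρ_α`, that is, `a = φ(1)` and `b = -φ(-1)`. -/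
def jPhi (α : ℝ) (φ : ℝ → ℝ) (c : ℝ) : ℝ :=
  ((φ 1) ^ 2 + (-φ (-1)) ^ 2) * jAlpha α c - 2 * φ 1 * (-φ (-1)) * jAlpha α (-c)

/-- The correlation `-1/(B-1)`. -/
def cB (B : ℕ) : ℝ := -1 / ((B : ℝ) - 1)

/-- `K_{α,B} = c_α ((B-1)/2)_α⁻¹ ((B-1)/2)^α`. -/
def kAlpha (α : ℝ) (B : ℕ) : ℝ :=
  cAlpha α * (poch (((B : ℝ) - 1) / 2) α)⁻¹ * (((B : ℝ) - 1) / 2) ^ α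

/-- The BSB1 matrix with entries `K J_φ(1)` on and `K J_φ(-1/(B-1))` off the diagonal. -/
def sigmaStar (α : ℝ) (φ : ℝ → ℝ) (B : ℕ) : Sym B :=
  bsb1 B (kAlpha α B * jPhi α φ 1) (kAlpha α B * jPhi α φ (cB B))

/-- `υ* = K_{α,B} (J_φ(1) - J_φ(-1/(B-1)))`. -/
def upsilonStar (α : ℝ) (φ : ℝ → ℝ) (B : ℕ) : ℝ :=
  kAlpha α B * (jPhi α φ 1 - jPhi α φ (cB B))

/-- `c_α ((B-1)/B)^{α-1} J_φ'(-1/(B-1))`. -/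
def lamMG (α : ℝ) (φ : ℝ → ℝ) (B : ℕ) : ℝ :=
  cAlpha α * (((B : ℝ) - 1) / B) ^ (α - 1) * deriv (jPhi α φ) (cB B)

/-- `c_α ((B-1)/B)^{α-1} (1/B) ((B-2) α [J_φ(1) - J_φ(c)] + (B/(B-1)) J_φ'(c))` at
`c = -1/(B-1)`. -/
def lamLG (α : ℝ) (φ : ℝ → ℝ) (B : ℕ) : ℝ :=
  cAlpha α * (((B : ℝ) - 1) / B) ^ (α - 1) * (1 / (B : ℝ)) *
    (((B : ℝ) - 2) * α * (jPhi α φ 1 - jPhi α φ (cB B)) +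
      (B : ℝ) / ((B : ℝ) - 1) * deriv (jPhi α φ) (cB B))

/-- The closed form of the eigenvalue on `𝕄`. -/
def lamM (α : ℝ) (φ : ℝ → ℝ) (B : ℕ) : ℝ :=
  cAlpha α * B * ((B : ℝ) - 1) ^ (α - 1) * (upsilonStar α φ B)⁻¹ * (2 : ℝ) ^ (-α) *
    (poch (((B : ℝ) + 1) / 2) α)⁻¹ * deriv (jPhi α φ) (cB B)

/-- The closed form of the eigenvalue on `𝕃`. -/
def lamL (α : ℝ) (φ : ℝ → ℝ) (B : ℕ) : ℝ :=
  cAlpha α * ((B : ℝ) - 1) ^ (α - 1) * (upsilonStar α φ B)⁻¹ * (2 : ℝ) ^ (-α) *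
    (poch (((B : ℝ) + 1) / 2) α)⁻¹ *
    (((B : ℝ) - 2) * α * (jPhi α φ 1 - jPhi α φ (cB B)) +
      (B : ℝ) / ((B : ℝ) - 1) * deriv (jPhi α φ) (cB B))

end BatchNorm

end

namespace BatchNorm

/-! ### The decomposition of `SymG` -/

/-! Scale invariance of `𝗇` separates direction from radius, which reduces every quantity to
bivariate Gaussian moments of `φ` itself, without normalization.

An orthonormal basis of the hyperplane of sum-zero vectors is a matrix `W` with `WᵀW = 1` and `WWᵀ =
G` (`exists_orthonormal_columns`). For `S` in `SymG` near `G` it presents `N(0, S)` as the image of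
a nondegenerate Gaussian on `ℝ^(B-1)` with precision `P = (WᵀSW)⁻¹`. Differentiating the density in
`P` under the integral, and composing with inversion, shows that the derivative of `E f` at `G` in
direction `T` is half the covariance of `f` with the quadratic form `q(z) = ⟪z, WᵀTW z⟫`
(`hasFDerivAt_integral_chart`); no smoothness of `φ` enters. Since `E q = tr T`, only `E[f q] / 2`
survives for trace-zero `T`.

Two homogeneous functions that are proportional on the unit sphere have Gaussian expectations whose
ratio is that of two radial Gamma integrals (`gaussAvg_eq_of_homogeneous`). Comparing `φ ∘ 𝗇` with
`φ` gives the factor `B^α 2^(-α) / (a)_α`, where `a = (B-1)/2` for values and `a = (B+1)/2` for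
derivatives, because `q` raises the degree by two. So in trace-zero directions the derivative of the
transform is a constant multiple of the derivative of `E[φ(x_i) φ(x_j)]` along `G + tT`
(`IsPosHom.hasFDerivAt_vtG_gElt`). That moment equals `c_α (st)^α J_φ(c)` for standard deviations
`s, t` and correlation `c` (`IsPosHom.integral_eval_mul`, resting on the planar polar integral
`integral_quadrant`).

The chain rule then gives the three scalars. On `𝕄` only the correlations move, leaving `J_φ'`. On
`𝕃`, the image of `G D G` combines `G D G`, `D` and a matrix `u_i + u_j`; centering kills the last
and returns `D` to `G D G`. On `ℝG` the transform is constant. For the fixed point, centering a BSB1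
matrix gives a multiple of `G`, so the recursion sends all nondegenerate ones to the same matrix
`Σ*`. Positivity of `υ*` holds because `E[(φ(x_i) - φ(x_j))²]` is a positive multiple of it.

For ReLU put `r = J_1' / (1 - J_1)`. Then `λ_𝕄 = B/(B+1) · r(c_B)` and `λ_𝕃 = 1 - 3/(B+1) +
λ_𝕄/(B-1)`. Monotonicity and limits follow since `r` increases strictly on `[-1, 0]` with `r(0) =
π/(2(π-1)) < 3/4`, while `c_B` increases to `0`; distinctness is `r(c)(1-c) < 1`, which amounts to
`sin θ < θ`. -/

theorem gMat_apply (B : ℕ) (i j : Fin B) :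
    gMat B i j = (if i = j then 1 else 0) - (B : ℝ)⁻¹ := by
  simp [gMat, Matrix.one_apply]

theorem gMat_mul_apply {B : ℕ} (A : Matrix (Fin B) (Fin B) ℝ) (i j : Fin B) :
    (gMat B * A) i j = A i j - (B : ℝ)⁻¹ * ∑ k, A k j := by
  simp [Matrix.mul_apply, gMat_apply, sub_mul, Finset.sum_sub_distrib, Finset.mul_sum]

theorem mul_gMat_apply {B : ℕ} (A : Matrix (Fin B) (Fin B) ℝ) (i j : Fin B) :
    (A * gMat B) i j = A i j - (B : ℝ)⁻¹ * ∑ k, A i k := by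
  simp [Matrix.mul_apply, gMat_apply, mul_sub, Finset.sum_sub_distrib, ← Finset.sum_mul, mul_comm]

theorem gMat_conj_apply {B : ℕ} (A : Matrix (Fin B) (Fin B) ℝ) (i j : Fin B) :
    (gMat B * A * gMat B) i j = A i j - (B : ℝ)⁻¹ * ∑ k, A k j
      - (B : ℝ)⁻¹ * ∑ k, (A i k - (B : ℝ)⁻¹ * ∑ l, A l k) := by
  simp_rw [mul_gMat_apply, gMat_mul_apply]

theorem symG_apply_comm {B : ℕ} (S : SymG B) (i j : Fin B) :
    (S : Matrix (Fin B) (Fin B) ℝ) i j = (S : Matrix (Fin B) (Fin B) ℝ) j i :=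
  (S.2.1.apply i j).symm

theorem symG_sum_row {B : ℕ} (S : SymG B) (i : Fin B) :
    ∑ j, (S : Matrix (Fin B) (Fin B) ℝ) i j = 0 := by
  have hB : B ≠ 0 := by rintro rfl; exact i.elim0
  have hB' : (B : ℝ) ≠ 0 := by exact_mod_cast hB
  have h : ∀ j, (S : Matrix (Fin B) (Fin B) ℝ) i j
      = (gMat B * (S : Matrix (Fin B) (Fin B) ℝ) * gMat B) i j := fun j => by rw [S.2.2]
  simp_rw [h, mul_gMat_apply, Finset.sum_sub_distrib]
  simp [hB']

theorem mem_SymG_of_sum_row {B : ℕ} {A : Matrix (Fin B) (Fin B) ℝ} (hA : A.IsSymm)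
    (h : ∀ i, ∑ j, A i j = 0) : A ∈ SymG B := by
  refine ⟨hA, ?_⟩
  have h' : ∀ j, ∑ i, A i j = 0 := fun j => by
    rw [← h j]; exact Finset.sum_congr rfl fun i _ => hA.apply j i
  ext i j
  rw [gMat_conj_apply]
  simp [h, h']

theorem conj_diagonal_apply {B : ℕ} (d : Fin B → ℝ) (hd : ∑ i, d i = 0) (i j : Fin B) :
    (gMat B * Matrix.diagonal d * gMat B) i j =
      (if i = j then d i else 0) - (B : ℝ)⁻¹ * d i - (B : ℝ)⁻¹ * d j := by
  rw [gMat_conj_apply]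
  simp [Matrix.diagonal_apply, Finset.sum_sub_distrib, ← Finset.mul_sum, hd]
  ring

/-- The factor `1 - 2/B` is nonzero for `B > 2`, so an element of `𝕃` is determined by its diagonal.
This gives both the dimension of `𝕃` and its independence from `𝕄`. -/
theorem conj_diagonal_diag {B : ℕ} (d : Fin B → ℝ) (hd : ∑ i, d i = 0) (i : Fin B) :
    (gMat B * Matrix.diagonal d * gMat B) i i = (1 - 2 / (B : ℝ)) * d i := by
  rw [conj_diagonal_apply d hd, if_pos rfl]
  ring

/-- The diagonal matrices of trace zero, mapped to `LSpace`. -/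
noncomputable def diagToL (B : ℕ) :
    LinearMap.ker (∑ i, LinearMap.proj i : (Fin B → ℝ) →ₗ[ℝ] ℝ) →ₗ[ℝ] SymG B where
  toFun d := centerSym B ⟨Matrix.diagonal d, Matrix.isSymm_diagonal _⟩
  map_add' d e := by
    rw [← map_add]
    congr 1
    exact Subtype.ext (Matrix.diagonal_add _ _).symm
  map_smul' c d := by
    rw [RingHom.id_apply, ← map_smul]
    congr 1
    exact Subtype.ext (Matrix.diagonal_smul _ _)

theorem coe_diagToL {B : ℕ} (d : LinearMap.ker (∑ i, LinearMap.proj i : (Fin B → ℝ) →ₗ[ℝ] ℝ)) :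
    (diagToL B d : Matrix (Fin B) (Fin B) ℝ) = gMat B * Matrix.diagonal d * gMat B := rfl

theorem sum_eq_zero_of_mem_ker {B : ℕ}
    (d : LinearMap.ker (∑ i, LinearMap.proj i : (Fin B → ℝ) →ₗ[ℝ] ℝ)) :
    ∑ i, (d : Fin B → ℝ) i = 0 := by
  have h := LinearMap.mem_ker.1 d.2
  simpa only [LinearMap.sum_apply, LinearMap.proj_apply] using h

theorem range_diagToL (B : ℕ) : LinearMap.range (diagToL B) = LSpace B := by
  ext S
  constructor
  · rintro ⟨d, rfl⟩
    exact ⟨d, sum_eq_zero_of_mem_ker d, rfl⟩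
  · rintro ⟨d, hd, hS⟩
    exact ⟨⟨d, by simpa [LinearMap.mem_ker] using hd⟩, Subtype.ext hS.symm⟩

theorem one_sub_two_div_pos {B : ℕ} (hB : 4 ≤ B) : 0 < 1 - 2 / (B : ℝ) := by
  have : (4 : ℝ) ≤ B := by exact_mod_cast hB
  rw [sub_pos, div_lt_one (by linarith)]
  linarith

theorem injective_diagToL {B : ℕ} (hB : 4 ≤ B) : Function.Injective (diagToL B) := by
  rw [injective_iff_map_eq_zero]
  intro d hd
  ext i
  have h := conj_diagonal_diag d (sum_eq_zero_of_mem_ker d) i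
  rw [← coe_diagToL, hd] at h
  have := (one_sub_two_div_pos hB).ne'
  simpa [this] using h

theorem finrank_LSpace {B : ℕ} (hB : 4 ≤ B) : Module.finrank ℝ (LSpace B) = B - 1 := by
  rw [← range_diagToL, LinearMap.finrank_range_of_inj (injective_diagToL hB)]
  set f := (∑ i, LinearMap.proj i : (Fin B → ℝ) →ₗ[ℝ] ℝ)
  have hf : LinearMap.range f = ⊤ := by
    refine LinearMap.range_eq_top.2 fun x => ⟨Pi.single ⟨0, by omega⟩ x, ?_⟩
    simp [f]
  have h := LinearMap.finrank_range_add_finrank_ker f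
  rw [hf] at h
  simp at h
  omega

theorem gElt_ne_zero {B : ℕ} (hB : 4 ≤ B) : gElt B ≠ 0 := by
  intro h
  have h' : gMat B ⟨0, by omega⟩ ⟨1, by omega⟩ = 0 :=
    congrFun (congrFun (congrArg Subtype.val h) _) _
  rw [gMat_apply] at h'
  have : (B : ℝ) ≠ 0 := by positivity
  simp [this] at h'

theorem finrank_lineG {B : ℕ} (hB : 4 ≤ B) : Module.finrank ℝ (lineG B) = 1 :=
  finrank_span_singleton (gElt_ne_zero hB)

/-- The symmetric matrix with zero diagonal and off-diagonal entries given by a function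
on unordered pairs. -/
noncomputable def offDiag (B : ℕ) :
    ({e : Sym2 (Fin B) // ¬e.IsDiag} → ℝ) →ₗ[ℝ] Matrix (Fin B) (Fin B) ℝ where
  toFun x := Matrix.of fun i j => if h : i = j then 0 else x ⟨s(i, j), by simpa using h⟩
  map_add' x y := by
    ext i j
    by_cases h : i = j <;> simp [h]
  map_smul' c x := by
    ext i j
    by_cases h : i = j <;> simp [h]

theorem offDiag_isSymm {B : ℕ} (x : {e : Sym2 (Fin B) // ¬e.IsDiag} → ℝ) :
    (offDiag B x).IsSymm := by
  ext i j
  by_cases h : i = j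
  · simp [offDiag, h]
  · simp [offDiag, h, Ne.symm h, Sym2.eq_swap]

/-- The row sums of `offDiag`. -/
noncomputable def offDiagRow (B : ℕ) :
    ({e : Sym2 (Fin B) // ¬e.IsDiag} → ℝ) →ₗ[ℝ] (Fin B → ℝ) where
  toFun x i := ∑ j, offDiag B x i j
  map_add' x y := by
    ext i
    simp [Finset.sum_add_distrib]
  map_smul' c x := by
    ext i
    simp [Finset.mul_sum]

/-- With entries `u i + u j` off the diagonal, row `i` sums to `(B - 2) u i + ∑ u`, which can be
solved for `u`. The `B` row-sum constraints are therefore independent, and `𝕄` has dimension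
`B(B-1)/2 - B`. -/
theorem surjective_offDiagRow {B : ℕ} (hB : 4 ≤ B) : Function.Surjective (offDiagRow B) := by
  intro v
  have hB' : (4 : ℝ) ≤ B := by exact_mod_cast hB
  -- Summing `(B - 2) u i + U = v i` over `i`, with `U = ∑ u i`, forces this value.
  set U := (∑ i, v i) / (2 * ((B : ℝ) - 1)) with hU
  let u : Fin B → ℝ := fun i => (v i - U) / ((B : ℝ) - 2)
  have h1 : (B : ℝ) - 1 ≠ 0 := by linarith
  have h2 : (B : ℝ) - 2 ≠ 0 := by linarith
  have hu : ∑ i, u i = U := by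
    simp only [u, ← Finset.sum_div, Finset.sum_sub_distrib]
    rw [show ∑ i, v i = 2 * ((B : ℝ) - 1) * U by rw [hU]; field_simp]
    simp
    field_simp
    ring
  refine ⟨fun e => Sym2.lift ⟨fun i j => u i + u j, fun i j => add_comm _ _⟩ e.1, ?_⟩
  ext i
  have h : ∀ j, offDiag B (fun e => Sym2.lift ⟨fun i j => u i + u j, fun i j => add_comm _ _⟩ e.1)
      i j = (u i + u j) - if i = j then 2 * u i else 0 := by
    intro j
    by_cases h : i = j
    · subst h; simp [offDiag]; ring
    · simp [offDiag, h]
  simp only [offDiagRow, LinearMap.coe_mk, AddHom.coe_mk, h, Finset.sum_sub_distrib,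
    Finset.sum_add_distrib, hu]
  simp [u]
  field_simp
  ring

/-- Matrices with zero diagonal and zero row sums, as elements of `SymG`. -/
noncomputable def offDiagToM (B : ℕ) : LinearMap.ker (offDiagRow B) →ₗ[ℝ] SymG B where
  toFun x := ⟨offDiag B x, mem_SymG_of_sum_row (offDiag_isSymm _) fun i => congrFun x.2 i⟩
  map_add' x y := Subtype.ext (by simp)
  map_smul' c x := Subtype.ext (by simp)

theorem injective_offDiagToM (B : ℕ) : Function.Injective (offDiagToM B) := by
  rw [injective_iff_map_eq_zero]
  intro x hx
  ext ⟨e, he⟩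
  induction e with | _ i j =>
  have h : offDiag B x i j = 0 := congrFun (congrFun (congrArg Subtype.val hx) i) j
  have hij : i ≠ j := by simpa using he
  simpa [offDiag, hij] using h

theorem range_offDiagToM (B : ℕ) : LinearMap.range (offDiagToM B) = MSpace B := by
  ext S
  constructor
  · rintro ⟨x, rfl⟩ i
    simp [offDiagToM, offDiag]
  · intro hS
    let x : {e : Sym2 (Fin B) // ¬e.IsDiag} → ℝ := fun e =>
      Sym2.lift ⟨fun i j => (S : Matrix (Fin B) (Fin B) ℝ) i j, fun i j => symG_apply_comm S i j⟩ e.1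
    have hx : offDiag B x = S := by
      ext i j
      by_cases h : i = j
      · subst h; simp [offDiag, hS i]
      · simp [offDiag, h, x]
    refine ⟨⟨x, ?_⟩, Subtype.ext hx⟩
    rw [LinearMap.mem_ker]
    ext i
    simp [offDiagRow, hx, symG_sum_row S]

theorem finrank_MSpace {B : ℕ} (hB : 4 ≤ B) :
    Module.finrank ℝ (MSpace B) = B * (B - 3) / 2 := by
  rw [← range_offDiagToM, LinearMap.finrank_range_of_inj (injective_offDiagToM B)]
  have h := LinearMap.finrank_range_add_finrank_ker (offDiagRow B)
  rw [LinearMap.range_eq_top.2 (surjective_offDiagRow hB)] at h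
  simp only [finrank_top, Module.finrank_fintype_fun_eq_card, Fintype.card_fin,
    Sym2.card_subtype_not_diag, Nat.choose_two_right] at h
  obtain ⟨k, rfl⟩ := Nat.exists_eq_add_of_le hB
  -- `B(B-1) = B(B-3) + 2B`, so the two natural-number halves differ by exactly `B`.
  have e1 : (4 + k) * (4 + k - 1) = (4 + k) * (4 + k - 3) + 2 * (4 + k) := by
    rw [show 4 + k - 1 = k + 3 by omega, show 4 + k - 3 = k + 1 by omega]; ring
  rw [e1, Nat.add_mul_div_left _ _ two_pos] at h
  omega

/-- Only the diagonal has to be matched: `ℝG` supplies its mean and `𝕃` the deviations from the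
mean. What remains has zero diagonal and so lies in `𝕄`. -/
theorem exists_decomposition {B : ℕ} (hB : 4 ≤ B) (S : SymG B) :
    ∃ x ∈ lineG B, ∃ y ∈ LSpace B, ∃ z ∈ MSpace B, S = x + y + z := by
  have hB' : (4 : ℝ) ≤ B := by exact_mod_cast hB
  set t := ∑ i, (S : Matrix (Fin B) (Fin B) ℝ) i i with ht
  -- The factor `B/(B-2)` inverts the one in `conj_diagonal_diag`.
  let d : Fin B → ℝ := fun i =>
    ((S : Matrix (Fin B) (Fin B) ℝ) i i - t / B) * ((B : ℝ) / (B - 2))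
  have hd : ∑ i, d i = 0 := by
    simp only [d, ← Finset.sum_mul, Finset.sum_sub_distrib, ← ht]
    simp
    left
    field_simp
    ring
  -- Since `tr G = B - 1`, this term carries the whole trace.
  let x : SymG B := (t / ((B : ℝ) - 1)) • gElt B
  let y : SymG B := centerSym B ⟨Matrix.diagonal d, Matrix.isSymm_diagonal _⟩
  refine ⟨x, Submodule.smul_mem _ _ (Submodule.mem_span_singleton_self _), y, ⟨d, hd, rfl⟩,
    S - x - y, fun i => ?_, by abel⟩
  have hx : (x : Matrix (Fin B) (Fin B) ℝ) i i = t / ((B : ℝ) - 1) * (1 - (B : ℝ)⁻¹) := by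
    change (t / ((B : ℝ) - 1)) * gMat B i i = _
    simp [gMat_apply]
  have hy : (y : Matrix (Fin B) (Fin B) ℝ) i i = (1 - 2 / (B : ℝ)) * d i :=
    conj_diagonal_diag d hd i
  simp only [Submodule.coe_sub, Matrix.sub_apply, hx, hy, d]
  have h1 : (B : ℝ) - 1 ≠ 0 := by linarith
  have h2 : (B : ℝ) - 2 ≠ 0 := by linarith
  field_simp
  ring

/-- Reading the diagonal removes the `𝕄` component, and summing it removes the `𝕃` component, which
leaves the coefficient of `G`. -/
theorem eq_zero_of_add_add_eq_zero {B : ℕ} (hB : 4 ≤ B) {x y z : SymG B} (hx : x ∈ lineG B)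
    (hy : y ∈ LSpace B) (hz : z ∈ MSpace B) (h : x + y + z = 0) : x = 0 ∧ y = 0 ∧ z = 0 := by
  have hB' : (4 : ℝ) ≤ B := by exact_mod_cast hB
  obtain ⟨c, rfl⟩ := Submodule.mem_span_singleton.1 hx
  obtain ⟨d, hd, hy⟩ := hy
  have hi : ∀ i, c * (1 - (B : ℝ)⁻¹) + (1 - 2 / (B : ℝ)) * d i = 0 := by
    intro i
    have h1 : ((c • gElt B + y + z : SymG B) : Matrix (Fin B) (Fin B) ℝ) i i = 0 := by rw [h]; rfl
    have h2 : (gElt B : Matrix (Fin B) (Fin B) ℝ) i i = 1 - (B : ℝ)⁻¹ := by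
      change gMat B i i = _
      simp [gMat_apply]
    simpa [h2, hy, conj_diagonal_diag d hd, hz i] using h1
  have hc : c = 0 := by
    have h3 : ∑ i : Fin B, (c * (1 - (B : ℝ)⁻¹) + (1 - 2 / (B : ℝ)) * d i) = 0 :=
      Finset.sum_eq_zero fun i _ => hi i
    rw [Finset.sum_add_distrib, ← Finset.mul_sum _ d, hd] at h3
    simp at h3
    rcases h3 with h3 | h3 | h3
    · linarith
    · exact h3
    · exfalso
      have : (B : ℝ)⁻¹ < 1 := inv_lt_one_of_one_lt₀ (by linarith)
      linarith
  subst hc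
  have hd0 : d = 0 := by
    ext i
    have := hi i
    simpa [(one_sub_two_div_pos hB).ne'] using this
  have hy0 : y = 0 := Subtype.ext (by rw [hy, hd0]; simp)
  refine ⟨by simp, hy0, ?_⟩
  simpa [hy0] using h

theorem isInternal_decomposition {B : ℕ} (hB : 4 ≤ B) :
    DirectSum.IsInternal ![lineG B, LSpace B, MSpace B] := by
  rw [DirectSum.isInternal_submodule_iff_iSupIndep_and_iSup_eq_top]
  constructor
  · rw [iSupIndep_fin_three]
    simp only [Matrix.cons_val]
    simp only [Submodule.disjoint_def, Submodule.mem_sup]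
    refine ⟨?_, ?_, ?_⟩
    · rintro x hx ⟨y, hy, z, hz, h⟩
      have := eq_zero_of_add_add_eq_zero hB (x := -x) (neg_mem hx) hy hz (by rw [← h]; abel)
      simpa using this.1
    · rintro x hx ⟨y, hy, z, hz, h⟩
      have := eq_zero_of_add_add_eq_zero hB (y := -x) hz (neg_mem hx) hy (by rw [← h]; abel)
      simpa using this.2.1
    · rintro x hx ⟨y, hy, z, hz, h⟩
      have := eq_zero_of_add_add_eq_zero hB (z := -x) hy hz (neg_mem hx) (by rw [← h]; abel)
      simpa using this.2.2
  · rw [eq_top_iff]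
    intro S _
    obtain ⟨x, hx, y, hy, z, hz, rfl⟩ := exists_decomposition hB S
    have key : ∀ k : Fin 3, ∀ w ∈ (![lineG B, LSpace B, MSpace B] k),
        w ∈ ⨆ i, ![lineG B, LSpace B, MSpace B] i := fun k w hw =>
      (le_iSup ![lineG B, LSpace B, MSpace B] k) hw
    exact add_mem (add_mem (key 0 x hx) (key 1 y hy)) (key 2 z hz)

/-! ### Operators that are scalar on the three summands -/

section Eigen

variable {B : ℕ} {U : SymG B →ₗ[ℝ] SymG B} {l m : ℝ}

/-- Independence of the summands splits the eigenvector equation into one scalar equation per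
component. -/
theorem apply_eq_smul_cases (hB : 4 ≤ B) (h0 : ∀ S ∈ lineG B, U S = 0)
    (hl : ∀ S ∈ LSpace B, U S = l • S) (hm : ∀ S ∈ MSpace B, U S = m • S) {μ : ℝ}
    {x y z : SymG B} (hx : x ∈ lineG B) (hy : y ∈ LSpace B) (hz : z ∈ MSpace B)
    (h : U (x + y + z) = μ • (x + y + z)) :
    (μ = 0 ∨ x = 0) ∧ (l = μ ∨ y = 0) ∧ (m = μ ∨ z = 0) := by
  have h1 := eq_zero_of_add_add_eq_zero hB (x := -(μ • x)) (y := (l - μ) • y) (z := (m - μ) • z)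
    (neg_mem (Submodule.smul_mem _ _ hx)) (Submodule.smul_mem _ _ hy) (Submodule.smul_mem _ _ hz)
    (by
      rw [map_add, map_add, h0 x hx, hl y hy, hm z hz] at h
      linear_combination (norm := module) h)
  refine ⟨by simpa using h1.1, ?_, ?_⟩
  · simpa [sub_eq_zero] using h1.2.1
  · simpa [sub_eq_zero] using h1.2.2

theorem hasEigenvalue_iff_of_scalar (hB : 4 ≤ B) (h0 : ∀ S ∈ lineG B, U S = 0)
    (hl : ∀ S ∈ LSpace B, U S = l • S) (hm : ∀ S ∈ MSpace B, U S = m • S) (μ : ℝ) :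
    Module.End.HasEigenvalue U μ ↔ μ = 0 ∨ μ = l ∨ μ = m := by
  constructor
  · intro h
    obtain ⟨v, hv⟩ := h.exists_hasEigenvector
    obtain ⟨x, hx, y, hy, z, hz, rfl⟩ := exists_decomposition hB v
    have hne := hv.2
    obtain ⟨h1, h2, h3⟩ := apply_eq_smul_cases hB h0 hl hm hx hy hz hv.apply_eq_smul
    by_contra hcon
    push Not at hcon
    apply hne
    rw [h1.resolve_left hcon.1, h2.resolve_left hcon.2.1.symm, h3.resolve_left hcon.2.2.symm]
    simp
  · have key : ∀ (V : Submodule ℝ (SymG B)) (c : ℝ), 0 < Module.finrank ℝ V →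
        (∀ S ∈ V, U S = c • S) → Module.End.HasEigenvalue U c := by
      intro V c hV hc
      have : Nontrivial V := Module.finrank_pos_iff.1 hV
      obtain ⟨v, hv⟩ := exists_ne (0 : V)
      refine Module.End.hasEigenvalue_of_hasEigenvector (x := (v : SymG B))
        ⟨Module.End.mem_eigenspace_iff.2 (hc v v.2), by simpa using hv⟩
    rintro (rfl | rfl | rfl)
    · exact key (lineG B) 0 (by rw [finrank_lineG hB]; exact one_pos)
        (fun S hS => by rw [h0 S hS, zero_smul])
    · exact key (LSpace B) _ (by rw [finrank_LSpace hB]; omega) hl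
    · refine key (MSpace B) _ ?_ hm
      rw [finrank_MSpace hB]
      refine Nat.div_pos ?_ two_pos
      calc 2 ≤ 4 * 1 := by norm_num
        _ ≤ B * (B - 3) := Nat.mul_le_mul hB (by omega)

theorem eigenspaces_of_scalar (hB : 4 ≤ B) (h0 : ∀ S ∈ lineG B, U S = 0)
    (hl : ∀ S ∈ LSpace B, U S = l • S) (hm : ∀ S ∈ MSpace B, U S = m • S)
    (hl0 : l ≠ 0) (hm0 : m ≠ 0) (hlm : l ≠ m) :
    Module.End.eigenspace U 0 = lineG B ∧ Module.End.eigenspace U l = LSpace B ∧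
      Module.End.eigenspace U m = MSpace B := by
  refine ⟨?_, ?_, ?_⟩
  · ext S
    rw [Module.End.mem_eigenspace_iff]
    refine ⟨fun h => ?_, fun h => by rw [h0 S h, zero_smul]⟩
    obtain ⟨x, hx, y, hy, z, hz, rfl⟩ := exists_decomposition hB S
    obtain ⟨-, h2, h3⟩ := apply_eq_smul_cases hB h0 hl hm hx hy hz h
    rw [h2.resolve_left hl0, h3.resolve_left hm0]
    simpa using hx
  · ext S
    rw [Module.End.mem_eigenspace_iff]
    refine ⟨fun h => ?_, hl S⟩
    obtain ⟨x, hx, y, hy, z, hz, rfl⟩ := exists_decomposition hB S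
    obtain ⟨h1, -, h3⟩ := apply_eq_smul_cases hB h0 hl hm hx hy hz h
    rw [h1.resolve_left hl0, h3.resolve_left hlm.symm]
    simpa using hy
  · ext S
    rw [Module.End.mem_eigenspace_iff]
    refine ⟨fun h => ?_, hm S⟩
    obtain ⟨x, hx, y, hy, z, hz, rfl⟩ := exists_decomposition hB S
    obtain ⟨h1, h2, -⟩ := apply_eq_smul_cases hB h0 hl hm hx hy hz h
    rw [h1.resolve_left hm0, h2.resolve_left hlm]
    simpa using hz

theorem centerSym_inclG (S : SymG B) : centerSym B (inclG B S) = S := Subtype.ext S.2.2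

/-- For `c ≠ 0` an eigenvector is `c⁻¹` times its own image, so it already lies in `SymG`; the
kernel of centering only contributes to the eigenvalue `0`. -/
theorem eigenspace_incl_of_ne_zero {c : ℝ} (hc : c ≠ 0) :
    Module.End.eigenspace (inclG B ∘ₗ U ∘ₗ centerSym B) c =
      (Module.End.eigenspace U c).map (inclG B) := by
  ext S
  rw [Module.End.mem_eigenspace_iff, Submodule.mem_map]
  constructor
  · intro h
    have h' : inclG B (U (centerSym B S)) = c • S := h
    have hS : S = inclG B (c⁻¹ • U (centerSym B S)) := by
      rw [map_smul, h', smul_smul, inv_mul_cancel₀ hc, one_smul]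
    refine ⟨centerSym B S, ?_, ?_⟩
    · rw [Module.End.mem_eigenspace_iff]
      have h2 := congrArg (centerSym B) h'
      rwa [centerSym_inclG, map_smul] at h2
    · rw [hS, centerSym_inclG]
  · rintro ⟨T, hT, rfl⟩
    rw [Module.End.mem_eigenspace_iff] at hT
    simp [centerSym_inclG, hT]

end Eigen


/-! ### The ReLU case -/

theorem isPosHom_relu : IsPosHom 1 relu := by
  intro r x hr
  simp only [relu, Real.rpow_one]
  rw [mul_max_of_nonneg _ _ hr.le, mul_zero]

theorem cAlpha_one : cAlpha 1 = 1 / 2 := by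
  have h : Real.Gamma (1 + 1 / 2) = 1 / 2 * √Real.pi := by
    rw [add_comm, Real.Gamma_add_one (by norm_num), Real.Gamma_one_half_eq]
  have : √Real.pi ≠ 0 := by positivity
  rw [cAlpha, h]
  field_simp
  simp

theorem poch_one {a : ℝ} (ha : 0 < a) : poch a 1 = a := by
  rw [poch, Real.Gamma_add_one ha.ne', mul_div_assoc, div_self (Real.Gamma_pos_of_pos ha).ne',
    mul_one]

theorem jPhi_relu : jPhi 1 relu = jAlpha 1 := by
  ext c
  simp [jPhi, relu]

/-! ### The closed form of `J_1` and the ratio `J_1' / (1 - J_1)`. -/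

theorem one_sub_mul_cos_pos {c : ℝ} (h1 : -1 < c) (h2 : c < 1) (η : ℝ) :
    0 < 1 - c * Real.cos η := by
  have h := Real.abs_cos_le_one η
  have : |c * Real.cos η| < 1 := by
    rw [abs_mul]
    calc |c| * |Real.cos η| ≤ |c| * 1 := by gcongr
      _ < 1 := by rw [mul_one, abs_lt]; exact ⟨h1, h2⟩
  have := (abs_lt.1 this).2
  linarith

/-- With `k = cos θ`, the derivative of `sin η / (1 - k cos η)` is `(cos η - k) / (1 - k cos η)²`.
Adding `k / (1 - k cos η)` makes the numerator `(1 - k²) cos η`, and the half-angle substitution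
integrates the added term. -/
theorem hasDerivAt_relu_primitive {θ : ℝ} (h0 : 0 < θ) (h1 : θ < Real.pi) {η : ℝ}
    (hη : η ∈ Set.Icc 0 (Real.pi / 2)) :
    HasDerivAt (fun η => (Real.sin η / (1 - Real.cos θ * Real.cos η) +
        Real.cos θ * (2 / Real.sin θ * Real.arctan ((1 + Real.cos θ) / Real.sin θ *
          Real.tan (η / 2)))) / Real.sin θ ^ 2)
      (Real.cos η / (1 - Real.cos θ * Real.cos η) ^ 2) η := by
  have hs : 0 < Real.sin θ := Real.sin_pos_of_pos_of_lt_pi h0 h1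
  have hsq := Real.sin_sq_add_cos_sq θ
  have hc1 : -1 < Real.cos θ := by nlinarith
  have hc2 : Real.cos θ < 1 := by nlinarith
  have hpos := one_sub_mul_cos_pos hc1 hc2 η
  have hhalf : 0 < Real.cos (η / 2) :=
    Real.cos_pos_of_mem_Ioo ⟨by linarith [hη.1, Real.pi_pos], by linarith [hη.2, Real.pi_pos]⟩
  have ha : HasDerivAt (fun η => Real.sin η / (1 - Real.cos θ * Real.cos η)) _ η :=
    (Real.hasDerivAt_sin η).div (((Real.hasDerivAt_cos η).const_mul (Real.cos θ)).const_sub 1)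
      hpos.ne'
  have hb : HasDerivAt (fun η => Real.tan (η / 2)) _ η :=
    HasDerivAt.comp η (Real.hasDerivAt_tan hhalf.ne') ((hasDerivAt_id η).div_const 2)
  have hd := (ha.add ((((hb.const_mul ((1 + Real.cos θ) / Real.sin θ)).arctan).const_mul
    (2 / Real.sin θ)).const_mul (Real.cos θ))).div_const (Real.sin θ ^ 2)
  refine hd.congr_deriv ?_
  have hcos : Real.cos η = 2 * Real.cos (η / 2) ^ 2 - 1 := by
    rw [← Real.cos_two_mul]; ring_nf
  have hsin : Real.sin (η / 2) ^ 2 = 1 - Real.cos (η / 2) ^ 2 := by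
    linarith [Real.sin_sq_add_cos_sq (η / 2)]
  -- The arctangent term is a primitive of `1 / (1 - cos θ cos η)`.
  have e1 : 2 / Real.sin θ * (1 / (1 + ((1 + Real.cos θ) / Real.sin θ * Real.tan (η / 2)) ^ 2) *
      ((1 + Real.cos θ) / Real.sin θ * (1 / Real.cos (η / 2) ^ 2 * (1 / 2)))) =
      1 / (1 - Real.cos θ * Real.cos η) := by
    have hk : Real.sin θ ^ 2 = (1 - Real.cos θ) * (1 + Real.cos θ) := by linarith
    have hden : 1 + ((1 + Real.cos θ) / Real.sin θ * Real.tan (η / 2)) ^ 2 =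
        (1 - Real.cos θ * Real.cos η) / ((1 - Real.cos θ) * Real.cos (η / 2) ^ 2) := by
      rw [Real.tan_eq_sin_div_cos, mul_pow, div_pow, div_pow, hsin, hk, hcos]
      have h3 : 1 - Real.cos θ ≠ 0 := by linarith
      have h4 : 1 + Real.cos θ ≠ 0 := by linarith
      field_simp
      ring
    rw [hden]
    have h3 : 1 - Real.cos θ ≠ 0 := by linarith
    field_simp
    rw [hk]
  rw [e1]
  have h5 : Real.sin η ^ 2 = 1 - Real.cos η ^ 2 := by linarith [Real.sin_sq_add_cos_sq η]
  have h6 : Real.cos θ ^ 2 = 1 - Real.sin θ ^ 2 := by linarith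
  field_simp
  simp only [h5]
  ring_nf
  simp only [h6]
  ring

theorem integral_relu {θ : ℝ} (h0 : 0 < θ) (h1 : θ < Real.pi) :
    ∫ η in (0 : ℝ)..(Real.pi / 2), Real.cos η / (1 - Real.cos θ * Real.cos η) ^ 2 =
      (Real.sin θ + (Real.pi - θ) * Real.cos θ) / Real.sin θ ^ 3 := by
  have hs : 0 < Real.sin θ := Real.sin_pos_of_pos_of_lt_pi h0 h1
  have hsq := Real.sin_sq_add_cos_sq θ
  have hc1 : -1 < Real.cos θ := by nlinarith
  have hc2 : Real.cos θ < 1 := by nlinarith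
  have hpi := Real.pi_pos
  have hcont : Continuous fun η => Real.cos η / (1 - Real.cos θ * Real.cos η) ^ 2 := by
    refine Continuous.div (by fun_prop) (by fun_prop) fun η => ?_
    exact pow_ne_zero _ (one_sub_mul_cos_pos hc1 hc2 η).ne'
  rw [intervalIntegral.integral_eq_sub_of_hasDerivAt (fun η hη =>
    hasDerivAt_relu_primitive h0 h1 (by rwa [Set.uIcc_of_le (by positivity)] at hη))
    (hcont.intervalIntegrable _ _)]
  -- The argument is `cot (θ/2) = tan ((π - θ)/2)`.
  have harc : Real.arctan ((1 + Real.cos θ) / Real.sin θ) = (Real.pi - θ) / 2 := by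
    rw [← Real.arctan_tan (x := (Real.pi - θ) / 2) (by linarith) (by linarith)]
    congr 1
    have e : (Real.pi - θ) / 2 = Real.pi / 2 - θ / 2 := by ring
    have hc : 0 < Real.cos (θ / 2) := Real.cos_pos_of_mem_Ioo ⟨by linarith, by linarith⟩
    have hs' : 0 < Real.sin (θ / 2) := Real.sin_pos_of_pos_of_lt_pi (by linarith) (by linarith)
    have e1 : Real.cos θ = 2 * Real.cos (θ / 2) ^ 2 - 1 := by
      rw [← Real.cos_two_mul]; ring_nf
    have e2 : Real.sin θ = 2 * Real.sin (θ / 2) * Real.cos (θ / 2) := by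
      rw [← Real.sin_two_mul]; ring_nf
    rw [Real.tan_eq_sin_div_cos, e, Real.sin_pi_div_two_sub, Real.cos_pi_div_two_sub, e1, e2]
    field_simp
    ring
  have h4 : Real.pi / 2 / 2 = Real.pi / 4 := by ring
  simp only [Real.sin_pi_div_two, Real.cos_pi_div_two, h4, Real.tan_pi_div_four, mul_one, harc]
  simp
  field_simp

/-- The closed form of `J_1`. -/
noncomputable def jRelu (c : ℝ) : ℝ :=
  1 / Real.pi * (√(1 - c ^ 2) + (Real.pi - Real.arccos c) * c)

theorem jAlpha_one_eq {c : ℝ} (hc : c ∈ Set.Icc (-1 : ℝ) 1) : jAlpha 1 c = jRelu c := by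
  have hpi := Real.pi_pos
  unfold jAlpha jRelu
  split_ifs with h
  · subst h
    simp
  rcases eq_or_lt_of_le hc.1 with rfl | hlt
  -- At `c = -1` the prefactor `sin θ ^ 3` vanishes, so the value of the integral is irrelevant.
  · have h3 : (0 : ℝ) ^ (2 * (1 : ℝ) + 1) = 0 := Real.zero_rpow (by norm_num)
    simp only [jAngle, Real.arccos_neg_one, Real.sin_pi, h3]
    simp
  have hlt2 : c < 1 := lt_of_le_of_ne hc.2 h
  have h0 : 0 < Real.arccos c := Real.arccos_pos.2 hlt2
  have h1 : Real.arccos c < Real.pi := by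
    refine lt_of_le_of_ne (Real.arccos_le_pi c) fun h => ?_
    rw [Real.arccos_eq_pi] at h
    linarith
  have hs : 0 < Real.sin (Real.arccos c) := Real.sin_pos_of_pos_of_lt_pi h0 h1
  have hint := integral_relu h0 h1
  have e1 : (2 * (1 : ℝ) + 1) = ((3 : ℕ) : ℝ) := by norm_num
  have e2 : (1 : ℝ) + 1 = ((2 : ℕ) : ℝ) := by norm_num
  unfold jAngle
  rw [e1, e2]
  simp only [Real.rpow_natCast, Real.rpow_one]
  rw [hint, cAlpha_one, show ((2 : ℕ) : ℝ) = 1 + 1 by norm_num, Real.Gamma_add_one one_ne_zero,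
    Real.Gamma_one]
  field_simp
  rw [Real.sin_arccos, Real.cos_arccos hc.1 hc.2]

theorem hasDerivAt_jRelu {c : ℝ} (h1 : -1 < c) (h2 : c < 1) :
    HasDerivAt jRelu (1 / Real.pi * (Real.pi - Real.arccos c)) c := by
  have hpos : 0 < 1 - c ^ 2 := by nlinarith
  have ha : HasDerivAt (fun c : ℝ => √(1 - c ^ 2)) _ c :=
    (((hasDerivAt_id c).pow 2).const_sub 1).sqrt hpos.ne'
  have hb : HasDerivAt (fun c : ℝ => (Real.pi - Real.arccos c) * c) _ c :=
    ((Real.hasDerivAt_arccos h1.ne' h2.ne).const_sub Real.pi).mul (hasDerivAt_id c)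
  refine ((ha.add hb).const_mul (1 / Real.pi)).congr_deriv ?_
  have : 0 < √(1 - c ^ 2) := Real.sqrt_pos.2 hpos
  simp
  field_simp
  ring

theorem hasDerivAt_jAlpha_one {c : ℝ} (h1 : -1 < c) (h2 : c < 1) :
    HasDerivAt (jAlpha 1) (1 / Real.pi * (Real.pi - Real.arccos c)) c := by
  refine (hasDerivAt_jRelu h1 h2).congr_of_eventuallyEq ?_
  filter_upwards [Ioo_mem_nhds h1 h2] with x hx using jAlpha_one_eq ⟨hx.1.le, hx.2.le⟩

theorem monotoneOn_jRelu : MonotoneOn jRelu (Set.Icc (-1) 0) := by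
  refine monotoneOn_of_deriv_nonneg (convex_Icc _ _) ?_ ?_ ?_
  · unfold jRelu
    fun_prop
  · rw [interior_Icc]
    intro x hx
    exact (hasDerivAt_jRelu hx.1 (by linarith [hx.2])).differentiableAt.differentiableWithinAt
  · rw [interior_Icc]
    intro x hx
    rw [(hasDerivAt_jRelu hx.1 (by linarith [hx.2])).deriv]
    have := Real.arccos_le_pi x
    have := Real.pi_pos
    have : 0 ≤ Real.pi - Real.arccos x := by linarith
    positivity

theorem jRelu_zero : jRelu 0 = 1 / Real.pi := by simp [jRelu]

theorem jRelu_lt_one {c : ℝ} (h1 : -1 ≤ c) (h2 : c ≤ 0) : jRelu c < 1 := by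
  have h := monotoneOn_jRelu ⟨h1, h2⟩ (Set.right_mem_Icc.2 (by norm_num)) h2
  rw [jRelu_zero] at h
  refine h.trans_lt ?_
  rw [div_lt_one Real.pi_pos]
  linarith [Real.pi_gt_three]

/-- The ratio `J_1' / (1 - J_1)`. -/
noncomputable def ratioRelu (c : ℝ) : ℝ :=
  1 / Real.pi * (Real.pi - Real.arccos c) / (1 - jRelu c)

/-- The nonnegative numerator increases strictly, while the positive denominator `1 - J_1` does not
increase. -/
theorem ratioRelu_strictMonoOn : StrictMonoOn ratioRelu (Set.Icc (-1) 0) := by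
  intro x hx y hy hxy
  have h1 := jRelu_lt_one hx.1 hx.2
  have h2 := jRelu_lt_one hy.1 hy.2
  have h3 := monotoneOn_jRelu hx hy hxy.le
  have h4 : Real.arccos y < Real.arccos x :=
    Real.strictAntiOn_arccos ⟨hx.1, by linarith [hx.2]⟩ ⟨hy.1, by linarith [hy.2]⟩ hxy
  have h5 := Real.arccos_le_pi x
  have hpi := Real.pi_pos
  unfold ratioRelu
  calc 1 / Real.pi * (Real.pi - Real.arccos x) / (1 - jRelu x)
      ≤ 1 / Real.pi * (Real.pi - Real.arccos x) / (1 - jRelu y) := by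
        apply div_le_div_of_nonneg_left _ (by linarith) (by linarith)
        exact mul_nonneg (by positivity) (by linarith)
    _ < 1 / Real.pi * (Real.pi - Real.arccos y) / (1 - jRelu y) := by
        gcongr

theorem ratioRelu_pos {c : ℝ} (h1 : -1 < c) (h2 : c ≤ 0) : 0 < ratioRelu c := by
  have h3 : Real.arccos c < Real.pi := by
    refine lt_of_le_of_ne (Real.arccos_le_pi c) fun h => ?_
    rw [Real.arccos_eq_pi] at h
    linarith
  have := jRelu_lt_one h1.le h2
  have hpi := Real.pi_pos
  unfold ratioRelu
  have : 0 < Real.pi - Real.arccos c := by linarith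
  have : 0 < 1 - jRelu c := by linarith
  positivity

theorem ratioRelu_zero : ratioRelu 0 = Real.pi / (2 * (Real.pi - 1)) := by
  have hpi := Real.pi_gt_three
  have : Real.pi - 1 ≠ 0 := by linarith
  rw [ratioRelu, jRelu_zero, Real.arccos_zero]
  field_simp
  ring

theorem ratioRelu_zero_lt : ratioRelu 0 < 3 / 4 := by
  have hpi := Real.pi_gt_three
  rw [ratioRelu_zero, div_lt_div_iff₀ (by linarith) (by norm_num)]
  linarith

/-- The tangent line of the strictly convex function `J_1` at `c` lies below `J_1 1 = 1`. -/
theorem ratioRelu_mul_lt {c : ℝ} (h1 : -1 < c) (h2 : c ≤ 0) : ratioRelu c * (1 - c) < 1 := by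
  have hj := jRelu_lt_one h1.le h2
  have hpi := Real.pi_pos
  rw [ratioRelu, div_mul_eq_mul_div, div_lt_one (by linarith), jRelu]
  have h0 : 0 < Real.arccos c := Real.arccos_pos.2 (by linarith)
  -- With `θ = arccos c`, the gap to be shown positive is `(θ - sin θ) / π`.
  have hs := Real.sin_lt h0
  rw [Real.sin_arccos] at hs
  rw [← sub_pos]
  have : 1 - 1 / Real.pi * (√(1 - c ^ 2) + (Real.pi - Real.arccos c) * c) -
      1 / Real.pi * (Real.pi - Real.arccos c) * (1 - c) =
      1 / Real.pi * (Real.arccos c - √(1 - c ^ 2)) := by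
    field_simp
    ring
  rw [this]
  exact mul_pos (by positivity) (by linarith)

/-! ### The ReLU eigenvalues as functions of the batch size. -/

theorem cB_mem {B : ℕ} (hB : 4 ≤ B) : -1 < cB B ∧ cB B < 0 := by
  have hB' : (4 : ℝ) ≤ B := by exact_mod_cast hB
  unfold cB
  rw [div_lt_iff₀ (by linarith), lt_div_iff₀ (by linarith)]
  constructor <;> linarith

theorem kAlpha_one {B : ℕ} (hB : 4 ≤ B) : kAlpha 1 B = 1 / 2 := by
  have hB' : (4 : ℝ) ≤ B := by exact_mod_cast hB
  have h : (0 : ℝ) < ((B : ℝ) - 1) / 2 := by linarith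
  rw [kAlpha, cAlpha_one, poch_one h, Real.rpow_one, mul_assoc, inv_mul_cancel₀ h.ne', mul_one]

theorem upsilonStar_relu {B : ℕ} (hB : 4 ≤ B) :
    upsilonStar 1 relu B = 1 / 2 * (1 - jAlpha 1 (cB B)) := by
  rw [upsilonStar, kAlpha_one hB, jPhi_relu]
  simp [jAlpha]

theorem lamL_relu {B : ℕ} (hB : 4 ≤ B) :
    lamL 1 relu B = 1 / (2 * ((B : ℝ) + 1) * upsilonStar 1 relu B) *
      (((B : ℝ) - 2) * (1 - jAlpha 1 (cB B)) +
        (B : ℝ) / ((B : ℝ) - 1) * deriv (jAlpha 1) (cB B)) := by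
  rw [lamL, jPhi_relu, cAlpha_one, poch_one (by positivity), sub_self, Real.rpow_zero,
    Real.rpow_neg_one, show jAlpha 1 1 = 1 by simp [jAlpha]]
  simp only [one_div, mul_inv, inv_div, mul_one]
  ring

theorem lamM_relu {B : ℕ} (hB : 4 ≤ B) :
    lamM 1 relu B = (B : ℝ) / (2 * ((B : ℝ) + 1) * upsilonStar 1 relu B) *
      deriv (jAlpha 1) (cB B) := by
  rw [lamM, jPhi_relu, cAlpha_one, poch_one (by positivity), sub_self, Real.rpow_zero,
    Real.rpow_neg_one]
  simp only [mul_inv, mul_one, div_eq_mul_inv]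
  ring

theorem lamM_relu_eq {B : ℕ} (hB : 4 ≤ B) :
    lamM 1 relu B = (B : ℝ) / ((B : ℝ) + 1) * ratioRelu (cB B) := by
  obtain ⟨h1, h2⟩ := cB_mem hB
  have hj := jRelu_lt_one h1.le h2.le
  have : 1 - jRelu (cB B) ≠ 0 := by linarith
  rw [lamM_relu hB, upsilonStar_relu hB, (hasDerivAt_jAlpha_one h1 (by linarith)).deriv,
    jAlpha_one_eq ⟨h1.le, by linarith⟩, ratioRelu]
  have : (B : ℝ) + 1 ≠ 0 := by positivity
  field_simp

/-- Since `2υ* = 1 - J_1(c_B)`, the first bracket of `lamL_relu` contributes `(B-2)/(B+1)`, and the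
derivative term is the `𝕄` eigenvalue divided by `B - 1`. All further facts about `𝕃` come from this
relation. -/
theorem lamL_relu_eq {B : ℕ} (hB : 4 ≤ B) :
    lamL 1 relu B = 1 - 3 / ((B : ℝ) + 1) + lamM 1 relu B / ((B : ℝ) - 1) := by
  obtain ⟨h1, h2⟩ := cB_mem hB
  have hj := jRelu_lt_one h1.le h2.le
  have hB' : (4 : ℝ) ≤ B := by exact_mod_cast hB
  have : 1 - jRelu (cB B) ≠ 0 := by linarith
  rw [lamM_relu_eq hB, lamL_relu hB, upsilonStar_relu hB,
    (hasDerivAt_jAlpha_one h1 (by linarith)).deriv, jAlpha_one_eq ⟨h1.le, by linarith⟩, ratioRelu]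
  have : (B : ℝ) + 1 ≠ 0 := by positivity
  have : (B : ℝ) - 1 ≠ 0 := by linarith
  field_simp
  ring

theorem lamM_relu_pos {B : ℕ} (hB : 4 ≤ B) : 0 < lamM 1 relu B := by
  obtain ⟨h1, h2⟩ := cB_mem hB
  have := ratioRelu_pos h1 h2.le
  have : (0 : ℝ) < B := by positivity
  rw [lamM_relu_eq hB]
  positivity

theorem lamM_relu_lt {B : ℕ} (hB : 4 ≤ B) : lamM 1 relu B < 3 / 4 := by
  obtain ⟨h1, h2⟩ := cB_mem hB
  have h3 := ratioRelu_strictMonoOn ⟨h1.le, h2.le⟩ (Set.right_mem_Icc.2 (by norm_num)) h2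
  have h4 := ratioRelu_pos h1 h2.le
  rw [lamM_relu_eq hB]
  have h5 : (B : ℝ) / ((B : ℝ) + 1) ≤ 1 := by
    rw [div_le_one (by positivity)]; linarith
  calc (B : ℝ) / ((B : ℝ) + 1) * ratioRelu (cB B) ≤ 1 * ratioRelu (cB B) := by gcongr
    _ < 3 / 4 := by linarith [ratioRelu_zero_lt]

theorem lamL_relu_pos {B : ℕ} (hB : 4 ≤ B) : 0 < lamL 1 relu B := by
  have hB' : (4 : ℝ) ≤ B := by exact_mod_cast hB
  rw [lamL_relu_eq hB]
  have h1 : 3 / ((B : ℝ) + 1) < 1 := by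
    rw [div_lt_one (by positivity)]; linarith
  have h2 : 0 < lamM 1 relu B / ((B : ℝ) - 1) := div_pos (lamM_relu_pos hB) (by linarith)
  linarith

/-- The difference factors as `(B-2)/(B+1) · (1 - r(c_B)(1 - c_B))` because `1 - c_B = B/(B-1)`; the
second factor is positive by `ratioRelu_mul_lt`. -/
theorem lamL_relu_ne_lamM_relu {B : ℕ} (hB : 4 ≤ B) : lamL 1 relu B ≠ lamM 1 relu B := by
  obtain ⟨h1, h2⟩ := cB_mem hB
  have hB' : (4 : ℝ) ≤ B := by exact_mod_cast hB
  have h3 := ratioRelu_mul_lt h1 h2.le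
  have h4 : 1 - cB B = (B : ℝ) / ((B : ℝ) - 1) := by
    have : (B : ℝ) - 1 ≠ 0 := by linarith
    rw [cB]; field_simp; ring
  have h5 : ((B : ℝ) + 1) / ((B : ℝ) - 1) * lamM 1 relu B < 1 := by
    rw [lamM_relu_eq hB]
    rw [h4] at h3
    have : (B : ℝ) - 1 ≠ 0 := by linarith
    calc _ = ratioRelu (cB B) * ((B : ℝ) / ((B : ℝ) - 1)) := by field_simp
      _ < 1 := h3
  rw [lamL_relu_eq hB]
  apply ne_of_gt
  rw [← sub_pos]
  have : 1 - 3 / ((B : ℝ) + 1) + lamM 1 relu B / ((B : ℝ) - 1) - lamM 1 relu B =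
      ((B : ℝ) - 2) / ((B : ℝ) + 1) * (1 - ((B : ℝ) + 1) / ((B : ℝ) - 1) * lamM 1 relu B) := by
    have : (B : ℝ) - 1 ≠ 0 := by linarith
    field_simp
    ring
  rw [this]
  exact mul_pos (div_pos (by linarith) (by linarith)) (by linarith)

theorem lamM_relu_strictMonoOn : StrictMonoOn (fun B : ℕ => lamM 1 relu B) (Set.Ici 4) := by
  intro B hB C hC hBC
  have hB : 4 ≤ B := hB
  have hC : 4 ≤ C := hC
  have hB' : (4 : ℝ) ≤ B := by exact_mod_cast hB
  have hBC' : (B : ℝ) < C := by exact_mod_cast hBC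
  obtain ⟨h1, h2⟩ := cB_mem hB
  obtain ⟨h3, h4⟩ := cB_mem hC
  have hcc : cB B < cB C := by
    unfold cB
    rw [div_lt_div_iff₀ (by linarith) (by linarith)]
    linarith
  have h5 := ratioRelu_strictMonoOn ⟨h1.le, h2.le⟩ ⟨h3.le, h4.le⟩ hcc
  have h6 := ratioRelu_pos h3 h4.le
  have h7 : (B : ℝ) / ((B : ℝ) + 1) ≤ (C : ℝ) / ((C : ℝ) + 1) := by
    rw [div_le_div_iff₀ (by linarith) (by linarith)]
    nlinarith
  simp only [lamM_relu_eq hB, lamM_relu_eq hC]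
  have : 0 < (B : ℝ) / ((B : ℝ) + 1) := div_pos (by linarith) (by linarith)
  calc _ < (B : ℝ) / ((B : ℝ) + 1) * ratioRelu (cB C) := by gcongr
    _ ≤ _ := by gcongr

/-- From `B` to `B + 1`, the term `1 - 3/(B+1)` gains `3/((B+1)(B+2))`. The term `λ_𝕄/(B-1)` loses
at most `λ_𝕄/(B(B-1))`, since `λ_𝕄` itself grows. -/
theorem lamL_relu_strictMonoOn : StrictMonoOn (fun B : ℕ => lamL 1 relu B) (Set.Ici 4) := by
  have key : ∀ B : ℕ, 4 ≤ B → lamL 1 relu B < lamL 1 relu (B + 1) := by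
    intro B hB
    have hB' : (4 : ℝ) ≤ B := by exact_mod_cast hB
    have h1 := lamM_relu_lt hB
    have h2 : lamM 1 relu B < lamM 1 relu (B + 1) :=
      lamM_relu_strictMonoOn (Set.mem_Ici.2 hB) (Set.mem_Ici.2 (by omega)) (Nat.lt_succ_self B)
    rw [lamL_relu_eq hB, lamL_relu_eq (by omega)]
    push_cast
    have h3 : lamM 1 relu B / B ≤ lamM 1 relu (B + 1) / ((B : ℝ) + 1 - 1) := by
      rw [add_sub_cancel_right]; gcongr
    have h4 : lamM 1 relu B / ((B : ℝ) - 1) - lamM 1 relu B / B =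
        lamM 1 relu B / (B * ((B : ℝ) - 1)) := by
      have : (B : ℝ) - 1 ≠ 0 := by linarith
      field_simp
      ring
    -- The bound `λ_𝕄 < 3/4` is tailored to this: it suffices that `(B+1)(B+2) ≤ 4B(B-1)`.
    have h5 : lamM 1 relu B / (B * ((B : ℝ) - 1)) < 3 / (((B : ℝ) + 1) * ((B : ℝ) + 2)) := by
      rw [div_lt_div_iff₀ (by nlinarith) (by positivity)]
      calc lamM 1 relu B * (((B : ℝ) + 1) * ((B : ℝ) + 2))
          < 3 / 4 * (((B : ℝ) + 1) * ((B : ℝ) + 2)) := by gcongr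
        _ ≤ 3 * (B * ((B : ℝ) - 1)) := by nlinarith
    have h6 : 3 / ((B : ℝ) + 1) - 3 / ((B : ℝ) + 1 + 1) =
        3 / (((B : ℝ) + 1) * ((B : ℝ) + 2)) := by
      field_simp
      ring
    linarith
  intro B hB C hC hBC
  induction C, hBC using Nat.le_induction with
  | base => exact key B hB
  | succ C hC' ih =>
    have hB : 4 ≤ B := hB
    have h4 : 4 ≤ C := by omega
    exact (ih h4).trans (key C h4)

theorem tendsto_cB : Tendsto cB atTop (𝓝 0) := by
  unfold cB
  refine Tendsto.const_div_atTop ?_ _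
  exact tendsto_atTop_add_const_right _ _ tendsto_natCast_atTop_atTop

theorem tendsto_lamM_relu :
    Tendsto (fun B : ℕ => lamM 1 relu B) atTop (𝓝 (Real.pi / (2 * (Real.pi - 1)))) := by
  have hc : ContinuousAt ratioRelu 0 := by
    unfold ratioRelu jRelu
    refine ContinuousAt.div (by fun_prop) (by fun_prop) ?_
    have h := jRelu_lt_one (c := 0) (by norm_num) le_rfl
    unfold jRelu at h
    linarith
  have h1 : Tendsto (fun B : ℕ => ratioRelu (cB B)) atTop (𝓝 (ratioRelu 0)) :=
    hc.tendsto.comp tendsto_cB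
  have h2 : Tendsto (fun B : ℕ => (B : ℝ) / ((B : ℝ) + 1)) atTop (𝓝 1) :=
    tendsto_natCast_div_add_atTop 1
  have h3 := h2.mul h1
  rw [one_mul, ratioRelu_zero] at h3
  refine h3.congr' ?_
  filter_upwards [eventually_ge_atTop 4] with B hB using (lamM_relu_eq hB).symm

theorem tendsto_lamL_relu : Tendsto (fun B : ℕ => lamL 1 relu B) atTop (𝓝 1) := by
  have h1 : Tendsto (fun B : ℕ => 3 / ((B : ℝ) + 1)) atTop (𝓝 0) :=
    Tendsto.const_div_atTop (tendsto_atTop_add_const_right _ _ tendsto_natCast_atTop_atTop) _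
  have h2 : Tendsto (fun B : ℕ => lamM 1 relu B / ((B : ℝ) - 1)) atTop (𝓝 0) :=
    tendsto_lamM_relu.div_atTop
      (tendsto_atTop_add_const_right _ (-1) tendsto_natCast_atTop_atTop)
  have h3 := ((tendsto_const_nhds (x := (1 : ℝ))).sub h1).add h2
  rw [sub_zero, add_zero] at h3
  refine h3.congr' ?_
  filter_upwards [eventually_ge_atTop 4] with B hB using (lamL_relu_eq hB).symm


/-! ### Homogeneous functions in polar coordinates -/

section Polar

variable {E : Type*} [NormedAddCommGroup E] [NormedSpace ℝ E] [Nontrivial E]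
  [FiniteDimensional ℝ E] [MeasurableSpace E] [BorelSpace E] (μ : Measure E) [μ.IsAddHaarMeasure]

/-- In polar coordinates `h(ru) = r^β h(u)`, so the integral over the product of sphere and
half-line factors. The identity holds without integrability, both sides then following the
convention for nonintegrable functions. -/
theorem integral_homogeneous_mul_norm {β : ℝ} {h : E → ℝ}
    (hh : ∀ r x, 0 < r → h (r • x) = r ^ β * h x) (k : ℝ → ℝ) :
    ∫ x, h x * k ‖x‖ ∂μ = (∫ u : Metric.sphere (0 : E) 1, h u ∂μ.toSphere) *
      ∫ r in Set.Ioi (0 : ℝ), r ^ (Module.finrank ℝ E - 1) * (r ^ β * k r) := by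
  calc
    ∫ x, h x * k ‖x‖ ∂μ = ∫ x : ({(0)}ᶜ : Set E), h x * k ‖x.1‖ ∂(μ.comap (↑)) := by
      rw [integral_subtype_comap (measurableSet_singleton _).compl fun x ↦ h x * k ‖x‖,
        restrict_compl_singleton]
    _ = ∫ p, h p.1 * (p.2.1 ^ β * k p.2)
          ∂μ.toSphere.prod (.volumeIoiPow (Module.finrank ℝ E - 1)) := by
      rw [← μ.measurePreserving_homeomorphUnitSphereProd.integral_comp
        (Homeomorph.measurableEmbedding _)]
      refine integral_congr_ae (Eventually.of_forall fun x => ?_)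
      have hx : 0 < ‖(x : E)‖ := norm_pos_iff.2 x.2
      simp only [homeomorphUnitSphereProd_apply_snd_coe, homeomorphUnitSphereProd_apply_fst_coe]
      rw [hh _ _ (inv_pos.2 hx), Real.inv_rpow hx.le]
      have : ‖(x : E)‖ ^ β ≠ 0 := (Real.rpow_pos_of_pos hx β).ne'
      field_simp
    _ = (∫ u : Metric.sphere (0 : E) 1, h u ∂μ.toSphere) *
          ∫ r : Set.Ioi (0 : ℝ), r.1 ^ β * k r ∂.volumeIoiPow (Module.finrank ℝ E - 1) :=
      integral_prod_mul (fun u : Metric.sphere (0 : E) 1 => h u)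
        (fun r : Set.Ioi (0 : ℝ) => r.1 ^ β * k r)
    _ = _ := by
      congr 1
      simp only [Measure.volumeIoiPow, ENNReal.ofReal]
      rw [integral_withDensity_eq_integral_smul,
        integral_subtype_comap measurableSet_Ioi fun a ↦
          Real.toNNReal (a ^ (Module.finrank ℝ E - 1)) • (a ^ β * k a),
        setIntegral_congr_fun measurableSet_Ioi fun x hx ↦ ?_]
      · rw [NNReal.smul_def, Real.coe_toNNReal _ (pow_nonneg hx.out.le _), smul_eq_mul]
      · exact (measurable_subtype_coe.pow_const _).real_toNNReal

theorem integrable_homogeneous_mul_norm_iff {β : ℝ} {h : E → ℝ}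
    (hh : ∀ r x, 0 < r → h (r • x) = r ^ β * h x) (k : ℝ → ℝ) :
    Integrable (fun x => h x * k ‖x‖) μ ↔
      Integrable (fun p : Metric.sphere (0 : E) 1 × Set.Ioi (0 : ℝ) => h p.1 * (p.2.1 ^ β * k p.2))
        (μ.toSphere.prod (.volumeIoiPow (Module.finrank ℝ E - 1))) := by
  rw [← μ.measurePreserving_homeomorphUnitSphereProd.integrable_comp_emb
    (Homeomorph.measurableEmbedding _), ← restrict_compl_singleton (μ := μ) 0, ← IntegrableOn,
    integrableOn_iff_comap_subtypeVal (by measurability), restrict_compl_singleton]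
  refine integrable_congr (Eventually.of_forall fun x => ?_)
  have hx : 0 < ‖(x : E)‖ := norm_pos_iff.2 x.2
  simp only [Function.comp_def, homeomorphUnitSphereProd_apply_snd_coe,
    homeomorphUnitSphereProd_apply_fst_coe]
  rw [hh _ _ (inv_pos.2 hx), Real.inv_rpow hx.le]
  have : ‖(x : E)‖ ^ β ≠ 0 := (Real.rpow_pos_of_pos hx β).ne'
  field_simp

/-- Fubini makes almost every radial slice integrable, and each slice is a positive constant times
`h` on the sphere. -/
theorem integrable_toSphere_of_homogeneous {β ε : ℝ} {h : E → ℝ}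
    (hh : ∀ r x, 0 < r → h (r • x) = r ^ β * h x)
    (hi : Integrable (fun x => h x * Real.exp (-ε * ‖x‖ ^ 2)) μ) :
    Integrable (fun u : Metric.sphere (0 : E) 1 => h u) μ.toSphere := by
  have h1 := (integrable_homogeneous_mul_norm_iff μ hh (fun r => Real.exp (-ε * r ^ 2))).1 hi
  have h2 := h1.prod_left_ae
  -- A nonzero radial measure is needed to extract one good radius from an almost-everywhere
  -- statement.
  have hne : (Measure.volumeIoiPow (Module.finrank ℝ E - 1)) ≠ 0 := by
    intro h0
    have := Measure.volumeIoiPow_apply_Iio (Module.finrank ℝ E - 1) ⟨1, Set.mem_Ioi.2 one_pos⟩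
    rw [h0] at this
    simp at this
    have h3 : (0 : ℝ) < (((Module.finrank ℝ E - 1 : ℕ) : ℝ) + 1)⁻¹ := by positivity
    exact absurd this (not_le.2 (by positivity))
  have : NeZero (Measure.volumeIoiPow (Module.finrank ℝ E - 1)) := ⟨hne⟩
  obtain ⟨r, hr⟩ := h2.exists
  refine (hr.mul_const (r.1 ^ β * Real.exp (-ε * r.1 ^ 2))⁻¹).congr
    (Eventually.of_forall fun u => ?_)
  have h3 : 0 < r.1 ^ β := Real.rpow_pos_of_pos r.2 β
  simp only
  field_simp

/-- The radial integrand is `r^(dim E - 1 + β) exp(-ε r²)`, integrable at `0` because `β > -dim E`.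
Passing through the sphere allows the degree of homogeneity to be changed. -/
theorem integrable_of_integrable_toSphere {β ε : ℝ} (hε : 0 < ε) {h : E → ℝ}
    (hh : ∀ r x, 0 < r → h (r • x) = r ^ β * h x) (hβ : -(Module.finrank ℝ E : ℝ) < β)
    (hi : Integrable (fun u : Metric.sphere (0 : E) 1 => h u) μ.toSphere) :
    Integrable (fun x => h x * Real.exp (-ε * ‖x‖ ^ 2)) μ := by
  refine (integrable_homogeneous_mul_norm_iff μ hh (fun r => Real.exp (-ε * r ^ 2))).2 ?_
  refine Integrable.mul_prod hi (g := fun r : Set.Ioi (0 : ℝ) => r.1 ^ β * Real.exp (-ε * r.1 ^ 2))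
    ?_
  rw [Measure.volumeIoiPow, integrable_withDensity_iff_integrable_smul' (by fun_prop) (by simp)]
  have hn : 1 ≤ Module.finrank ℝ E := Module.finrank_pos
  have h1 := integrableOn_rpow_mul_exp_neg_mul_sq hε
    (s := ((Module.finrank ℝ E - 1 : ℕ) : ℝ) + β) (by push_cast [hn]; linarith)
  rw [integrableOn_iff_comap_subtypeVal measurableSet_Ioi] at h1
  refine h1.congr (Eventually.of_forall fun r => ?_)
  have hr : 0 < r.1 := r.2
  simp only [Function.comp_apply, smul_eq_mul]
  rw [ENNReal.toReal_ofReal (by positivity), Real.rpow_add hr, Real.rpow_natCast, mul_assoc]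

end Polar

/-! ### Differentiating Gaussian integrals in the precision operator -/

/-- Precisions close to the identity keep at least half of the quadratic form. This gives one
Gaussian bound valid for all of them, as dominated differentiation requires. -/
theorem half_norm_sq_le {E H : Type*} [NormedAddCommGroup E] [NormedAddCommGroup H]
    [NormedSpace ℝ H] {Q : E → H →L[ℝ] ℝ} (hQn : ∀ z, ‖Q z‖ ≤ ‖z‖ ^ 2) {P₀ : H}
    (hP₀ : ∀ z, Q z P₀ = ‖z‖ ^ 2) {P : H} (hP : P ∈ Metric.ball P₀ (1 / 2)) (z : E) :
    1 / 2 * ‖z‖ ^ 2 ≤ Q z P := by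
  have h1 : ‖P - P₀‖ ≤ 1 / 2 := by
    rw [← dist_eq_norm]; exact (Metric.mem_ball.1 hP).le
  have h3 : |Q z (P - P₀)| ≤ 1 / 2 * ‖z‖ ^ 2 := by
    rw [← Real.norm_eq_abs]
    calc ‖Q z (P - P₀)‖ ≤ ‖Q z‖ * ‖P - P₀‖ := ContinuousLinearMap.le_opNorm _ _
      _ ≤ ‖z‖ ^ 2 * (1 / 2) := by gcongr; exact hQn z
      _ = _ := by ring
  rw [map_sub, hP₀] at h3
  linarith [(abs_le.1 h3).1]

/-- The quadratic form `⟪z, T z⟫` as a function of the operator `T`. -/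
noncomputable def quadAt {E : Type*} [NormedAddCommGroup E] [InnerProductSpace ℝ E] (z : E) :
    (E →L[ℝ] E) →L[ℝ] ℝ :=
  (innerSL ℝ z).comp (ContinuousLinearMap.apply ℝ E z)

theorem norm_quadAt_le {E : Type*} [NormedAddCommGroup E] [InnerProductSpace ℝ E] (z : E) :
    ‖quadAt z‖ ≤ ‖z‖ ^ 2 := by
  refine ContinuousLinearMap.opNorm_le_bound _ (by positivity) fun T => ?_
  calc ‖inner ℝ z (T z)‖ ≤ ‖z‖ * ‖T z‖ := norm_inner_le_norm _ _
    _ ≤ ‖z‖ * (‖T‖ * ‖z‖) := by gcongr; exact T.le_opNorm z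
    _ = _ := by ring

section Derivative

variable {E : Type*} [NormedAddCommGroup E] [InnerProductSpace ℝ E]
  [FiniteDimensional ℝ E] [MeasurableSpace E] [BorelSpace E]

/-- The functions with finite integral against every Gaussian weight. -/
def GaussIntegrable (f : E → ℝ) : Prop :=
  ∀ ε : ℝ, 0 < ε → Integrable (fun z => f z * Real.exp (-ε * ‖z‖ ^ 2))

/-- Unnormalized expectation with respect to the centered Gaussian of precision `P`. -/
noncomputable def gaussInt (f : E → ℝ) (P : E →L[ℝ] E) : ℝ :=
  ∫ z, f z * Real.exp (-(1 / 2) * inner ℝ z (P z))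

/-- Expectation with respect to the centered Gaussian of precision `P`. -/
noncomputable def gaussAvg (f : E → ℝ) (P : E →L[ℝ] E) : ℝ :=
  gaussInt f P / gaussInt (fun _ => 1) P

theorem gaussInt_one (f : E → ℝ) :
    gaussInt f 1 = ∫ z, f z * Real.exp (-(1 / 2) * ‖z‖ ^ 2) := by
  simp [gaussInt]

theorem gaussIntegrable_one : GaussIntegrable (fun _ : E => (1 : ℝ)) := by
  intro ε hε
  have h := (GaussianFourier.integrable_cexp_neg_mul_sq_norm_add (V := E) (b := (ε : ℂ))
    (by simpa using hε) 0 0).norm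
  refine h.congr (Eventually.of_forall fun z => ?_)
  simp only [Complex.norm_exp]
  norm_cast
  simp

theorem gaussInt_one_one_pos : 0 < gaussInt (fun _ : E => (1 : ℝ)) 1 := by
  rw [gaussInt_one]
  refine integral_pos_of_integrable_nonneg_nonzero (x := 0) (by fun_prop)
    (gaussIntegrable_one _ (by norm_num)) (fun z => by positivity) (by simp)

/-- Half of the Gaussian exponent absorbs the quadratic growth, through `x ≤ exp x`. -/
theorem GaussIntegrable.mul_of_le {f h : E → ℝ} (hf : GaussIntegrable f)
    (hm : AEStronglyMeasurable h) {C : ℝ} (hh : ∀ z, |h z| ≤ C * ‖z‖ ^ 2) :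
    GaussIntegrable (fun z => f z * h z) := by
  intro ε hε
  have h1 := ((hf (ε / 2) (by positivity)).norm.const_mul (|C| * (2 / ε)))
  refine h1.mono' ?_ (Eventually.of_forall fun z => ?_)
  · have e : (fun z => f z * h z * Real.exp (-ε * ‖z‖ ^ 2)) =
        fun z => (f z * Real.exp (-ε * ‖z‖ ^ 2)) * h z := by
      ext z; ring
    rw [e]
    exact (hf ε hε).aestronglyMeasurable.mul hm
  · have h2 : ε / 2 * ‖z‖ ^ 2 ≤ Real.exp (ε / 2 * ‖z‖ ^ 2) :=
      (by linarith [Real.add_one_le_exp (ε / 2 * ‖z‖ ^ 2)])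
    have h3 : ‖z‖ ^ 2 ≤ 2 / ε * Real.exp (ε / 2 * ‖z‖ ^ 2) := by
      rw [div_mul_eq_mul_div, le_div_iff₀ hε]
      linarith
    have h4 : Real.exp (ε / 2 * ‖z‖ ^ 2) * Real.exp (-ε * ‖z‖ ^ 2) =
        Real.exp (-(ε / 2) * ‖z‖ ^ 2) := by
      rw [← Real.exp_add]; ring_nf
    rw [norm_mul, norm_mul, norm_mul, Real.norm_eq_abs, Real.norm_eq_abs, Real.norm_eq_abs,
      Real.norm_eq_abs, Real.abs_exp, Real.abs_exp, ← h4]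
    calc |f z| * |h z| * Real.exp (-ε * ‖z‖ ^ 2)
        ≤ |f z| * (|C| * (2 / ε * Real.exp (ε / 2 * ‖z‖ ^ 2))) * Real.exp (-ε * ‖z‖ ^ 2) := by
          gcongr
          calc |h z| ≤ C * ‖z‖ ^ 2 := hh z
            _ ≤ |C| * ‖z‖ ^ 2 := by gcongr; exact le_abs_self C
            _ ≤ _ := by gcongr
      _ = _ := by ring

theorem GaussIntegrable.aestronglyMeasurable {f : E → ℝ} (hf : GaussIntegrable f) :
    AEStronglyMeasurable f := by
  refine ((hf 1 one_pos).aestronglyMeasurable.mul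
    (g := fun z => Real.exp (1 * ‖z‖ ^ 2)) (by fun_prop)).congr (Eventually.of_forall fun z => ?_)
  simp only [Pi.mul_apply]
  rw [mul_assoc, ← Real.exp_add]
  simp

section Abstract

variable {H : Type*} [NormedAddCommGroup H] [NormedSpace ℝ H]

/-- The integrand is smooth in `P` whatever `f` is. On the ball of radius `1/2` its derivative is
dominated by `|f z| ‖z‖² exp(-‖z‖²/4)`, so differentiation passes under the integral. -/
theorem hasFDerivAt_integral_exp {f : E → ℝ} (hf : GaussIntegrable f) {Q : E → H →L[ℝ] ℝ}
    (hQ : Continuous Q) (hQn : ∀ z, ‖Q z‖ ≤ ‖z‖ ^ 2) {P₀ : H} (hP₀ : ∀ z, Q z P₀ = ‖z‖ ^ 2) :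
    ∃ D : H →L[ℝ] ℝ,
      HasFDerivAt (fun P => ∫ z, f z * Real.exp (-(1 / 2) * Q z P)) D P₀ ∧
      ∀ T, D T = -(1 / 2) * ∫ z, f z * Q z T * Real.exp (-(1 / 2) * ‖z‖ ^ 2) := by
  have hfm := hf.aestronglyMeasurable
  let F' : H → E → H →L[ℝ] ℝ := fun P z =>
    (f z * (Real.exp (-(1 / 2) * Q z P) * -(1 / 2))) • Q z
  have hQP : ∀ P, Continuous fun z => Q z P := fun P => hQ.clm_apply continuous_const
  have hF'm : ∀ P, AEStronglyMeasurable (F' P) volume := fun P =>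
    AEStronglyMeasurable.smul (hfm.mul (by fun_prop)) hQ.aestronglyMeasurable
  have hb := hf.mul_of_le (h := fun z => ‖z‖ ^ 2) (C := 1) (by fun_prop)
    (fun z => by rw [abs_of_nonneg (by positivity), one_mul]) (1 / 4) (by norm_num)
  have hbound : ∀ z, ∀ P ∈ Metric.ball P₀ (1 / 2),
      ‖F' P z‖ ≤ ‖f z * ‖z‖ ^ 2 * Real.exp (-(1 / 4) * ‖z‖ ^ 2)‖ := by
    intro z P hP
    have h1 := half_norm_sq_le hQn hP₀ hP z
    have h2 : Real.exp (-(1 / 2) * Q z P) ≤ Real.exp (-(1 / 4) * ‖z‖ ^ 2) := by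
      apply Real.exp_le_exp.2; linarith
    have h3 : |(1 / 2 : ℝ)| ≤ 1 := by rw [abs_of_pos] <;> norm_num
    simp only [F', norm_smul, norm_mul, Real.norm_eq_abs, Real.abs_exp, norm_pow, abs_norm,
      abs_neg]
    calc |f z| * (Real.exp (-(1 / 2) * Q z P) * |1 / 2|) * ‖Q z‖
        ≤ |f z| * (Real.exp (-(1 / 4) * ‖z‖ ^ 2) * 1) * ‖z‖ ^ 2 := by
          gcongr
          exact hQn z
      _ = |f z| * ‖z‖ ^ 2 * Real.exp (-(1 / 4) * ‖z‖ ^ 2) := by ring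
  have hdiff : ∀ z, ∀ P ∈ Metric.ball P₀ (1 / 2),
      HasFDerivAt (fun P : H => f z * Real.exp (-(1 / 2) * Q z P)) (F' P z) P := by
    intro z P _
    have h1 : HasFDerivAt (fun P : H => -(1 / 2) * Q z P) ((-(1 / 2) : ℝ) • Q z) P :=
      (Q z).hasFDerivAt.const_mul (-(1 / 2) : ℝ)
    refine (h1.exp.const_mul (f z)).congr_fderiv ?_
    simp only [F', smul_smul]
  have hmain := hasFDerivAt_integral_of_dominated_of_fderiv_le
    (F := fun (P : H) z => f z * Real.exp (-(1 / 2) * Q z P)) (F' := F')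
    (x₀ := P₀) (s := Metric.ball P₀ (1 / 2)) (Metric.ball_mem_nhds _ (by norm_num))
    (Eventually.of_forall fun P => hfm.mul (by fun_prop))
    (by simpa [hP₀] using hf (1 / 2) (by norm_num)) (hF'm P₀)
    (Eventually.of_forall hbound) hb.norm (Eventually.of_forall hdiff)
  refine ⟨_, hmain, fun T => ?_⟩
  have hint : Integrable (F' P₀) := hb.norm.mono' (hF'm P₀)
    (Eventually.of_forall fun z => hbound z P₀ (Metric.mem_ball_self (by norm_num)))
  rw [ContinuousLinearMap.integral_apply hint, ← integral_const_mul]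
  refine integral_congr_ae (Eventually.of_forall fun z => ?_)
  simp [F', hP₀]
  ring

end Abstract

theorem hasFDerivAt_gaussInt {f : E → ℝ} (hf : GaussIntegrable f) :
    ∃ D : (E →L[ℝ] E) →L[ℝ] ℝ, HasFDerivAt (gaussInt f) D 1 ∧
      ∀ T, D T = -(1 / 2) * gaussInt (fun z => f z * inner ℝ z (T z)) 1 := by
  obtain ⟨D, h1, h2⟩ := hasFDerivAt_integral_exp hf (Q := quadAt) (P₀ := 1)
    (by unfold quadAt; fun_prop) norm_quadAt_le (fun z => by simp [quadAt])
  refine ⟨D, h1, fun T => ?_⟩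
  rw [h2, gaussInt_one]
  rfl

/-- The quotient rule turns the two unnormalized derivatives into minus half the covariance of `f`
with the quadratic form of `T`. -/
theorem hasFDerivAt_gaussAvg {f : E → ℝ} (hf : GaussIntegrable f) :
    ∃ D : (E →L[ℝ] E) →L[ℝ] ℝ, HasFDerivAt (gaussAvg f) D 1 ∧
      ∀ T, D T = -(1 / 2) * (gaussAvg (fun z => f z * inner ℝ z (T z)) 1 -
        gaussAvg f 1 * gaussAvg (fun z => inner ℝ z (T z)) 1) := by
  obtain ⟨D₁, h1, h1'⟩ := hasFDerivAt_gaussInt hf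
  obtain ⟨D₂, h2, h2'⟩ := hasFDerivAt_gaussInt (gaussIntegrable_one (E := E))
  have hpos := (gaussInt_one_one_pos (E := E)).ne'
  have h3 := h1.mul ((hasDerivAt_inv hpos).comp_hasFDerivAt 1 h2)
  refine ⟨_, h3, fun T => ?_⟩
  simp [h1', h2', gaussAvg]
  field_simp
  ring

end Derivative


/-! ### Multivariate Gaussians: linear images and densities -/

section Density

variable {E : Type*} [NormedAddCommGroup E] [InnerProductSpace ℝ E]
  [FiniteDimensional ℝ E] [MeasurableSpace E] [BorelSpace E]

theorem gaussInt_one_one :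
    gaussInt (fun _ : E => (1 : ℝ)) 1 = (2 * Real.pi) ^ ((Module.finrank ℝ E : ℝ) / 2) := by
  rw [gaussInt_one]
  simp only [one_mul]
  rw [GaussianFourier.integral_rexp_neg_mul_sq_norm (by norm_num)]
  congr 1
  ring

/-- Finite measures with equal characteristic functions agree, and that of the density is the
Gaussian Fourier integral. -/
theorem stdGaussian_eq_withDensity :
    stdGaussian E = (volume : Measure E).withDensity
      (fun z => ENNReal.ofReal ((gaussInt (fun _ : E => (1 : ℝ)) 1)⁻¹ *
        Real.exp (-(1 / 2) * ‖z‖ ^ 2))) := by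
  have hpos := gaussInt_one_one_pos (E := E)
  have hint : Integrable (fun z : E => (gaussInt (fun _ : E => (1 : ℝ)) 1)⁻¹ *
      Real.exp (-(1 / 2) * ‖z‖ ^ 2)) := by
    have := gaussIntegrable_one (E := E) (1 / 2) (by norm_num)
    simp only [one_mul] at this
    exact this.const_mul _
  have : IsFiniteMeasure ((volume : Measure E).withDensity
      (fun z => ENNReal.ofReal ((gaussInt (fun _ : E => (1 : ℝ)) 1)⁻¹ *
        Real.exp (-(1 / 2) * ‖z‖ ^ 2)))) := isFiniteMeasure_withDensity_ofReal hint.2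
  apply Measure.ext_of_charFun
  ext t
  rw [charFun_stdGaussian, charFun_apply, integral_withDensity_eq_integral_toReal_smul
    (by fun_prop) (by simp)]
  have h := GaussianFourier.integral_cexp_neg_mul_sq_norm_add (V := E) (b := (1 / 2 : ℂ))
    (by norm_num) Complex.I t
  have h2 : ((gaussInt (fun _ : E => (1 : ℝ)) 1 : ℝ) : ℂ) =
      (Real.pi / (1 / 2) : ℂ) ^ (Module.finrank ℝ E / 2 : ℂ) := by
    rw [gaussInt_one_one, Complex.ofReal_cpow (by positivity)]
    push_cast
    congr 1
    ring
  rw [← h2] at h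
  calc Complex.exp (-‖t‖ ^ 2 / 2)
      = ((gaussInt (fun _ : E => (1 : ℝ)) 1 : ℝ) : ℂ)⁻¹ *
        ∫ v : E, Complex.exp (-(1 / 2) * ‖v‖ ^ 2 + Complex.I * inner ℝ t v) := by
        rw [h, ← mul_assoc, inv_mul_cancel₀ (by exact_mod_cast hpos.ne'), one_mul]
        congr 1
        rw [Complex.I_sq]
        ring
    _ = _ := by
        rw [← integral_const_mul]
        refine integral_congr_ae (Eventually.of_forall fun z => ?_)
        simp only
        rw [ENNReal.toReal_ofReal (by positivity), Complex.exp_add, Complex.real_smul,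
          real_inner_comm]
        push_cast
        rw [mul_comm Complex.I]
        ring

theorem integral_stdGaussian (f : E → ℝ) : ∫ z, f z ∂(stdGaussian E) = gaussAvg f 1 := by
  have hpos := gaussInt_one_one_pos (E := E)
  rw [stdGaussian_eq_withDensity, integral_withDensity_eq_integral_toReal_smul
    (by fun_prop) (by simp), gaussAvg, gaussInt_one f, eq_div_iff hpos.ne', ← integral_mul_const]
  refine integral_congr_ae (Eventually.of_forall fun z => ?_)
  simp only [smul_eq_mul]
  rw [ENNReal.toReal_ofReal (by positivity)]
  field_simp

theorem integrable_stdGaussian_iff (f : E → ℝ) :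
    Integrable f (stdGaussian E) ↔ Integrable (fun z => f z * Real.exp (-(1 / 2) * ‖z‖ ^ 2)) := by
  have hpos := gaussInt_one_one_pos (E := E)
  rw [stdGaussian_eq_withDensity, integrable_withDensity_iff_integrable_smul'
    (by fun_prop) (by simp)]
  refine Iff.trans (integrable_congr (Eventually.of_forall fun z => ?_))
    (integrable_const_mul_iff (c := (gaussInt (fun _ : E => (1 : ℝ)) 1)⁻¹)
      (isUnit_iff_ne_zero.2 (inv_ne_zero hpos.ne')) _)
  simp only [smul_eq_mul]
  rw [ENNReal.toReal_ofReal (by positivity)]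
  ring

end Density

section Map

variable {ι κ : Type*} [Fintype ι]

/-- Multiplication by a matrix as a map between Euclidean spaces. -/
noncomputable def mulVecE (M : Matrix κ ι ℝ) (x : EuclideanSpace ℝ ι) : EuclideanSpace ℝ κ :=
  WithLp.toLp 2 (M.mulVec x.ofLp)

theorem mulVecE_apply (M : Matrix κ ι ℝ) (x : EuclideanSpace ℝ ι) (i : κ) :
    mulVecE M x i = ∑ j, M i j * x j := rfl

theorem continuous_mulVecE (M : Matrix κ ι ℝ) : Continuous (mulVecE M) := by
  unfold mulVecE
  refine (PiLp.continuous_toLp 2 _).comp ?_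
  refine continuous_pi fun i => ?_
  simp only [Matrix.mulVec, dotProduct]
  fun_prop

theorem inner_eq_dotProduct (x y : EuclideanSpace ℝ ι) :
    inner ℝ x y = x.ofLp ⬝ᵥ y.ofLp := by
  simp [PiLp.inner_apply, dotProduct, mul_comm]

theorem mulVecE_mulVecE {η : Type*} [Fintype η] (M : Matrix κ ι ℝ) (N : Matrix ι η ℝ)
    (x : EuclideanSpace ℝ η) : mulVecE M (mulVecE N x) = mulVecE (M * N) x := by
  simp [mulVecE, Matrix.mulVec_mulVec]

theorem posSemidef_conj [Finite κ] {S : Matrix ι ι ℝ} (hS : S.PosSemidef) (M : Matrix κ ι ℝ) :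
    (M * S * M.transpose).PosSemidef := by
  have := hS.mul_mul_conjTranspose_same M
  rwa [Matrix.conjTranspose_eq_transpose_of_trivial] at this

variable [Fintype κ]

theorem inner_mulVecE (M : Matrix κ ι ℝ) (x : EuclideanSpace ℝ ι) (y : EuclideanSpace ℝ κ) :
    inner ℝ (mulVecE M x) y = inner ℝ x (mulVecE M.transpose y) := by
  rw [inner_eq_dotProduct, inner_eq_dotProduct]
  simp only [mulVecE]
  rw [Matrix.dotProduct_mulVec, Matrix.vecMul_transpose]

variable [DecidableEq ι] [DecidableEq κ]

theorem map_multivariateGaussian {S : Matrix ι ι ℝ} (hS : S.PosSemidef) (M : Matrix κ ι ℝ) :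
    (multivariateGaussian 0 S).map (mulVecE M) =
      multivariateGaussian 0 (M * S * M.transpose) := by
  have : IsFiniteMeasure ((multivariateGaussian 0 S).map (mulVecE M)) :=
    Measure.isFiniteMeasure_map _ _
  apply Measure.ext_of_charFun
  ext t
  rw [charFun_multivariateGaussian (posSemidef_conj hS M), charFun_apply,
    integral_map (continuous_mulVecE M).aemeasurable (by fun_prop)]
  simp_rw [inner_mulVecE]
  rw [← charFun_apply, charFun_multivariateGaussian hS]
  simp only [inner_zero_right]
  congr 4
  simp only [mulVecE]
  rw [← Matrix.mulVec_mulVec, ← Matrix.mulVec_mulVec, Matrix.dotProduct_mulVec (t.ofLp) M,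
    ← Matrix.mulVec_transpose]

theorem integral_map_multivariateGaussian {S : Matrix ι ι ℝ} (hS : S.PosSemidef)
    (M : Matrix κ ι ℝ) {f : EuclideanSpace ℝ κ → ℝ} (hf : Measurable f) :
    ∫ x, f x ∂(multivariateGaussian 0 (M * S * M.transpose)) =
      ∫ x, f (mulVecE M x) ∂(multivariateGaussian 0 S) := by
  rw [← map_multivariateGaussian hS M, integral_map (continuous_mulVecE M).aemeasurable
    hf.aestronglyMeasurable]

theorem integrable_map_multivariateGaussian {S : Matrix ι ι ℝ} (hS : S.PosSemidef)
    (M : Matrix κ ι ℝ) {f : EuclideanSpace ℝ κ → ℝ} (hf : Measurable f) :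
    Integrable f (multivariateGaussian 0 (M * S * M.transpose)) ↔
      Integrable (fun x => f (mulVecE M x)) (multivariateGaussian 0 S) := by
  rw [← map_multivariateGaussian hS M, integrable_map_measure hf.aestronglyMeasurable
    (continuous_mulVecE M).aemeasurable]
  rfl

open scoped MatrixOrder

/-- The change of variables `z = √S u` in Gaussian integrals. -/
theorem gaussInt_sqrt {S : Matrix ι ι ℝ} (hS : S.PosDef) (f : EuclideanSpace ℝ ι → ℝ) :
    gaussInt (fun u => f (Matrix.toEuclideanCLM (𝕜 := ℝ) (CFC.sqrt S) u)) 1 * √S.det =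
      gaussInt f (Matrix.toEuclideanCLM (𝕜 := ℝ) S⁻¹) := by
  set R := CFC.sqrt S with hR
  have hRR : R * R = S := CFC.sqrt_mul_sqrt_self _ hS.posSemidef.nonneg
  have hRs : R.transpose = R := by
    have h : IsSelfAdjoint R := (CFC.sqrt_nonneg S).isSelfAdjoint
    have h' : R.conjTranspose = R := h
    rwa [Matrix.conjTranspose_eq_transpose_of_trivial] at h'
  have hdet : R.det * R.det = S.det := by rw [← Matrix.det_mul, hRR]
  have hSd := hS.det_pos
  have hRd : R.det ≠ 0 := by
    intro h
    rw [h, zero_mul] at hdet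
    exact hSd.ne hdet
  have hRu : IsUnit R.det := isUnit_iff_ne_zero.2 hRd
  -- This makes `⟪Ru, S⁻¹Ru⟫ = ‖u‖²`, so the substitution yields the standard Gaussian weight.
  have hinv : R * S⁻¹ * R = 1 := by
    rw [← hRR, Matrix.mul_inv_rev, ← mul_assoc, Matrix.mul_nonsing_inv _ hRu, one_mul,
      Matrix.nonsing_inv_mul _ hRu]
  let A : EuclideanSpace ℝ ι →ₗ[ℝ] EuclideanSpace ℝ ι :=
    (Matrix.toEuclideanCLM (𝕜 := ℝ) R).toLinearMap
  have hAdet : LinearMap.det A = R.det := by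
    have : A = Matrix.toLin (EuclideanSpace.basisFun ι ℝ).toBasis
        (EuclideanSpace.basisFun ι ℝ).toBasis R := rfl
    rw [this, LinearMap.det_toLin]
  have hA := Measure.map_linearMap_addHaar_eq_smul_addHaar (volume : Measure (EuclideanSpace ℝ ι))
    (f := A) (by rw [hAdet]; exact hRd)
  have hemb : MeasurableEmbedding A := by
    have hinj : Function.Injective A :=
      (LinearMap.equivOfDetNeZero A (by rw [hAdet]; exact hRd)).injective
    exact (LinearMap.continuous_of_finiteDimensional A).measurableEmbedding hinj
  have hnorm : ∀ u, inner ℝ (A u) (Matrix.toEuclideanCLM (𝕜 := ℝ) S⁻¹ (A u)) = ‖u‖ ^ 2 := by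
    intro u
    have e1 : (A u).ofLp = R.mulVec u.ofLp := rfl
    rw [Matrix.inner_toEuclideanCLM, e1, Matrix.mulVec_mulVec, ← real_inner_self_eq_norm_sq,
      inner_eq_dotProduct, dotProduct_comm, Matrix.dotProduct_mulVec, ← Matrix.mulVec_transpose,
      Matrix.mulVec_mulVec, hRs, ← mul_assoc, hinv, Matrix.one_mulVec]
  have hsq : √S.det = |R.det| := by rw [← hdet, Real.sqrt_mul_self_eq_abs]
  have hmain : gaussInt f (Matrix.toEuclideanCLM (𝕜 := ℝ) S⁻¹) * |R.det|⁻¹ =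
      gaussInt (fun u => f (A u)) 1 := by
    have h1 := hemb.integral_map (μ := volume) (fun z => f z *
      Real.exp (-(1 / 2) * inner ℝ z (Matrix.toEuclideanCLM (𝕜 := ℝ) S⁻¹ z)))
    rw [hA, integral_smul_measure, ENNReal.toReal_ofReal (abs_nonneg _), hAdet] at h1
    simp only [hnorm] at h1
    rw [gaussInt_one, ← h1, abs_inv, smul_eq_mul, mul_comm]
    rfl
  have : |R.det| ≠ 0 := abs_ne_zero.2 hRd
  rw [hsq]
  change gaussInt (fun u => f (A u)) 1 * _ = _
  rw [← hmain]
  field_simp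

theorem gaussInt_one_toEuclideanCLM {S : Matrix ι ι ℝ} (hS : S.PosDef) :
    gaussInt (fun _ => (1 : ℝ)) (Matrix.toEuclideanCLM (𝕜 := ℝ) S⁻¹) =
      (2 * Real.pi) ^ ((Fintype.card ι : ℝ) / 2) * √S.det := by
  rw [← gaussInt_sqrt hS, gaussInt_one_one, finrank_euclideanSpace]

/-- The Jacobian `√(det S)` appears in numerator and denominator of `gaussAvg` and cancels. -/
theorem integral_multivariateGaussian {S : Matrix ι ι ℝ} (hS : S.PosDef)
    {f : EuclideanSpace ℝ ι → ℝ} (hf : Measurable f) :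
    ∫ x, f x ∂(multivariateGaussian 0 S) =
      gaussAvg f (Matrix.toEuclideanCLM (𝕜 := ℝ) S⁻¹) := by
  have h : √S.det ≠ 0 := (Real.sqrt_pos.2 hS.det_pos).ne'
  rw [multivariateGaussian, integral_map (by fun_prop) hf.aestronglyMeasurable]
  simp only [zero_add]
  rw [integral_stdGaussian (fun u => f (Matrix.toEuclideanCLM (𝕜 := ℝ) (CFC.sqrt S) u)), gaussAvg,
    gaussAvg, ← gaussInt_sqrt hS, ← gaussInt_sqrt hS]
  rw [mul_div_mul_right _ _ h]

end Map


/-! ### The bivariate Gaussian integrals behind `J_α` -/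

/-- The `α`-ReLU. -/
noncomputable def rhoAlpha (α x : ℝ) : ℝ := if 0 < x then x ^ α else 0

theorem rhoAlpha_of_pos {α x : ℝ} (h : 0 < x) : rhoAlpha α x = x ^ α := if_pos h

theorem rhoAlpha_of_nonpos {α x : ℝ} (h : x ≤ 0) : rhoAlpha α x = 0 := if_neg (not_lt.2 h)

theorem rhoAlpha_nonneg (α x : ℝ) : 0 ≤ rhoAlpha α x := by
  unfold rhoAlpha
  split_ifs with h
  · positivity
  · exact le_rfl

theorem measurable_rhoAlpha (α : ℝ) : Measurable (rhoAlpha α) :=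
  Measurable.ite measurableSet_Ioi (measurable_id.pow_const α) measurable_const

theorem rhoAlpha_mul {α r : ℝ} (hr : 0 < r) (x : ℝ) :
    rhoAlpha α (r * x) = r ^ α * rhoAlpha α x := by
  unfold rhoAlpha
  by_cases hx : 0 < x
  · rw [if_pos hx, if_pos (mul_pos hr hx), Real.mul_rpow hr.le hx.le]
  · rw [if_neg hx, if_neg (by rw [mul_pos_iff_of_pos_left hr]; exact hx), mul_zero]

/-- The angular density of the quadrant integral. -/
noncomputable def angular (α c ψ : ℝ) : ℝ :=
  rhoAlpha α (Real.cos ψ) * rhoAlpha α (Real.sin ψ) *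
    (((1 - c * Real.sin (2 * ψ)) / (2 * (1 - c ^ 2))) ^ (-(α + 1)) *
      (1 / 2 * Real.Gamma (α + 1)))

theorem one_sub_sq_pos {c : ℝ} (h1 : -1 < c) (h2 : c < 1) : 0 < 1 - c ^ 2 := by nlinarith

theorem one_sub_mul_sin_pos {c : ℝ} (h1 : -1 < c) (h2 : c < 1) (η : ℝ) :
    0 < 1 - c * Real.sin η := by
  have := one_sub_mul_cos_pos h1 h2 (η - Real.pi / 2)
  rwa [Real.cos_sub_pi_div_two] at this

theorem angular_nonneg {α c : ℝ} (hα : -(1 / 2) < α) (h1 : -1 < c) (h2 : c < 1) (ψ : ℝ) :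
    0 ≤ angular α c ψ := by
  have h3 := one_sub_sq_pos h1 h2
  have h4 := one_sub_mul_sin_pos h1 h2 (2 * ψ)
  have h5 := Real.Gamma_pos_of_pos (show 0 < α + 1 by linarith)
  have := rhoAlpha_nonneg α (Real.cos ψ)
  have := rhoAlpha_nonneg α (Real.sin ψ)
  unfold angular
  positivity

/-- The exponent of the density of a standard bivariate Gaussian with correlation `c`. -/
noncomputable def bivExp (c : ℝ) (p : ℝ × ℝ) : ℝ :=
  Real.exp (-((p.1 ^ 2 + p.2 ^ 2 - 2 * c * (p.1 * p.2)) / (2 * (1 - c ^ 2))))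

/-- At angle `ψ` the exponent is `-b r²` with `b = (1 - c sin 2ψ) / (2(1 - c²))`, and the weight is
`r^(2α+1)`: a Gamma integral, finite as `α > -1`. -/
theorem lintegral_radial {α c : ℝ} (hα : -(1 / 2) < α) (h1 : -1 < c) (h2 : c < 1) (ψ : ℝ) :
    ∫⁻ r in Set.Ioi (0 : ℝ), ENNReal.ofReal r * ENNReal.ofReal
      (rhoAlpha α (r * Real.cos ψ) * rhoAlpha α (r * Real.sin ψ) *
        bivExp c (r * Real.cos ψ, r * Real.sin ψ)) = ENNReal.ofReal (angular α c ψ) := by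
  have h3 := one_sub_sq_pos h1 h2
  have h4 := one_sub_mul_sin_pos h1 h2 (2 * ψ)
  set b := (1 - c * Real.sin (2 * ψ)) / (2 * (1 - c ^ 2)) with hb
  have hbpos : 0 < b := by positivity
  set A := rhoAlpha α (Real.cos ψ) * rhoAlpha α (Real.sin ψ) with hA
  have hA0 : 0 ≤ A := mul_nonneg (rhoAlpha_nonneg _ _) (rhoAlpha_nonneg _ _)
  have hcongr : ∀ r ∈ Set.Ioi (0 : ℝ), ENNReal.ofReal r * ENNReal.ofReal
      (rhoAlpha α (r * Real.cos ψ) * rhoAlpha α (r * Real.sin ψ) *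
        bivExp c (r * Real.cos ψ, r * Real.sin ψ)) =
      ENNReal.ofReal (A * (r ^ (2 * α + 1) * Real.exp (-b * r ^ (2 : ℝ)))) := by
    intro r hr
    have hr : 0 < r := hr
    rw [← ENNReal.ofReal_mul hr.le, rhoAlpha_mul hr, rhoAlpha_mul hr]
    congr 1
    have e1 : bivExp c (r * Real.cos ψ, r * Real.sin ψ) = Real.exp (-b * r ^ (2 : ℝ)) := by
      rw [bivExp, hb, Real.sin_two_mul, Real.rpow_two]
      congr 1
      have : (r * Real.cos ψ) ^ 2 + (r * Real.sin ψ) ^ 2 = r ^ 2 := by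
        rw [mul_pow, mul_pow, ← mul_add, Real.cos_sq_add_sin_sq, mul_one]
      simp only [this]
      field_simp
    have e2 : r ^ (2 * α + 1) = r * (r ^ α * r ^ α) := by
      rw [Real.rpow_add hr, Real.rpow_one, two_mul, Real.rpow_add hr]; ring
    rw [e1, e2, hA]
    ring
  rw [setLIntegral_congr_fun measurableSet_Ioi hcongr,
    ← ofReal_integral_eq_lintegral_ofReal]
  · rw [integral_const_mul, integral_rpow_mul_exp_neg_mul_rpow two_pos (by linarith) hbpos, angular]
    congr 2
    rw [show -(2 * α + 1 + 1) / 2 = -(α + 1) by ring, show (2 * α + 1 + 1) / 2 = α + 1 by ring]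
    ring
  · exact (integrableOn_rpow_mul_exp_neg_mul_rpow (by linarith) two_pos hbpos).const_mul A
  · filter_upwards [ae_restrict_mem measurableSet_Ioi] with r hr
    have hr : 0 < r := hr
    positivity

theorem measurable_bivExp (c : ℝ) : Measurable (bivExp c) := by
  unfold bivExp
  fun_prop

theorem measurable_angular (α c : ℝ) : Measurable (angular α c) := by
  unfold angular
  have := measurable_rhoAlpha α
  fun_prop

/-- Nonnegativity lets polar coordinates and Tonelli run on lower Lebesgue integrals, with no
integrability established in advance. -/
theorem integral_quadrant_eq_angular {α c : ℝ} (hα : -(1 / 2) < α) (h1 : -1 < c) (h2 : c < 1) :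
    ∫ p : ℝ × ℝ, rhoAlpha α p.1 * rhoAlpha α p.2 * bivExp c p =
      ∫ ψ in Set.Ioo (-Real.pi) Real.pi, angular α c ψ := by
  have hρ := measurable_rhoAlpha α
  have he := measurable_bivExp c
  have hm : Measurable fun p : ℝ × ℝ => rhoAlpha α p.1 * rhoAlpha α p.2 * bivExp c p := by fun_prop
  rw [integral_eq_lintegral_of_nonneg_ae (Eventually.of_forall fun p => ?_)
    hm.aestronglyMeasurable,
    integral_eq_lintegral_of_nonneg_ae (Eventually.of_forall fun ψ => angular_nonneg hα h1 h2 ψ)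
    (measurable_angular α c).aestronglyMeasurable]
  · congr 1
    rw [← lintegral_comp_polarCoord_symm, polarCoord_target, Measure.volume_eq_prod,
      ← Measure.prod_restrict, lintegral_prod_symm']
    · refine lintegral_congr fun ψ => ?_
      rw [← lintegral_radial hα h1 h2 ψ]
      simp only [polarCoord_symm_apply, smul_eq_mul]
    · simp only [polarCoord_symm_apply, smul_eq_mul]
      fun_prop
  · have := rhoAlpha_nonneg α p.1
    have := rhoAlpha_nonneg α p.2
    have : 0 ≤ bivExp c p := (Real.exp_pos _).le
    simp only [Pi.zero_apply]
    positivity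

/-- Only the open first quadrant contributes. There `η = 2ψ - π/2` turns `sin 2ψ` into `cos η` and
the range into `(-π/2, π/2)`, on which the integrand is even. -/
theorem integral_angular {α c : ℝ} (h1 : -1 < c) (h2 : c < 1) :
    ∫ ψ in Set.Ioo (-Real.pi) Real.pi, angular α c ψ =
      (1 - c ^ 2) ^ (α + 1) * Real.Gamma (α + 1) *
        ∫ η in (0 : ℝ)..(Real.pi / 2), Real.cos η ^ α / (1 - c * Real.cos η) ^ (1 + α) := by
  have hpi := Real.pi_pos
  have h3 := one_sub_sq_pos h1 h2
  have hsub : ∫ ψ in Set.Ioo (-Real.pi) Real.pi, angular α c ψ =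
      ∫ ψ in Set.Ioo 0 (Real.pi / 2), angular α c ψ := by
    refine setIntegral_eq_of_subset_of_forall_sdiff_eq_zero measurableSet_Ioo
      (fun x hx => ⟨by linarith [hx.1], by linarith [hx.2]⟩) fun ψ hψ => ?_
    unfold angular
    rcases le_or_gt ψ 0 with h | h
    · rw [rhoAlpha_of_nonpos (Real.sin_nonpos_of_nonpos_of_neg_pi_le h hψ.1.1.le)]
      simp
    · have : Real.pi / 2 ≤ ψ := by
        by_contra hcon
        exact hψ.2 ⟨h, not_le.1 hcon⟩
      rw [rhoAlpha_of_nonpos (Real.cos_nonpos_of_pi_div_two_le_of_le this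
        (by linarith [hψ.1.2]))]
      simp
  let F : ℝ → ℝ := fun η => Real.cos η ^ α / (1 - c * Real.cos η) ^ (1 + α)
  have hF : ∀ ψ ∈ Set.Ioo 0 (Real.pi / 2), angular α c ψ =
      (1 - c ^ 2) ^ (α + 1) * Real.Gamma (α + 1) * F (2 * ψ - Real.pi / 2) := by
    intro ψ hψ
    have hs : 0 < Real.sin ψ := Real.sin_pos_of_pos_of_lt_pi hψ.1 (by linarith [hψ.2])
    have hc : 0 < Real.cos ψ := Real.cos_pos_of_mem_Ioo ⟨by linarith [hψ.1], hψ.2⟩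
    have h4 := one_sub_mul_sin_pos h1 h2 (2 * ψ)
    simp only [F, angular]
    rw [Real.cos_sub_pi_div_two, rhoAlpha_of_pos hs, rhoAlpha_of_pos hc,
      Real.rpow_neg (by positivity),
      Real.div_rpow h4.le (by positivity), Real.mul_rpow two_pos.le h3.le, add_comm 1 α]
    rw [show Real.sin (2 * ψ) ^ α = 2 ^ α * (Real.cos ψ ^ α * Real.sin ψ ^ α) by
      rw [Real.sin_two_mul, Real.mul_rpow (by positivity) hc.le, Real.mul_rpow two_pos.le hs.le]
      ring]
    rw [Real.rpow_add two_pos, Real.rpow_one]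
    have : (1 - c * Real.sin (2 * ψ)) ^ (α + 1) ≠ 0 := (Real.rpow_pos_of_pos h4 _).ne'
    have : (1 - c ^ 2) ^ (α + 1) ≠ 0 := (Real.rpow_pos_of_pos h3 _).ne'
    field_simp
  have hsubst : ∫ ψ in Set.Ioo 0 (Real.pi / 2), F (2 * ψ - Real.pi / 2) =
      ∫ η in (0 : ℝ)..(Real.pi / 2), F η := by
    rw [← integral_Ioc_eq_integral_Ioo, ← intervalIntegral.integral_of_le (by positivity),
      intervalIntegral.integral_comp_mul_sub F two_ne_zero]
    have e1 : 2 * 0 - Real.pi / 2 = -(Real.pi / 2) := by ring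
    have e2 : 2 * (Real.pi / 2) - Real.pi / 2 = Real.pi / 2 := by ring
    rw [e1, e2, intervalIntegral.integral_of_le (by linarith), integral_Ioc_eq_integral_Ioo,
      intervalIntegral.integral_of_le (by linarith), integral_Ioc_eq_integral_Ioo]
    -- Evenness is used by writing the integrand as a function of `|η|`; the indicator restricts the
    -- identity on the line to the interval.
    have h5 := integral_comp_abs (f := (Set.Iio (Real.pi / 2)).indicator F)
    have e3 : (fun x => (Set.Iio (Real.pi / 2)).indicator F |x|) =
        (Set.Ioo (-(Real.pi / 2)) (Real.pi / 2)).indicator F := by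
      ext x
      by_cases hx : |x| < Real.pi / 2
      · rw [Set.indicator_of_mem (Set.mem_Iio.2 hx),
          Set.indicator_of_mem (Set.mem_Ioo.2 (abs_lt.1 hx))]
        simp only [F, Real.cos_abs]
      · rw [Set.indicator_of_notMem (fun h => hx (Set.mem_Iio.1 h)), Set.indicator_of_notMem
          (fun h => hx (abs_lt.2 (Set.mem_Ioo.1 h)))]
    rw [e3, integral_indicator measurableSet_Ioo, setIntegral_indicator measurableSet_Iio,
      Set.Ioi_inter_Iio] at h5
    rw [h5]
    simp
  rw [hsub, setIntegral_congr_fun measurableSet_Ioo hF, integral_const_mul, hsubst]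

theorem cAlpha_pos {α : ℝ} (hα : -(1 / 2) < α) : 0 < cAlpha α := by
  have h := Real.Gamma_pos_of_pos (show 0 < α + 1 / 2 by linarith)
  have := Real.pi_pos
  unfold cAlpha
  positivity

theorem integral_quadrant {α c : ℝ} (hα : -(1 / 2) < α) (h1 : -1 < c) (h2 : c < 1) :
    ∫ p : ℝ × ℝ, rhoAlpha α p.1 * rhoAlpha α p.2 * bivExp c p =
      2 * Real.pi * √(1 - c ^ 2) * (cAlpha α * jAlpha α c) := by
  have h3 := one_sub_sq_pos h1 h2
  have h4 := cAlpha_pos hα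
  have hpi := Real.pi_pos
  rw [integral_quadrant_eq_angular hα h1 h2, integral_angular h1 h2, jAlpha, if_neg h2.ne, jAngle,
    Real.sin_arccos, Real.cos_arccos h1.le h2.le]
  -- One factor `√(1 - c²)` belongs to the normalization `2π√(1 - c²)` of the density; the rest is
  -- the `sin θ ^ (2α+1)` of `jAngle`.
  have e : (1 - c ^ 2) ^ (α + 1) = √(1 - c ^ 2) * √(1 - c ^ 2) ^ (2 * α + 1) := by
    have h5 : 0 < √(1 - c ^ 2) := Real.sqrt_pos.2 h3
    nth_rewrite 1 [← Real.sq_sqrt h3.le]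
    rw [← Real.rpow_natCast, ← Real.rpow_mul h5.le]
    nth_rewrite 2 [← Real.rpow_one √(1 - c ^ 2)]
    rw [← Real.rpow_add h5]
    congr 1
    push_cast
    ring
  rw [e]
  field_simp


/-! ### Gaussian moments of positive-homogeneous functions -/

/-- Homogeneity determines `φ` by its values at `±1`, except at `0` (where `φ 0` is free if `α =
0`). The exception is null for nondegenerate Gaussians. -/
theorem IsPosHom.eq_of_ne_zero {α : ℝ} {φ : ℝ → ℝ} (hφ : IsPosHom α φ) {x : ℝ} (hx : x ≠ 0) :
    φ x = φ 1 * rhoAlpha α x + φ (-1) * rhoAlpha α (-x) := by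
  rcases lt_or_gt_of_ne hx with h | h
  · have h' : 0 < -x := by linarith
    rw [rhoAlpha_of_nonpos h.le, rhoAlpha_of_pos h', mul_zero, zero_add, mul_comm, ← hφ _ _ h']
    congr 1
    ring
  · rw [rhoAlpha_of_pos h, rhoAlpha_of_nonpos (by linarith : -x ≤ 0), mul_zero, add_zero, mul_comm,
      ← hφ _ _ h, mul_one]

theorem IsPosHom.measurable {α : ℝ} {φ : ℝ → ℝ} (hφ : IsPosHom α φ) : Measurable φ := by
  have h : φ = fun x => if x = 0 then φ 0 else φ 1 * rhoAlpha α x + φ (-1) * rhoAlpha α (-x) := by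
    ext x
    split_ifs with hx
    · rw [hx]
    · exact hφ.eq_of_ne_zero hx
  have hρ := measurable_rhoAlpha α
  rw [h]
  exact Measurable.ite (measurableSet_singleton 0) measurable_const (by fun_prop)

theorem ae_gaussianReal_ne_zero {v : NNReal} (hv : v ≠ 0) : ∀ᵐ x ∂(gaussianReal 0 v), x ≠ 0 := by
  have := nullSingletonClass_gaussianReal (μ := 0) hv
  exact compl_mem_ae_iff.2 (measure_singleton 0)

theorem gaussianPDFReal_mul_rho_sq (α : ℝ) (v : NNReal) :
    (fun x => gaussianPDFReal 0 v x * rhoAlpha α x ^ 2) = (Set.Ioi (0 : ℝ)).indicator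
      (fun x => (√(2 * Real.pi * v))⁻¹ * (x ^ (2 * α) *
        Real.exp (-(2 * (v : ℝ))⁻¹ * x ^ (2 : ℝ)))) := by
  ext x
  by_cases hx : 0 < x
  · have h2 : x ^ (2 * α) = x ^ α * x ^ α := by rw [two_mul, Real.rpow_add hx]
    rw [Set.indicator_of_mem (Set.mem_Ioi.2 hx), gaussianPDFReal, rhoAlpha_of_pos hx, h2,
      sub_zero, Real.rpow_two]
    have : -x ^ 2 / (2 * (v : ℝ)) = -(2 * (v : ℝ))⁻¹ * x ^ 2 := by
      rw [div_eq_inv_mul]; ring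
    rw [this]
    ring
  · rw [Set.indicator_of_notMem (fun h => hx (Set.mem_Ioi.1 h)), rhoAlpha_of_nonpos (not_lt.1 hx)]
    ring

theorem integrable_rho_sq {α : ℝ} (hα : -(1 / 2) < α) {v : NNReal} (hv : v ≠ 0) :
    Integrable (fun x => rhoAlpha α x ^ 2) (gaussianReal 0 v) := by
  have hv' : (0 : ℝ) < v := by positivity
  rw [gaussianReal_of_var_ne_zero 0 hv, gaussianPDF_def,
    integrable_withDensity_iff_integrable_smul' (by fun_prop) (by simp)]
  have h : (fun x => (ENNReal.ofReal (gaussianPDFReal 0 v x)).toReal • rhoAlpha α x ^ 2) =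
      fun x => gaussianPDFReal 0 v x * rhoAlpha α x ^ 2 := by
    ext x
    rw [ENNReal.toReal_ofReal (gaussianPDFReal_nonneg _ _ _), smul_eq_mul]
  rw [h, gaussianPDFReal_mul_rho_sq, integrable_indicator_iff measurableSet_Ioi]
  exact (integrableOn_rpow_mul_exp_neg_mul_rpow (by linarith) two_pos (by positivity)).const_mul _

theorem integral_rho_sq {α : ℝ} (hα : -(1 / 2) < α) {v : NNReal} (hv : v ≠ 0) :
    ∫ x, rhoAlpha α x ^ 2 ∂(gaussianReal 0 v) = (v : ℝ) ^ α * cAlpha α := by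
  have hv' : (0 : ℝ) < v := by positivity
  have hpi := Real.pi_pos
  rw [integral_gaussianReal_eq_integral_smul hv]
  simp only [smul_eq_mul]
  rw [gaussianPDFReal_mul_rho_sq, integral_indicator measurableSet_Ioi, integral_const_mul,
    integral_rpow_mul_exp_neg_mul_rpow two_pos (by linarith) (by positivity), cAlpha,
    show (2 * α + 1) / 2 = α + 1 / 2 by ring, show -(2 * α + 1) / 2 = -(α + 1 / 2) by ring,
    Real.inv_rpow (by positivity), Real.rpow_neg (by positivity), inv_inv,
    Real.rpow_add (by positivity), ← Real.sqrt_eq_rpow, Real.mul_rpow two_pos.le hv'.le,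
    Real.rpow_sub two_pos, Real.rpow_one, show 2 * Real.pi * (v : ℝ) = (2 * v) * Real.pi by ring,
    Real.sqrt_mul (by positivity)]
  have h1 : √(2 * (v : ℝ)) ≠ 0 := by positivity
  have h2 : √Real.pi ≠ 0 := by positivity
  field_simp

theorem map_neg_gaussianReal (v : NNReal) : (gaussianReal 0 v).map (fun x => -x) =
    gaussianReal 0 v := by
  rw [gaussianReal_map_neg, neg_zero]

theorem integrable_rho_neg_sq {α : ℝ} (hα : -(1 / 2) < α) {v : NNReal} (hv : v ≠ 0) :
    Integrable (fun x => rhoAlpha α (-x) ^ 2) (gaussianReal 0 v) := by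
  have h := integrable_rho_sq hα hv
  rw [← map_neg_gaussianReal] at h
  exact h.comp_measurable measurable_neg

theorem integral_rho_neg_sq {α : ℝ} (hα : -(1 / 2) < α) {v : NNReal} (hv : v ≠ 0) :
    ∫ x, rhoAlpha α (-x) ^ 2 ∂(gaussianReal 0 v) = (v : ℝ) ^ α * cAlpha α := by
  rw [← integral_rho_sq hα hv]
  conv_rhs => rw [← map_neg_gaussianReal]
  have := measurable_rhoAlpha α
  rw [integral_map (by fun_prop) (by fun_prop)]

theorem IsPosHom.sq_eq {α : ℝ} {φ : ℝ → ℝ} (hφ : IsPosHom α φ) {x : ℝ} (hx : x ≠ 0) :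
    φ x * φ x = φ 1 ^ 2 * rhoAlpha α x ^ 2 + φ (-1) ^ 2 * rhoAlpha α (-x) ^ 2 := by
  have h : rhoAlpha α x * rhoAlpha α (-x) = 0 := by
    rcases le_total x 0 with h | h
    · rw [rhoAlpha_of_nonpos h, zero_mul]
    · rw [rhoAlpha_of_nonpos (neg_nonpos.2 h), mul_zero]
  rw [hφ.eq_of_ne_zero hx]
  linear_combination 2 * φ 1 * φ (-1) * h

theorem IsPosHom.integrable_sq {α : ℝ} {φ : ℝ → ℝ} (hφ : IsPosHom α φ) (hα : -(1 / 2) < α)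
    {v : NNReal} (hv : v ≠ 0) : Integrable (fun x => φ x * φ x) (gaussianReal 0 v) := by
  refine (((integrable_rho_sq hα hv).const_mul (φ 1 ^ 2)).add
    ((integrable_rho_neg_sq hα hv).const_mul (φ (-1) ^ 2))).congr ?_
  filter_upwards [ae_gaussianReal_ne_zero hv] with x hx
  exact (hφ.sq_eq hx).symm

theorem jAlpha_one_right (α : ℝ) : jAlpha α 1 = 1 := if_pos rfl

theorem jAlpha_neg_one {α : ℝ} (hα : -(1 / 2) < α) : jAlpha α (-1) = 0 := by
  have h : (0 : ℝ) ^ (2 * α + 1) = 0 := Real.zero_rpow (by linarith)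
  rw [jAlpha, if_neg (by norm_num), jAngle, Real.arccos_neg_one, Real.sin_pi, h]
  simp

theorem jPhi_one {α : ℝ} (hα : -(1 / 2) < α) (φ : ℝ → ℝ) :
    jPhi α φ 1 = φ 1 ^ 2 + φ (-1) ^ 2 := by
  rw [jPhi, jAlpha_one_right, jAlpha_neg_one hα]
  ring

theorem IsPosHom.integral_sq {α : ℝ} {φ : ℝ → ℝ} (hφ : IsPosHom α φ) (hα : -(1 / 2) < α)
    {v : NNReal} (hv : v ≠ 0) :
    ∫ x, φ x * φ x ∂(gaussianReal 0 v) = cAlpha α * (v : ℝ) ^ α * jPhi α φ 1 := by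
  have h : ∫ x, φ x * φ x ∂(gaussianReal 0 v) =
      ∫ x, (φ 1 ^ 2 * rhoAlpha α x ^ 2 + φ (-1) ^ 2 * rhoAlpha α (-x) ^ 2) ∂(gaussianReal 0 v) := by
    refine integral_congr_ae ?_
    filter_upwards [ae_gaussianReal_ne_zero hv] with x hx
    exact hφ.sq_eq hx
  rw [h, integral_add ((integrable_rho_sq hα hv).const_mul _)
    ((integrable_rho_neg_sq hα hv).const_mul _), integral_const_mul, integral_const_mul,
    integral_rho_sq hα hv, integral_rho_neg_sq hα hv, jPhi_one hα]
  ring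

/-! ### Moments of one or two coordinates of a Gaussian vector. -/

section Multivariate

variable {ι : Type*} [Fintype ι] [DecidableEq ι] {S : Matrix ι ι ℝ}

theorem ae_eval_ne_zero (hS : S.PosSemidef) {i : ι} (hi : 0 < S i i) :
    ∀ᵐ x ∂(multivariateGaussian 0 S), x i ≠ 0 := by
  have h := measurePreserving_eval_multivariateGaussian (μ := 0) hS (i := i)
  exact h.quasiMeasurePreserving.ae (ae_gaussianReal_ne_zero (by simpa using hi))

theorem IsPosHom.integrable_eval_sq {α : ℝ} {φ : ℝ → ℝ} (hφ : IsPosHom α φ) (hα : -(1 / 2) < α)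
    (hS : S.PosSemidef) {i : ι} (hi : 0 < S i i) :
    Integrable (fun x => φ (x i) * φ (x i)) (multivariateGaussian 0 S) := by
  have h := measurePreserving_eval_multivariateGaussian (μ := 0) hS (i := i)
  exact h.integrable_comp_of_integrable
    (hφ.integrable_sq hα (v := (S i i).toNNReal) (by simpa using hi))

theorem IsPosHom.integral_eval_sq {α : ℝ} {φ : ℝ → ℝ} (hφ : IsPosHom α φ) (hα : -(1 / 2) < α)
    (hS : S.PosSemidef) {i : ι} (hi : 0 < S i i) :
    ∫ x, φ (x i) * φ (x i) ∂(multivariateGaussian 0 S) =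
      cAlpha α * S i i ^ α * jPhi α φ 1 := by
  have h := measurePreserving_eval_multivariateGaussian (μ := 0) hS (i := i)
  have hm := hφ.measurable
  have h2 := hφ.integral_sq hα (v := (S i i).toNNReal) (by simpa using hi)
  rw [Real.coe_toNNReal _ hi.le] at h2
  rw [← h2, ← PiLp.zero_apply (p := 2) (β := fun _ : ι => ℝ) (i := i), ← h.map_eq,
    integral_map h.measurable.aemeasurable
    (by fun_prop)]

theorem integrable_mul_of_sq {Ω : Type*} [MeasurableSpace Ω] {μ : Measure Ω} {f g : Ω → ℝ}
    (hf : AEStronglyMeasurable f μ) (hg : AEStronglyMeasurable g μ)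
    (hf2 : Integrable (fun x => f x * f x) μ) (hg2 : Integrable (fun x => g x * g x) μ) :
    Integrable (fun x => f x * g x) μ := by
  refine (hf2.add hg2).mono' (hf.mul hg) (Eventually.of_forall fun x => ?_)
  rw [Real.norm_eq_abs, abs_le]
  simp only [Pi.add_apply]
  constructor <;> nlinarith [sq_nonneg (f x + g x), sq_nonneg (f x - g x)]

theorem IsPosHom.integrable_eval_mul {α : ℝ} {φ₁ φ₂ : ℝ → ℝ} (h₁ : IsPosHom α φ₁)
    (h₂ : IsPosHom α φ₂) (hα : -(1 / 2) < α)
    (hS : S.PosSemidef) {i j : ι} (hi : 0 < S i i) (hj : 0 < S j j) :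
    Integrable (fun x => φ₁ (x i) * φ₂ (x j)) (multivariateGaussian 0 S) := by
  have hm := h₁.measurable
  have hm' := h₂.measurable
  exact integrable_mul_of_sq (Measurable.aestronglyMeasurable (by fun_prop))
    (Measurable.aestronglyMeasurable (by fun_prop)) (h₁.integrable_eval_sq hα hS hi)
    (h₂.integrable_eval_sq hα hS hj)

end Multivariate

theorem isPosHom_rhoAlpha (α : ℝ) : IsPosHom α (rhoAlpha α) := fun _ x hr => rhoAlpha_mul hr x

theorem isPosHom_rhoAlpha_neg (α : ℝ) : IsPosHom α (fun x => rhoAlpha α (-x)) := fun r x hr => by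
  simp only
  rw [← rhoAlpha_mul hr, mul_neg]

/-- The `2 × 2` correlation matrix. -/
def corrMat (c : ℝ) : Matrix (Fin 2) (Fin 2) ℝ := !![1, c; c, 1]

theorem corrMat_det (c : ℝ) : (corrMat c).det = 1 - c ^ 2 := by
  rw [corrMat, Matrix.det_fin_two_of]
  ring

theorem corrMat_posDef {c : ℝ} (h1 : -1 < c) (h2 : c < 1) : (corrMat c).PosDef := by
  refine Matrix.PosDef.of_dotProduct_mulVec_pos ?_ fun x hx => ?_
  · ext i j
    fin_cases i <;> fin_cases j <;> simp [corrMat]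
  · have h3 := one_sub_sq_pos h1 h2
    have e : star x ⬝ᵥ (corrMat c).mulVec x = (x 0 + c * x 1) ^ 2 + (1 - c ^ 2) * x 1 ^ 2 := by
      simp [corrMat, dotProduct, Matrix.mulVec, Fin.sum_univ_two]
      ring
    rw [e]
    by_cases h : x 1 = 0
    · have h0 : x 0 ≠ 0 := fun h0 => hx (by ext i; fin_cases i <;> simp [h, h0])
      rw [h]
      have : 0 < x 0 ^ 2 := by positivity
      simpa using this
    · have : 0 < x 1 ^ 2 := by positivity
      positivity

theorem corrMat_inv {c : ℝ} (h1 : -1 < c) (h2 : c < 1) :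
    (corrMat c)⁻¹ = (1 - c ^ 2)⁻¹ • !![1, -c; -c, 1] := by
  have h3 := (one_sub_sq_pos h1 h2).ne'
  refine Matrix.inv_eq_right_inv ?_
  ext i j
  fin_cases i <;> fin_cases j <;> simp [corrMat] <;> field_simp <;> ring

theorem gaussInt_corrMat {c : ℝ} (h1 : -1 < c) (h2 : c < 1) (f : ℝ → ℝ → ℝ) :
    gaussInt (fun y : EuclideanSpace ℝ (Fin 2) => f (y 0) (y 1))
      (Matrix.toEuclideanCLM (𝕜 := ℝ) (corrMat c)⁻¹) =
      ∫ p : ℝ × ℝ, f p.1 p.2 * bivExp c p := by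
  have h3 := (one_sub_sq_pos h1 h2).ne'
  rw [gaussInt, ← (PiLp.volume_preserving_toLp (Fin 2)).integral_comp
    (MeasurableEquiv.toLp 2 _).measurableEmbedding,
    ← (volume_preserving_finTwoArrow ℝ).integral_comp
      (MeasurableEquiv.finTwoArrow).measurableEmbedding]
  refine integral_congr_ae (Eventually.of_forall fun y => ?_)
  simp only [Matrix.inner_toEuclideanCLM, corrMat_inv h1 h2, bivExp,
    MeasurableEquiv.finTwoArrow_apply]
  congr 2
  simp [dotProduct, Matrix.mulVec, Fin.sum_univ_two]
  field_simp
  ring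

theorem gaussAvg_corrMat {c : ℝ} (h1 : -1 < c) (h2 : c < 1) {f : ℝ → ℝ → ℝ}
    (hf : Measurable fun y : EuclideanSpace ℝ (Fin 2) => f (y 0) (y 1)) :
    ∫ y : EuclideanSpace ℝ (Fin 2), f (y 0) (y 1) ∂(multivariateGaussian 0 (corrMat c)) =
      (2 * Real.pi * √(1 - c ^ 2))⁻¹ * ∫ p : ℝ × ℝ, f p.1 p.2 * bivExp c p := by
  rw [integral_multivariateGaussian (corrMat_posDef h1 h2) hf, gaussAvg, gaussInt_corrMat h1 h2,
    gaussInt_one_toEuclideanCLM (corrMat_posDef h1 h2), corrMat_det, div_eq_inv_mul]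
  simp

theorem integral_rho_mul_rho {α c : ℝ} (hα : -(1 / 2) < α) (h1 : -1 < c) (h2 : c < 1) :
    ∫ y, rhoAlpha α (y 0) * rhoAlpha α (y 1) ∂(multivariateGaussian 0 (corrMat c)) =
      cAlpha α * jAlpha α c := by
  have hρ := measurable_rhoAlpha α
  have h3 : √(1 - c ^ 2) ≠ 0 := (Real.sqrt_pos.2 (one_sub_sq_pos h1 h2)).ne'
  have hpi := Real.pi_pos
  rw [gaussAvg_corrMat h1 h2 (f := fun x y => rhoAlpha α x * rhoAlpha α y) (by fun_prop),
    integral_quadrant hα h1 h2]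
  field_simp

/-- Flipping signs of coordinates is a linear map, which multiplies the correlation by the product
of the signs. -/
theorem integral_corrMat_signs {c : ℝ} (h1 : -1 < c) (h2 : c < 1) (ε : Fin 2 → ℝ)
    (h0 : ε 0 ^ 2 = 1) (h0' : ε 1 ^ 2 = 1) {f : ℝ → ℝ → ℝ}
    (hf : Measurable fun y : EuclideanSpace ℝ (Fin 2) => f (y 0) (y 1)) :
    ∫ y : EuclideanSpace ℝ (Fin 2), f (ε 0 * y 0) (ε 1 * y 1)
        ∂(multivariateGaussian 0 (corrMat c)) =
      ∫ y : EuclideanSpace ℝ (Fin 2), f (y 0) (y 1)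
        ∂(multivariateGaussian 0 (corrMat (ε 0 * ε 1 * c))) := by
  have e : corrMat (ε 0 * ε 1 * c) =
      Matrix.diagonal ε * corrMat c * (Matrix.diagonal ε).transpose := by
    ext i j
    fin_cases i <;> fin_cases j <;>
      simp [corrMat, Matrix.diagonal_transpose, Matrix.diagonal_mul, Matrix.mul_diagonal] <;>
      linarith
  rw [e, integral_map_multivariateGaussian (corrMat_posDef h1 h2).posSemidef _ hf]
  refine integral_congr_ae (Eventually.of_forall fun y => ?_)
  simp [mulVecE_apply, Matrix.diagonal_apply]

/-- Splitting `φ` into its two one-sided parts gives four quadrant integrals: equal signs produce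
`J_α(c)`, opposite signs `J_α(-c)`. -/
theorem IsPosHom.integral_corrMat {α : ℝ} {φ : ℝ → ℝ} (hφ : IsPosHom α φ) (hα : -(1 / 2) < α)
    {c : ℝ} (h1 : -1 < c) (h2 : c < 1) :
    ∫ y, φ (y 0) * φ (y 1) ∂(multivariateGaussian 0 (corrMat c)) = cAlpha α * jPhi α φ c := by
  have hS := (corrMat_posDef h1 h2).posSemidef
  have h0 : 0 < corrMat c 0 0 := by simp [corrMat]
  have h0' : 0 < corrMat c 1 1 := by simp [corrMat]
  have hρ := measurable_rhoAlpha α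
  have hm : Measurable fun y : EuclideanSpace ℝ (Fin 2) => rhoAlpha α (y 0) * rhoAlpha α (y 1) := by
    fun_prop
  have ipp := (isPosHom_rhoAlpha α).integrable_eval_mul (isPosHom_rhoAlpha α) hα hS h0 h0'
  have ipm := (isPosHom_rhoAlpha α).integrable_eval_mul (isPosHom_rhoAlpha_neg α) hα hS h0 h0'
  have imp := (isPosHom_rhoAlpha_neg α).integrable_eval_mul (isPosHom_rhoAlpha α) hα hS h0 h0'
  have imm := (isPosHom_rhoAlpha_neg α).integrable_eval_mul (isPosHom_rhoAlpha_neg α) hα hS h0 h0'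
  have vmm := integral_corrMat_signs h1 h2 ![-1, -1] (by simp) (by simp)
    (f := fun x y => rhoAlpha α x * rhoAlpha α y) hm
  have vpm := integral_corrMat_signs h1 h2 ![1, -1] (by simp) (by simp)
    (f := fun x y => rhoAlpha α x * rhoAlpha α y) hm
  have vmp := integral_corrMat_signs h1 h2 ![-1, 1] (by simp) (by simp)
    (f := fun x y => rhoAlpha α x * rhoAlpha α y) hm
  simp only [Matrix.cons_val_zero, Matrix.cons_val_one, neg_mul, one_mul, mul_neg, mul_one,
    neg_neg] at vmm vpm vmp
  rw [integral_rho_mul_rho hα h1 h2] at vmm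
  rw [integral_rho_mul_rho hα (by linarith) (by linarith)] at vpm vmp
  have h : ∫ y, φ (y 0) * φ (y 1) ∂(multivariateGaussian 0 (corrMat c)) =
      ∫ y, (φ 1 ^ 2 * (rhoAlpha α (y 0) * rhoAlpha α (y 1)) +
        φ (-1) ^ 2 * (rhoAlpha α (-(y 0)) * rhoAlpha α (-(y 1))) +
        (φ 1 * φ (-1) * (rhoAlpha α (y 0) * rhoAlpha α (-(y 1))) +
          φ 1 * φ (-1) * (rhoAlpha α (-(y 0)) * rhoAlpha α (y 1))))
        ∂(multivariateGaussian 0 (corrMat c)) := by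
    refine integral_congr_ae ?_
    filter_upwards [ae_eval_ne_zero hS h0, ae_eval_ne_zero hS h0'] with y hy0 hy1
    rw [hφ.eq_of_ne_zero hy0, hφ.eq_of_ne_zero hy1]
    ring
  have jpp := ipp.const_mul (φ 1 ^ 2)
  have jmm := imm.const_mul (φ (-1) ^ 2)
  have jpm := ipm.const_mul (φ 1 * φ (-1))
  have jmp := imp.const_mul (φ 1 * φ (-1))
  have a1 := integral_add (jpp.add jmm) (jpm.add jmp)
  have a2 := integral_add jpp jmm
  have a3 := integral_add jpm jmp
  simp only [Pi.add_apply] at a1 a2 a3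
  rw [h, a1, a2, a3, integral_const_mul, integral_const_mul,
    integral_const_mul, integral_const_mul, integral_rho_mul_rho hα h1 h2, vmm, vpm, vmp, jPhi]
  ring

theorem IsPosHom.integral_eval_mul {ι : Type*} [Fintype ι] [DecidableEq ι] {S : Matrix ι ι ℝ}
    {α : ℝ} {φ : ℝ → ℝ} (hφ : IsPosHom α φ) (hα : -(1 / 2) < α)
    (hS : S.PosSemidef) {i j : ι} {s t c : ℝ} (hs : 0 < s) (ht : 0 < t)
    (hi : S i i = s ^ 2) (hj : S j j = t ^ 2) (hij : S i j = c * (s * t))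
    (h1 : -1 < c) (h2 : c < 1) :
    ∫ x, φ (x i) * φ (x j) ∂(multivariateGaussian 0 S) =
      cAlpha α * (s * t) ^ α * jPhi α φ c := by
  have hm := hφ.measurable
  -- `M` selects the coordinates `i, j` and divides them by their standard deviations.
  obtain ⟨M, hM⟩ : ∃ M : Matrix (Fin 2) ι ℝ,
      M = Matrix.of fun k l => if l = (![i, j] : Fin 2 → ι) k then
        ((![s, t] : Fin 2 → ℝ) k)⁻¹ else 0 :=
    ⟨_, rfl⟩
  have hji : S j i = c * (s * t) := by
    rw [← hij]
    have := hS.1.apply i j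
    simpa using this
  have hMS : M * S * M.transpose = corrMat c := by
    have e : ∀ k l, (M * S * M.transpose) k l = ((![s, t] : Fin 2 → ℝ) k)⁻¹ *
        S ((![i, j] : Fin 2 → ι) k) ((![i, j] : Fin 2 → ι) l) * ((![s, t] : Fin 2 → ℝ) l)⁻¹ := by
      intro k l
      simp [hM, Matrix.mul_apply]
    ext k l
    rw [e]
    fin_cases k <;> fin_cases l <;> simp [corrMat, hi, hj, hij, hji] <;> field_simp
  have hMx : ∀ (x : EuclideanSpace ℝ ι) k, mulVecE M x k =
      ((![s, t] : Fin 2 → ℝ) k)⁻¹ * x ((![i, j] : Fin 2 → ι) k) := by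
    intro x k
    simp [mulVecE_apply, hM]
  have h := integral_map_multivariateGaussian hS M
    (f := fun y : EuclideanSpace ℝ (Fin 2) => φ (y 0) * φ (y 1)) (by fun_prop)
  rw [hMS, hφ.integral_corrMat hα h1 h2] at h
  have e : ∀ x : EuclideanSpace ℝ ι, φ (x i) * φ (x j) =
      (s * t) ^ α * (φ (mulVecE M x 0) * φ (mulVecE M x 1)) := by
    intro x
    have e1 : s * mulVecE M x 0 = x i := by
      rw [hMx]
      simp [hs.ne']
    have e2 : t * mulVecE M x 1 = x j := by
      rw [hMx]
      simp [ht.ne']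
    rw [← e1, ← e2, hφ s _ hs, hφ t _ ht, Real.mul_rpow hs.le ht.le]
    ring
  simp_rw [e]
  rw [integral_const_mul, ← h]
  ring


/-! ### An isometric parametrization of the centered subspace -/

/-- The columns of `W` are an orthonormal basis of the orthogonal complement of the all-ones vector,
and `WWᵀ` is the projection onto it. -/
theorem exists_orthonormal_columns {B : ℕ} (hB : 4 ≤ B) :
    ∃ W : Matrix (Fin B) (Fin (B - 1)) ℝ, W.transpose * W = 1 ∧ W * W.transpose = gMat B := by
  have hB' : (B : ℝ) ≠ 0 := by positivity
  obtain ⟨o, ho⟩ : ∃ o : EuclideanSpace ℝ (Fin B), ∀ i, o i = 1 :=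
    ⟨WithLp.toLp 2 fun _ => 1, fun _ => rfl⟩
  have ho0 : o ≠ 0 := by
    intro h
    have := ho ⟨0, by omega⟩
    rw [h] at this
    simp at this
  have : Fact (Module.finrank ℝ (EuclideanSpace ℝ (Fin B)) = (B - 1) + 1) :=
    ⟨by rw [finrank_euclideanSpace, Fintype.card_fin]; omega⟩
  have hfr : Module.finrank ℝ ((Submodule.span ℝ {o})ᗮ : Submodule ℝ _) = B - 1 :=
    Submodule.finrank_orthogonal_span_singleton ho0
  let b := (stdOrthonormalBasis ℝ ((Submodule.span ℝ {o})ᗮ : Submodule ℝ _)).reindex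
    (finCongr hfr)
  let W : Matrix (Fin B) (Fin (B - 1)) ℝ := Matrix.of fun i k => (b k : EuclideanSpace ℝ (Fin B)) i
  have hb : ∀ k, ∑ i, (b k : EuclideanSpace ℝ (Fin B)) i = 0 := by
    intro k
    have h := Submodule.mem_orthogonal_singleton_iff_inner_right.1 (b k).2
    simpa [PiLp.inner_apply, ho] using h
  refine ⟨W, ?_, ?_⟩
  · ext k l
    have h := orthonormal_iff_ite.1 b.orthonormal k l
    rw [Submodule.coe_inner, PiLp.inner_apply] at h
    simpa [W, Matrix.mul_apply, Matrix.one_apply, mul_comm] using h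
  · ext i j
    -- Column `j` of `G` has sum zero, and its coefficient on the `k`-th basis vector is that
    -- vector's `j`-th entry; the expansion is column `j` of `WWᵀ`.
    let y : EuclideanSpace ℝ (Fin B) := WithLp.toLp 2 fun l => gMat B l j
    have hy : y ∈ (Submodule.span ℝ {o})ᗮ := by
      rw [Submodule.mem_orthogonal_singleton_iff_inner_right]
      simp [PiLp.inner_apply, ho, y, gMat_apply, Finset.sum_sub_distrib, hB']
    have h := congrArg (fun z : ((Submodule.span ℝ {o})ᗮ : Submodule ℝ _) =>
      (z : EuclideanSpace ℝ (Fin B)) i) (b.sum_repr ⟨y, hy⟩)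
    have hr : ∀ k, b.repr ⟨y, hy⟩ k = (b k : EuclideanSpace ℝ (Fin B)) j := by
      intro k
      rw [b.repr_apply_apply, Submodule.coe_inner, PiLp.inner_apply]
      simp [y, gMat_apply, sub_mul, Finset.sum_sub_distrib, ← Finset.mul_sum, hb]
    simp only [hr, Submodule.coe_sum, Submodule.coe_smul, WithLp.ofLp_sum, Finset.sum_apply,
      WithLp.ofLp_smul, Pi.smul_apply, smul_eq_mul] at h
    simp only [Matrix.mul_apply, W, Matrix.transpose_apply, Matrix.of_apply]
    rw [show gMat B i j = y i from rfl, ← h]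
    exact Finset.sum_congr rfl fun k _ => mul_comm _ _

/-- The derivative of inversion at `1` is `-1`. It passes from precision back to covariance and
cancels the sign in `hasFDerivAt_gaussAvg`. -/
theorem hasFDerivAt_comp_inverse {V R : Type*} [NormedAddCommGroup V] [NormedSpace ℝ V]
    [NormedRing R] [HasSummableGeomSeries R] [NormedAlgebra ℝ R] {F : R → ℝ} {D : R →L[ℝ] ℝ}
    (hF : HasFDerivAt F D 1) (L : V →L[ℝ] R) {v : V} (hv : L v = 1) :
    ∃ D' : V →L[ℝ] ℝ, HasFDerivAt (fun x => F (Ring.inverse (L x))) D' v ∧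
      ∀ x, D' x = -D (L x) := by
  have hinv := hasFDerivAt_ringInverse (𝕜 := ℝ) (1 : Rˣ)
  rw [Units.val_one, ← hv] at hinv
  have hF' : HasFDerivAt F D ((Ring.inverse ∘ L) v) := by
    rw [Function.comp_apply, hv, Ring.inverse_one]
    exact hF
  exact ⟨_, hF'.comp v (hinv.comp v L.hasFDerivAt), fun x => by simp⟩

theorem conj_chart {B : ℕ} {κ : Type*} [Fintype κ] {W : Matrix (Fin B) κ ℝ}
    (h2 : W * W.transpose = gMat B) (S : SymG B) :
    W * (W.transpose * (S : Matrix (Fin B) (Fin B) ℝ) * W) * W.transpose = S := by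
  have h : W * (W.transpose * (S : Matrix (Fin B) (Fin B) ℝ) * W) * W.transpose =
      (W * W.transpose) * (S : Matrix (Fin B) (Fin B) ℝ) * (W * W.transpose) := by
    simp only [Matrix.mul_assoc]
  rw [h, h2, S.2.2]

section Chart

variable {B : ℕ} {κ : Type*} [Fintype κ] [DecidableEq κ] {W : Matrix (Fin B) κ ℝ}

/-- The covariance operator of a centered Gaussian in the coordinates given by `W`. -/
noncomputable def chartOp (W : Matrix (Fin B) κ ℝ) :
    SymG B →ₗ[ℝ] (EuclideanSpace ℝ κ →L[ℝ] EuclideanSpace ℝ κ) where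
  toFun S := Matrix.toEuclideanCLM (𝕜 := ℝ) (W.transpose * (S : Matrix (Fin B) (Fin B) ℝ) * W)
  map_add' S T := by
    rw [Submodule.coe_add, Matrix.mul_add, Matrix.add_mul, map_add]
  map_smul' c S := by
    rw [Submodule.coe_smul, Matrix.mul_smul, Matrix.smul_mul, map_smul, RingHom.id_apply]

theorem chartOp_gElt (h1 : W.transpose * W = 1) (h2 : W * W.transpose = gMat B) :
    chartOp W (gElt B) = 1 := by
  have h : W.transpose * gMat B * W = 1 := by
    rw [← h2, ← Matrix.mul_assoc, h1, Matrix.one_mul, h1]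
  change Matrix.toEuclideanCLM (𝕜 := ℝ) (W.transpose * gMat B * W) = 1
  rw [h, map_one]

theorem norm_mulVecE (h1 : W.transpose * W = 1) (z : EuclideanSpace ℝ κ) : ‖mulVecE W z‖ = ‖z‖ := by
  have h : inner ℝ (mulVecE W z) (mulVecE W z) = inner ℝ z z := by
    rw [inner_mulVecE, mulVecE_mulVecE, h1]
    simp [mulVecE]
  rw [real_inner_self_eq_norm_sq, real_inner_self_eq_norm_sq] at h
  exact (sq_eq_sq₀ (norm_nonneg _) (norm_nonneg _)).1 h

theorem posDef_of_norm_lt {M : Matrix κ κ ℝ} (hM : M.IsSymm)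
    (h : ‖Matrix.toEuclideanCLM (𝕜 := ℝ) M - 1‖ < 1 / 2) : M.PosDef := by
  refine Matrix.PosDef.of_dotProduct_mulVec_pos ?_ fun x hx => ?_
  · rw [Matrix.IsHermitian, Matrix.conjTranspose_eq_transpose_of_trivial]
    exact hM
  · obtain ⟨A, hA⟩ : ∃ A, A = Matrix.toEuclideanCLM (𝕜 := ℝ) M := ⟨_, rfl⟩
    obtain ⟨z, hz⟩ : ∃ z : EuclideanSpace ℝ κ, z = WithLp.toLp 2 x := ⟨_, rfl⟩
    rw [← hA] at h
    have h2 : inner ℝ z (A z) = x ⬝ᵥ M.mulVec x := by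
      rw [hA, hz, Matrix.toEuclideanCLM_toLp, inner_eq_dotProduct]
    have h3 : 0 < ‖z‖ := by
      rw [norm_pos_iff, hz]
      intro h0
      exact hx (by simpa using h0)
    have h4 : |inner ℝ z ((A - 1) z)| ≤ 1 / 2 * ‖z‖ ^ 2 := by
      calc |inner ℝ z ((A - 1) z)| ≤ ‖z‖ * ‖(A - 1) z‖ := abs_real_inner_le_norm _ _
        _ ≤ ‖z‖ * (1 / 2 * ‖z‖) := by
          gcongr
          exact ((A - 1).le_opNorm z).trans (by gcongr)
        _ = _ := by ring
    have h5 : inner ℝ z ((A - 1) z) = inner ℝ z (A z) - ‖z‖ ^ 2 := by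
      rw [sub_apply, inner_sub_right, one_apply_eq_self,
        real_inner_self_eq_norm_sq]
    have h6 : 0 < ‖z‖ ^ 2 := by positivity
    rw [star_trivial, ← h2]
    have := (abs_le.1 h4).1
    linarith

theorem toEuclideanCLM_inv {M : Matrix κ κ ℝ} (hM : IsUnit M) :
    Matrix.toEuclideanCLM (𝕜 := ℝ) M⁻¹ = Ring.inverse (Matrix.toEuclideanCLM (𝕜 := ℝ) M) := by
  have h := Ring.inverse_mul_cancel_left (Matrix.toEuclideanCLM (𝕜 := ℝ) M)
    (Matrix.toEuclideanCLM (𝕜 := ℝ) M⁻¹) (hM.map _)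
  rw [← map_mul, Matrix.mul_nonsing_inv _ ((Matrix.isUnit_iff_isUnit_det M).1 hM), map_one,
    mul_one] at h
  exact h.symm

attribute [local instance] Matrix.normedAddCommGroup Matrix.normedSpace

theorem continuous_chartOp (W : Matrix (Fin B) κ ℝ) : Continuous (chartOp W) :=
  (chartOp W).continuous_of_finiteDimensional

theorem eventually_posDef (h1 : W.transpose * W = 1) (h2 : W * W.transpose = gMat B) :
    ∀ᶠ S : SymG B in 𝓝 (gElt B), (W.transpose * (S : Matrix (Fin B) (Fin B) ℝ) * W).PosDef := by
  have h := (continuous_chartOp W).tendsto (gElt B)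
  rw [chartOp_gElt h1 h2] at h
  filter_upwards [h.eventually (Metric.ball_mem_nhds _ one_half_pos)] with S hS
  refine posDef_of_norm_lt ?_ ?_
  · rw [Matrix.IsSymm, Matrix.transpose_mul, Matrix.transpose_mul, Matrix.transpose_transpose,
      S.2.1, Matrix.mul_assoc]
  · rw [dist_eq_norm] at hS
    exact hS

theorem eventually_posSemidef (h1 : W.transpose * W = 1) (h2 : W * W.transpose = gMat B) :
    ∀ᶠ S : SymG B in 𝓝 (gElt B), (S : Matrix (Fin B) (Fin B) ℝ).PosSemidef := by
  filter_upwards [eventually_posDef h1 h2] with S hS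
  rw [← conj_chart h2 S]
  exact posSemidef_conj hS.posSemidef W

theorem integral_chart (h2 : W * W.transpose = gMat B) {S : SymG B}
    (hS : (W.transpose * (S : Matrix (Fin B) (Fin B) ℝ) * W).PosDef)
    {f : EuclideanSpace ℝ (Fin B) → ℝ} (hf : Measurable f) :
    ∫ x, f x ∂(multivariateGaussian 0 (S : Matrix (Fin B) (Fin B) ℝ)) =
      gaussAvg (fun z => f (mulVecE W z)) (Ring.inverse (chartOp W S)) := by
  conv_lhs => rw [← conj_chart h2 S]
  have hm : Measurable fun z => f (mulVecE W z) := hf.comp (continuous_mulVecE W).measurable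
  rw [integral_map_multivariateGaussian hS.posSemidef W hf, integral_multivariateGaussian hS hm,
    toEuclideanCLM_inv hS.isUnit]
  rfl

theorem hasFDerivAt_integral_chart (h1 : W.transpose * W = 1) (h2 : W * W.transpose = gMat B)
    {f : EuclideanSpace ℝ (Fin B) → ℝ} (hf : Measurable f)
    (hi : GaussIntegrable fun z => f (mulVecE W z)) :
    ∃ D : SymG B →L[ℝ] ℝ, HasFDerivAt
      (fun S : SymG B => ∫ x, f x ∂(multivariateGaussian 0 (S : Matrix (Fin B) (Fin B) ℝ)))
      D (gElt B) ∧
      ∀ T, D T = 1 / 2 *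
        (gaussAvg (fun z => f (mulVecE W z) * inner ℝ z (chartOp W T z)) 1 -
          gaussAvg (fun z => f (mulVecE W z)) 1 *
            gaussAvg (fun z => inner ℝ z (chartOp W T z)) 1) := by
  obtain ⟨D, hD, hDT⟩ := hasFDerivAt_gaussAvg hi
  obtain ⟨D', hD', hDT'⟩ := hasFDerivAt_comp_inverse (V := SymG B) hD
    ⟨chartOp W, continuous_chartOp W⟩ (chartOp_gElt h1 h2)
  refine ⟨D', hD'.congr_of_eventuallyEq ?_, fun T => ?_⟩
  · filter_upwards [eventually_posDef h1 h2] with S hS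
    exact integral_chart h2 hS hf
  · refine (hDT' T).trans ((congrArg Neg.neg (hDT (chartOp W T))).trans ?_)
    ring

end Chart


/-! ### Gaussian expectations of homogeneous functions -/

/-- The radial factor of the Gaussian integral of a function homogeneous of degree `β`. -/
theorem integral_radial {n : ℕ} (hn : 0 < n) {β : ℝ} (hβ : 0 < (n : ℝ) + β) :
    ∫ r in Set.Ioi (0 : ℝ), r ^ (n - 1) * (r ^ β * Real.exp (-(1 / 2) * r ^ 2)) =
      (2 : ℝ) ^ (((n : ℝ) + β) / 2 - 1) * Real.Gamma (((n : ℝ) + β) / 2) := by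
  have h : ∫ r in Set.Ioi (0 : ℝ), r ^ (n - 1) * (r ^ β * Real.exp (-(1 / 2) * r ^ 2)) =
      ∫ r in Set.Ioi (0 : ℝ), r ^ ((n : ℝ) + β - 1) * Real.exp (-(1 / 2) * r ^ (2 : ℝ)) := by
    refine setIntegral_congr_fun measurableSet_Ioi fun r hr => ?_
    have e : (n : ℝ) + β - 1 = ((n - 1 : ℕ) : ℝ) + β := by
      rw [Nat.cast_sub hn]
      push_cast
      ring
    rw [e, Real.rpow_add hr, Real.rpow_natCast, Real.rpow_two, mul_assoc]
  rw [h, integral_rpow_mul_exp_neg_mul_rpow two_pos (by linarith) (by norm_num),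
    show ((n : ℝ) + β - 1 + 1) / 2 = ((n : ℝ) + β) / 2 by ring,
    show -((n : ℝ) + β - 1 + 1) / 2 = -(((n : ℝ) + β) / 2) by ring, one_div,
    Real.inv_rpow two_pos.le, Real.rpow_neg two_pos.le, inv_inv, Real.rpow_sub two_pos,
    Real.rpow_one]
  ring

section Homogeneous

variable {E : Type*} [NormedAddCommGroup E] [InnerProductSpace ℝ E] [FiniteDimensional ℝ E]
  [MeasurableSpace E] [BorelSpace E] [Nontrivial E]

/-- The spherical integrals differ by the factor `C`. The radial ones are Gamma integrals at
`(n+β)/2` and `(n+β)/2 + α`, whose ratio is the Pochhammer factor with `2^(-α)`. -/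
theorem gaussAvg_eq_of_homogeneous {α β C : ℝ} {f g : E → ℝ}
    (hf : ∀ r x, 0 < r → f (r • x) = r ^ β * f x)
    (hg : ∀ r x, 0 < r → g (r • x) = r ^ (β + 2 * α) * g x)
    (hfg : ∀ u, ‖u‖ = 1 → f u = C * g u) (h1 : 0 < (Module.finrank ℝ E : ℝ) + β)
    (h2 : 0 < (Module.finrank ℝ E : ℝ) + β + 2 * α) :
    gaussAvg f 1 = C * (2 : ℝ) ^ (-α) *
      (poch (((Module.finrank ℝ E : ℝ) + β) / 2) α)⁻¹ * gaussAvg g 1 := by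
  have hn : 0 < Module.finrank ℝ E := Module.finrank_pos
  have hs : ∫ u : Metric.sphere (0 : E) 1, f u ∂(volume : Measure E).toSphere =
      C * ∫ u : Metric.sphere (0 : E) 1, g u ∂(volume : Measure E).toSphere := by
    rw [← integral_const_mul]
    exact integral_congr_ae (Eventually.of_forall fun u => hfg u (by simp))
  have kf := integral_homogeneous_mul_norm volume hf (fun r => Real.exp (-(1 / 2) * r ^ 2))
  have kg := integral_homogeneous_mul_norm volume hg (fun r => Real.exp (-(1 / 2) * r ^ 2))
  have h3 : 0 < (Module.finrank ℝ E : ℝ) + (β + 2 * α) := by linarith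
  rw [integral_radial hn h1, hs] at kf
  rw [integral_radial hn h3] at kg
  have e : ((Module.finrank ℝ E : ℝ) + (β + 2 * α)) / 2 =
      ((Module.finrank ℝ E : ℝ) + β) / 2 + α := by ring
  have hG1 : Real.Gamma (((Module.finrank ℝ E : ℝ) + β) / 2) ≠ 0 :=
    (Real.Gamma_pos_of_pos (by linarith)).ne'
  have hG2 : Real.Gamma (((Module.finrank ℝ E : ℝ) + β) / 2 + α) ≠ 0 :=
    (Real.Gamma_pos_of_pos (by linarith)).ne'
  have hp : (2 : ℝ) ^ (((Module.finrank ℝ E : ℝ) + β) / 2 + α - 1) =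
      (2 : ℝ) ^ α * (2 : ℝ) ^ (((Module.finrank ℝ E : ℝ) + β) / 2 - 1) := by
    rw [← Real.rpow_add two_pos]
    congr 1
    ring
  have h2a : (2 : ℝ) ^ α ≠ 0 := by positivity
  rw [gaussAvg, gaussAvg, gaussInt_one f, gaussInt_one g, kf, kg, e, hp, poch,
    Real.rpow_neg two_pos.le]
  field_simp

theorem gaussIntegrable_of_homogeneous {β γ C : ℝ} {f g : E → ℝ}
    (hf : ∀ r x, 0 < r → f (r • x) = r ^ β * f x)
    (hg : ∀ r x, 0 < r → g (r • x) = r ^ γ * g x)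
    (hfg : ∀ u, ‖u‖ = 1 → f u = C * g u) (h1 : -(Module.finrank ℝ E : ℝ) < β)
    (hi : Integrable g (stdGaussian E)) : GaussIntegrable f := by
  have h := integrable_toSphere_of_homogeneous volume hg ((integrable_stdGaussian_iff g).1 hi)
  intro ε hε
  refine integrable_of_integrable_toSphere volume hε hf h1 ((h.const_mul C).congr ?_)
  exact Eventually.of_forall fun u => (hfg u (by simp)).symm

end Homogeneous

theorem integral_eval_mul_stdGaussian {κ : Type*} [Fintype κ] [DecidableEq κ] (k l : κ) :
    ∫ z : EuclideanSpace ℝ κ, z k * z l ∂(stdGaussian (EuclideanSpace ℝ κ)) =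
      if k = l then 1 else 0 := by
  have h := covariance_eval_multivariateGaussian (μ := 0) (Matrix.PosSemidef.one (n := κ) (R := ℝ))
    k l
  rw [multivariateGaussian_zero_one] at h
  have h0 : ∀ k : κ, ∫ z : EuclideanSpace ℝ κ, z k ∂(stdGaussian (EuclideanSpace ℝ κ)) = 0 :=
    fun k => integral_strongDual_stdGaussian (EuclideanSpace.proj k)
  simp only [covariance, h0, sub_zero] at h
  rw [h, Matrix.one_apply]

theorem integrable_eval_mul_stdGaussian {κ : Type*} [Fintype κ] (k l : κ) :
    Integrable (fun z : EuclideanSpace ℝ κ => z k * z l) (stdGaussian (EuclideanSpace ℝ κ)) := by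
  have h := (gaussIntegrable_one (E := EuclideanSpace ℝ κ)).mul_of_le (h := fun z => z k * z l)
    (Continuous.aestronglyMeasurable (by fun_prop)) (C := 1) (fun z => by
      rw [abs_mul, one_mul, sq]
      exact mul_le_mul (PiLp.norm_apply_le z k) (PiLp.norm_apply_le z l) (by positivity)
        (by positivity)) (1 / 2) (by norm_num)
  rw [integrable_stdGaussian_iff]
  simpa using h

theorem gaussAvg_quadratic {κ : Type*} [Fintype κ] [DecidableEq κ] (M : Matrix κ κ ℝ) :
    gaussAvg (fun z => inner ℝ z (Matrix.toEuclideanCLM (𝕜 := ℝ) M z)) 1 = M.trace := by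
  have h : ∀ z : EuclideanSpace ℝ κ, inner ℝ z (Matrix.toEuclideanCLM (𝕜 := ℝ) M z) =
      ∑ k, ∑ l, M k l * (z k * z l) := by
    intro z
    rw [Matrix.inner_toEuclideanCLM]
    simp only [dotProduct, Matrix.mulVec, Finset.mul_sum]
    refine Finset.sum_congr rfl fun k _ => Finset.sum_congr rfl fun l _ => ?_
    ring
  rw [← integral_stdGaussian]
  simp_rw [h]
  have hi : ∀ k l, Integrable (fun z : EuclideanSpace ℝ κ => M k l * (z k * z l))
      (stdGaussian (EuclideanSpace ℝ κ)) := fun k l =>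
    (integrable_eval_mul_stdGaussian k l).const_mul _
  rw [integral_finsetSum _ fun k _ => integrable_finsetSum _ fun l _ => hi k l]
  refine Finset.sum_congr rfl fun k _ => ?_
  rw [integral_finsetSum _ fun l _ => hi k l]
  simp [integral_const_mul, integral_eval_mul_stdGaussian]

/-! ### Products `φ(x_i) φ(x_j)` in the coordinates of the centered subspace. -/

section Chart

variable {B : ℕ} {W : Matrix (Fin B) (Fin (B - 1)) ℝ} {α : ℝ} {φ : ℝ → ℝ}

theorem trace_chart (h2 : W * W.transpose = gMat B) (T : SymG B) :
    (W.transpose * (T : Matrix (Fin B) (Fin B) ℝ) * W).trace =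
      (T : Matrix (Fin B) (Fin B) ℝ).trace := by
  rw [Matrix.trace_mul_comm, ← Matrix.mul_assoc, h2]
  conv_rhs => rw [← T.2.2, Matrix.trace_mul_comm, ← Matrix.mul_assoc, gMat_mul_gMat]

theorem gMat_posSemidef (B : ℕ) : (gMat B).PosSemidef := by
  have h := posSemidef_conj (Matrix.PosSemidef.one (n := Fin B) (R := ℝ)) (gMat B)
  rwa [mul_one, gMat_transpose, gMat_mul_gMat] at h

theorem gMat_diag_pos (hB : 4 ≤ B) (i : Fin B) : 0 < gMat B i i := by
  have h : (4 : ℝ) ≤ B := by exact_mod_cast hB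
  have h2 : (B : ℝ)⁻¹ < 1 := inv_lt_one_of_one_lt₀ (by linarith)
  rw [gMat_apply]
  simpa using h2

theorem integral_gMat (h2 : W * W.transpose = gMat B)
    {f : EuclideanSpace ℝ (Fin B) → ℝ} (hf : Measurable f) :
    ∫ x, f x ∂(multivariateGaussian 0 (gMat B)) = gaussAvg (fun z => f (mulVecE W z)) 1 := by
  have h := integral_map_multivariateGaussian (Matrix.PosSemidef.one (n := Fin (B - 1)) (R := ℝ))
    W hf
  rwa [Matrix.mul_one, h2, multivariateGaussian_zero_one, integral_stdGaussian] at h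

theorem integrable_gMat (h2 : W * W.transpose = gMat B)
    {f : EuclideanSpace ℝ (Fin B) → ℝ} (hf : Measurable f) :
    Integrable f (multivariateGaussian 0 (gMat B)) ↔
      Integrable (fun z => f (mulVecE W z)) (stdGaussian (EuclideanSpace ℝ (Fin (B - 1)))) := by
  have h := integrable_map_multivariateGaussian
    (Matrix.PosSemidef.one (n := Fin (B - 1)) (R := ℝ)) W hf
  rwa [Matrix.mul_one, h2, multivariateGaussian_zero_one] at h

theorem mulVecE_smul (r : ℝ) (z : EuclideanSpace ℝ (Fin (B - 1))) :
    mulVecE W (r • z) = r • mulVecE W z := by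
  simp [mulVecE, Matrix.mulVec_smul]

theorem IsPosHom.homogeneous_mul (hφ : IsPosHom α φ) (i j : Fin B) {r : ℝ} (hr : 0 < r)
    (x : EuclideanSpace ℝ (Fin B)) :
    φ ((r • x) i) * φ ((r • x) j) = r ^ (2 * α) * (φ (x i) * φ (x j)) := by
  rw [PiLp.smul_apply, PiLp.smul_apply, smul_eq_mul, smul_eq_mul, hφ r _ hr, hφ r _ hr, two_mul,
    Real.rpow_add hr]
  ring

theorem phiN_smul (φ : ℝ → ℝ) {r : ℝ} (hr : 0 < r) (x : EuclideanSpace ℝ (Fin B)) (i : Fin B) :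
    phiN φ (r • x) i = phiN φ x i := by
  rw [phiN, phiN, PiLp.smul_apply, smul_eq_mul, norm_smul, Real.norm_eq_abs, abs_of_pos hr]
  congr 1
  rw [mul_left_comm, mul_div_mul_left _ _ hr.ne']

theorem IsPosHom.phiN_mul_of_norm_one (hφ : IsPosHom α φ) (hB : 4 ≤ B) (i j : Fin B)
    {x : EuclideanSpace ℝ (Fin B)} (hx : ‖x‖ = 1) :
    phiN φ x i * phiN φ x j = (B : ℝ) ^ α * (φ (x i) * φ (x j)) := by
  have hB' : (0 : ℝ) < B := by positivity
  have hs : 0 < √(B : ℝ) := by positivity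
  have e : (B : ℝ) ^ α = √(B : ℝ) ^ α * √(B : ℝ) ^ α := by
    rw [← Real.mul_rpow hs.le hs.le, Real.mul_self_sqrt hB'.le]
  rw [phiN, phiN, hx, div_one, div_one, hφ _ _ hs, hφ _ _ hs, e]
  ring

theorem IsPosHom.measurable_phiN (hφ : IsPosHom α φ) (i : Fin B) :
    Measurable fun x : EuclideanSpace ℝ (Fin B) => phiN φ x i := by
  have := hφ.measurable
  unfold phiN
  fun_prop

theorem IsPosHom.measurable_eval_mul (hφ : IsPosHom α φ) (i j : Fin B) :
    Measurable fun x : EuclideanSpace ℝ (Fin B) => φ (x i) * φ (x j) := by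
  have := hφ.measurable
  fun_prop

theorem nontrivial_chart (hB : 4 ≤ B) : Nontrivial (EuclideanSpace ℝ (Fin (B - 1))) := by
  have : 0 < Module.finrank ℝ (EuclideanSpace ℝ (Fin (B - 1))) := by
    rw [finrank_euclideanSpace, Fintype.card_fin]
    omega
  exact Module.nontrivial_of_finrank_pos this

theorem finrank_chart (hB : 4 ≤ B) :
    (Module.finrank ℝ (EuclideanSpace ℝ (Fin (B - 1))) : ℝ) = (B : ℝ) - 1 := by
  rw [finrank_euclideanSpace, Fintype.card_fin, Nat.cast_sub (by omega), Nat.cast_one]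

theorem IsPosHom.integrable_chart (hφ : IsPosHom α φ) (hα : -(1 / 2) < α) (hB : 4 ≤ B)
    (h2 : W * W.transpose = gMat B) (i j : Fin B) :
    Integrable (fun z => φ (mulVecE W z i) * φ (mulVecE W z j))
      (stdGaussian (EuclideanSpace ℝ (Fin (B - 1)))) :=
  (integrable_gMat h2 (hφ.measurable_eval_mul i j)).1
    (hφ.integrable_eval_mul hφ hα (gMat_posSemidef B) (gMat_diag_pos hB i) (gMat_diag_pos hB j))

theorem IsPosHom.gaussIntegrable_chart (hφ : IsPosHom α φ) (hα : -(1 / 2) < α) (hB : 4 ≤ B)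
    (h2 : W * W.transpose = gMat B) (i j : Fin B) :
    GaussIntegrable fun z => φ (mulVecE W z i) * φ (mulVecE W z j) := by
  have := nontrivial_chart hB
  have hB' : (4 : ℝ) ≤ B := by exact_mod_cast hB
  have hh : ∀ r (z : EuclideanSpace ℝ (Fin (B - 1))), 0 < r →
      φ (mulVecE W (r • z) i) * φ (mulVecE W (r • z) j) =
        r ^ (2 * α) * (φ (mulVecE W z i) * φ (mulVecE W z j)) := fun r z hr => by
    rw [mulVecE_smul, hφ.homogeneous_mul i j hr]
  exact gaussIntegrable_of_homogeneous (C := 1) hh hh (fun u _ => (one_mul _).symm)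
    (by rw [finrank_chart hB]; linarith) (hφ.integrable_chart hα hB h2 i j)

theorem IsPosHom.gaussIntegrable_phiN (hφ : IsPosHom α φ) (hα : -(1 / 2) < α) (hB : 4 ≤ B)
    (h1 : W.transpose * W = 1) (h2 : W * W.transpose = gMat B) (i j : Fin B) :
    GaussIntegrable fun z => phiN φ (mulVecE W z) i * phiN φ (mulVecE W z) j := by
  have := nontrivial_chart hB
  have hB' : (4 : ℝ) ≤ B := by exact_mod_cast hB
  refine gaussIntegrable_of_homogeneous (C := (B : ℝ) ^ α) (β := 0) (γ := 2 * α)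
    (g := fun z => φ (mulVecE W z i) * φ (mulVecE W z j)) (fun r z hr => ?_) (fun r z hr => ?_)
    (fun u hu => hφ.phiN_mul_of_norm_one hB i j ((norm_mulVecE h1 u).trans hu))
    (by rw [finrank_chart hB]; linarith) (hφ.integrable_chart hα hB h2 i j)
  · rw [mulVecE_smul, phiN_smul φ hr, phiN_smul φ hr, Real.rpow_zero, one_mul]
  · rw [mulVecE_smul, hφ.homogeneous_mul i j hr]

theorem IsPosHom.gaussAvg_phiN (hφ : IsPosHom α φ) (hα : -(1 / 2) < α) (hB : 4 ≤ B)
    (h1 : W.transpose * W = 1) (i j : Fin B) :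
    gaussAvg (fun z => phiN φ (mulVecE W z) i * phiN φ (mulVecE W z) j) 1 =
      (B : ℝ) ^ α * (2 : ℝ) ^ (-α) * (poch (((B : ℝ) - 1) / 2) α)⁻¹ *
        gaussAvg (fun z => φ (mulVecE W z i) * φ (mulVecE W z j)) 1 := by
  have := nontrivial_chart hB
  have hB' : (4 : ℝ) ≤ B := by exact_mod_cast hB
  have h := gaussAvg_eq_of_homogeneous (C := (B : ℝ) ^ α) (β := 0) (α := α)
    (f := fun z => phiN φ (mulVecE W z) i * phiN φ (mulVecE W z) j)
    (g := fun z => φ (mulVecE W z i) * φ (mulVecE W z j)) (fun r z hr => ?_) (fun r z hr => ?_)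
    (fun u hu => hφ.phiN_mul_of_norm_one hB i j ((norm_mulVecE h1 u).trans hu))
    (by rw [finrank_chart hB]; linarith) (by rw [finrank_chart hB]; linarith)
  · rw [h, finrank_chart hB, add_zero]
  · rw [mulVecE_smul, phiN_smul φ hr, phiN_smul φ hr, Real.rpow_zero, one_mul]
  · rw [mulVecE_smul, hφ.homogeneous_mul i j hr, zero_add]

/-- The quadratic form makes the normalized function homogeneous of degree `2` in dimension `B - 1`,
which moves the Pochhammer parameter from `(B-1)/2` to `(B+1)/2`. -/
theorem IsPosHom.gaussAvg_phiN_quadratic (hφ : IsPosHom α φ) (hα : -(1 / 2) < α) (hB : 4 ≤ B)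
    (h1 : W.transpose * W = 1) (i j : Fin B)
    (A : EuclideanSpace ℝ (Fin (B - 1)) →L[ℝ] EuclideanSpace ℝ (Fin (B - 1))) :
    gaussAvg (fun z => phiN φ (mulVecE W z) i * phiN φ (mulVecE W z) j * inner ℝ z (A z)) 1 =
      (B : ℝ) ^ α * (2 : ℝ) ^ (-α) * (poch (((B : ℝ) + 1) / 2) α)⁻¹ *
        gaussAvg (fun z => φ (mulVecE W z i) * φ (mulVecE W z j) * inner ℝ z (A z)) 1 := by
  have := nontrivial_chart hB
  have hB' : (4 : ℝ) ≤ B := by exact_mod_cast hB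
  have hq : ∀ (r : ℝ) (z : EuclideanSpace ℝ (Fin (B - 1))),
      inner ℝ (r • z) (A (r • z)) = r ^ (2 : ℝ) * inner ℝ z (A z) := fun r z => by
    rw [map_smul, inner_smul_left, inner_smul_right, Real.rpow_two, conj_trivial]
    ring
  have h := gaussAvg_eq_of_homogeneous (C := (B : ℝ) ^ α) (β := 2) (α := α)
    (f := fun z => phiN φ (mulVecE W z) i * phiN φ (mulVecE W z) j * inner ℝ z (A z))
    (g := fun z => φ (mulVecE W z i) * φ (mulVecE W z j) * inner ℝ z (A z))
    (fun r z hr => ?_) (fun r z hr => ?_)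
    (fun u hu => by rw [hφ.phiN_mul_of_norm_one hB i j ((norm_mulVecE h1 u).trans hu), mul_assoc])
    (by rw [finrank_chart hB]; linarith) (by rw [finrank_chart hB]; linarith)
  · rw [h, finrank_chart hB, show ((B : ℝ) - 1 + 2) / 2 = ((B : ℝ) + 1) / 2 by ring]
  · rw [mulVecE_smul, phiN_smul φ hr, phiN_smul φ hr, hq]
    ring
  · rw [mulVecE_smul, hφ.homogeneous_mul i j hr, hq, Real.rpow_add hr]
    ring

end Chart


/-! ### The derivative of the integral transform -/

/-- The expectation of `φ(x_i) φ(x_j)` along the line through `G` in the direction `T`. -/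
noncomputable def momentPath {B : ℕ} (φ : ℝ → ℝ) (i j : Fin B) (T : SymG B) (t : ℝ) : ℝ :=
  ∫ x, φ (x i) * φ (x j)
    ∂(multivariateGaussian 0 ((gElt B + t • T : SymG B) : Matrix (Fin B) (Fin B) ℝ))

theorem momentPath_comm {B : ℕ} (φ : ℝ → ℝ) (i j : Fin B) (T : SymG B) :
    momentPath φ i j T = momentPath φ j i T := by
  ext t
  simp only [momentPath, mul_comm]

/-- The symmetrized elementary matrices. -/
noncomputable def symSingle {B : ℕ} (i j : Fin B) : Sym B :=
  ⟨(1 / 2 : ℝ) • (Matrix.single i j 1 + Matrix.single j i 1), by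
    change Matrix.transpose _ = _
    rw [Matrix.transpose_smul, Matrix.transpose_add, Matrix.transpose_single,
      Matrix.transpose_single, add_comm]⟩

/-- Expanding in symmetrized elementary matrices lets the derivatives of scalar entries assemble
into a derivative with values in `Sym B`. -/
theorem sum_smul_symSingle_apply {B : ℕ} (F : Fin B → Fin B → ℝ) (i j : Fin B) :
    ((∑ k, ∑ l, F k l • symSingle k l : Sym B) : Matrix (Fin B) (Fin B) ℝ) i j =
      1 / 2 * (F i j + F j i) := by
  have h1 : ∀ k l : Fin B, ((F k l • symSingle k l : Sym B) : Matrix (Fin B) (Fin B) ℝ) i j =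
      F k l * (1 / 2 * ((if k = i ∧ l = j then 1 else 0) + if l = i ∧ k = j then 1 else 0)) := by
    intro k l
    simp [symSingle, Matrix.single_apply]
    split_ifs <;> ring
  simp only [Submodule.coe_sum, Matrix.sum_apply, h1]
  simp only [mul_add, Finset.sum_add_distrib, ite_and, mul_ite, mul_zero, mul_one,
    Finset.sum_ite_eq', Finset.mem_univ, if_true]
  simp
  ring

section Derivative

variable {B : ℕ} {α : ℝ} {φ : ℝ → ℝ}

attribute [local instance] Matrix.normedAddCommGroup Matrix.normedSpace

theorem hasDerivAt_line {F : Type*} [NormedAddCommGroup F] [NormedSpace ℝ F] {f : SymG B → F}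
    {D : SymG B →L[ℝ] F} (hf : HasFDerivAt f D (gElt B)) (T : SymG B) :
    HasDerivAt (fun t : ℝ => f (gElt B + t • T)) (D T) 0 := by
  have h : HasDerivAt (fun t : ℝ => gElt B + t • T) T 0 := by
    have h := ((hasDerivAt_id (0 : ℝ)).smul_const T).const_add (gElt B)
    rw [one_smul] at h
    exact h
  have hf' : HasFDerivAt f D (gElt B + (0 : ℝ) • T) := by
    rwa [zero_smul, add_zero]
  exact hf'.comp_hasDerivAt 0 h

theorem hasFDerivAt_sum_smul {F : Fin B → Fin B → SymG B → ℝ}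
    {D : Fin B → Fin B → SymG B →L[ℝ] ℝ} {S : SymG B}
    (h : ∀ i j, HasFDerivAt (F i j) (D i j) S) :
    ∃ D' : SymG B →L[ℝ] Sym B,
      HasFDerivAt (fun S => ∑ k, ∑ l, F k l S • symSingle k l) D' S ∧
      ∀ T, D' T = ∑ k, ∑ l, D k l T • symSingle k l := by
  refine ⟨∑ k, ∑ l, (D k l).smulRight (symSingle k l),
    HasFDerivAt.fun_sum fun k _ => HasFDerivAt.fun_sum fun l _ =>
      (h k l).smul_const (symSingle k l), fun T => ?_⟩
  simp

/-- Normalized and unnormalized moments have derivatives of the same covariance form. In trace-zero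
directions only the homogeneous term `E[f q]` remains, so they differ by one constant. Comparing
with an arbitrary derivative `d` of `momentPath` lets closed forms be inserted later. -/
theorem IsPosHom.hasFDerivAt_vtG_gElt (hφ : IsPosHom α φ) (hα : -(1 / 2) < α) (hB : 4 ≤ B) :
    (∃ D : SymG B →L[ℝ] Sym B, HasFDerivAt (vtG B φ) D (gElt B) ∧
      ∀ T : SymG B, (T : Matrix (Fin B) (Fin B) ℝ).trace = 0 → ∀ i j d,
        HasDerivAt (momentPath φ i j T) d 0 → (D T : Matrix (Fin B) (Fin B) ℝ) i j =
          (B : ℝ) ^ α * (2 : ℝ) ^ (-α) * (poch (((B : ℝ) + 1) / 2) α)⁻¹ * d) ∧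
    ∀ (i j : Fin B) (T : SymG B), DifferentiableAt ℝ (momentPath φ i j T) 0 := by
  obtain ⟨W, h1, h2⟩ := exists_orthonormal_columns hB
  have hf := fun i j => hasFDerivAt_integral_chart h1 h2
    ((hφ.measurable_phiN i).mul (hφ.measurable_phiN j)) (hφ.gaussIntegrable_phiN hα hB h1 h2 i j)
  have hg := fun i j => hasFDerivAt_integral_chart h1 h2 (hφ.measurable_eval_mul i j)
    (hφ.gaussIntegrable_chart hα hB h2 i j)
  choose Df hDf hDf' using hf
  choose Dg hDg hDg' using hg
  have hpath : ∀ i j T, HasDerivAt (momentPath φ i j T) (Dg i j T) 0 :=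
    fun i j T => hasDerivAt_line (hDg i j) T
  refine ⟨?_, fun i j T => (hpath i j T).differentiableAt⟩
  obtain ⟨D', hD', hD''⟩ := hasFDerivAt_sum_smul hDf
  refine ⟨D', hD'.congr_of_eventuallyEq (Eventually.of_forall fun S => ?_), fun T hT i j d hd => ?_⟩
  · ext i j
    rw [sum_smul_symSingle_apply]
    simp only [vtG, vt, Matrix.of_apply, Pi.mul_apply]
    rw [show (fun x => phiN φ x j * phiN φ x i) = fun x => phiN φ x i * phiN φ x j from
      funext fun x => mul_comm _ _]
    ring
  -- Trace zero removes the product of expectations; its factor would carry the other Pochhammer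
  -- parameter.
  · have hq : gaussAvg (fun z => inner ℝ z (chartOp W T z)) 1 = 0 := by
      refine (gaussAvg_quadratic _).trans ?_
      rw [trace_chart h2, hT]
    have hfg : ∀ i j, Df i j T =
        (B : ℝ) ^ α * (2 : ℝ) ^ (-α) * (poch (((B : ℝ) + 1) / 2) α)⁻¹ * Dg i j T := by
      intro i j
      have e := hφ.gaussAvg_phiN_quadratic hα hB h1 i j (chartOp W T)
      rw [hDf', hDg', hq]
      simp only [Pi.mul_apply]
      rw [e]
      ring
    rw [hD'' T, sum_smul_symSingle_apply, hfg, hfg, (hpath i j T).unique hd,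
      (hpath j i T).unique (by rwa [momentPath_comm])]
    ring

end Derivative


/-! ### Closed forms -/

section ClosedForm

variable {B : ℕ} {α : ℝ} {φ : ℝ → ℝ}

theorem poch_pos {a b : ℝ} (ha : 0 < a) (hab : 0 < a + b) : 0 < poch a b :=
  div_pos (Real.Gamma_pos_of_pos hab) (Real.Gamma_pos_of_pos ha)

theorem one_sub_inv_pos (hB : 4 ≤ B) : 0 < 1 - (B : ℝ)⁻¹ := by
  have h : (4 : ℝ) ≤ B := by exact_mod_cast hB
  have h2 : (B : ℝ)⁻¹ < 1 := inv_lt_one_of_one_lt₀ (by linarith)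
  linarith

theorem gMat_diag (i : Fin B) : gMat B i i = 1 - (B : ℝ)⁻¹ := by
  simp [gMat_apply]

theorem gMat_offDiag {i j : Fin B} (hij : i ≠ j) : gMat B i j = -(B : ℝ)⁻¹ := by
  simp [gMat_apply, hij]

theorem cB_mul (hB : 4 ≤ B) : cB B * (1 - (B : ℝ)⁻¹) = -(B : ℝ)⁻¹ := by
  have h : (4 : ℝ) ≤ B := by exact_mod_cast hB
  have h1 : (B : ℝ) - 1 ≠ 0 := by linarith
  have h2 : (B : ℝ) ≠ 0 := by linarith
  rw [cB]
  field_simp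

theorem kAlpha_eq (hB : 4 ≤ B) : kAlpha α B = (B : ℝ) ^ α * (2 : ℝ) ^ (-α) *
    (poch (((B : ℝ) - 1) / 2) α)⁻¹ * (cAlpha α * (1 - (B : ℝ)⁻¹) ^ α) := by
  have h : (4 : ℝ) ≤ B := by exact_mod_cast hB
  have hB0 : (0 : ℝ) < B := by linarith
  have e : (((B : ℝ) - 1) / 2) ^ α = (B : ℝ) ^ α * (2 : ℝ) ^ (-α) * (1 - (B : ℝ)⁻¹) ^ α := by
    rw [Real.rpow_neg two_pos.le, ← Real.inv_rpow two_pos.le,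
      ← Real.mul_rpow hB0.le (by norm_num),
      ← Real.mul_rpow (by positivity) (one_sub_inv_pos hB).le]
    congr 1
    field_simp
  rw [kAlpha, e]
  ring

theorem kAlpha_pos (hα : -(1 / 2) < α) (hB : 4 ≤ B) : 0 < kAlpha α B := by
  have h : (4 : ℝ) ≤ B := by exact_mod_cast hB
  have h1 := cAlpha_pos hα
  have h2 : 0 < poch (((B : ℝ) - 1) / 2) α := poch_pos (by linarith) (by linarith)
  have h3 : 0 < ((B : ℝ) - 1) / 2 := by linarith
  rw [kAlpha]
  positivity

theorem IsPosHom.integral_gMat (hφ : IsPosHom α φ) (hα : -(1 / 2) < α) (hB : 4 ≤ B) (i j : Fin B) :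
    ∫ x, φ (x i) * φ (x j) ∂(multivariateGaussian 0 (gMat B)) =
      cAlpha α * (1 - (B : ℝ)⁻¹) ^ α * jPhi α φ (if i = j then 1 else cB B) := by
  have hq := one_sub_inv_pos hB
  by_cases hij : i = j
  · rw [if_pos hij, ← hij, hφ.integral_eval_sq hα (gMat_posSemidef B) (gMat_diag_pos hB i),
      gMat_diag]
  · have hs : √(1 - (B : ℝ)⁻¹) * √(1 - (B : ℝ)⁻¹) = 1 - (B : ℝ)⁻¹ := Real.mul_self_sqrt hq.le
    have hc := cB_mem hB
    rw [if_neg hij, hφ.integral_eval_mul hα (gMat_posSemidef B) (Real.sqrt_pos.2 hq)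
      (Real.sqrt_pos.2 hq) (by rw [gMat_diag, Real.sq_sqrt hq.le])
      (by rw [gMat_diag, Real.sq_sqrt hq.le]) (c := cB B)
      (by rw [gMat_offDiag hij, hs, cB_mul hB]) hc.1 (by linarith [hc.2]), hs]

theorem IsPosHom.vtG_gElt (hφ : IsPosHom α φ) (hα : -(1 / 2) < α) (hB : 4 ≤ B) :
    vtG B φ (gElt B) = sigmaStar α φ B := by
  obtain ⟨W, h1, h2⟩ := exists_orthonormal_columns hB
  ext i j
  have e : ((vtG B φ (gElt B) : Sym B) : Matrix (Fin B) (Fin B) ℝ) i j =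
      ∫ x, phiN φ x i * phiN φ x j ∂(multivariateGaussian 0 (gMat B)) := rfl
  have hm : Measurable fun x : EuclideanSpace ℝ (Fin B) => phiN φ x i * phiN φ x j :=
    (hφ.measurable_phiN i).mul (hφ.measurable_phiN j)
  rw [e, BatchNorm.integral_gMat h2 hm, hφ.gaussAvg_phiN hα hB h1,
    ← BatchNorm.integral_gMat h2 (hφ.measurable_eval_mul i j), hφ.integral_gMat hα hB]
  have e2 : ((sigmaStar α φ B : Sym B) : Matrix (Fin B) (Fin B) ℝ) i j =
      if i = j then kAlpha α B * jPhi α φ 1 else kAlpha α B * jPhi α φ (cB B) := rfl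
  rw [e2, kAlpha_eq hB]
  split_ifs <;> ring

theorem path_apply (T : SymG B) (t : ℝ) (i j : Fin B) :
    ((gElt B + t • T : SymG B) : Matrix (Fin B) (Fin B) ℝ) i j =
      gMat B i j + t * (T : Matrix (Fin B) (Fin B) ℝ) i j := rfl

theorem tendsto_path (T : SymG B) :
    Tendsto (fun t : ℝ => gElt B + t • T) (𝓝 0) (𝓝 (gElt B)) := by
  have h : Continuous fun t : ℝ => gElt B + t • T := by fun_prop
  simpa using h.tendsto 0

theorem eventually_path_posSemidef (hB : 4 ≤ B) (T : SymG B) :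
    ∀ᶠ t in 𝓝 (0 : ℝ), ((gElt B + t • T : SymG B) : Matrix (Fin B) (Fin B) ℝ).PosSemidef := by
  obtain ⟨W, h1, h2⟩ := exists_orthonormal_columns hB
  exact (tendsto_path T).eventually (eventually_posSemidef h1 h2)

theorem eventually_path_diag_pos (hB : 4 ≤ B) (T : SymG B) (i : Fin B) :
    ∀ᶠ t in 𝓝 (0 : ℝ), 0 < gMat B i i + t * (T : Matrix (Fin B) (Fin B) ℝ) i i := by
  have h : Continuous fun t : ℝ => gMat B i i + t * (T : Matrix (Fin B) (Fin B) ℝ) i i := by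
    fun_prop
  have h2 := h.tendsto 0
  rw [zero_mul, add_zero] at h2
  exact h2.eventually (lt_mem_nhds (gMat_diag_pos hB i))

theorem IsPosHom.momentPath_diag (hφ : IsPosHom α φ) (hα : -(1 / 2) < α) (hB : 4 ≤ B) (i : Fin B)
    (T : SymG B) : momentPath φ i i T =ᶠ[𝓝 0] fun t =>
      cAlpha α * (gMat B i i + t * (T : Matrix (Fin B) (Fin B) ℝ) i i) ^ α * jPhi α φ 1 := by
  filter_upwards [eventually_path_posSemidef hB T, eventually_path_diag_pos hB T i] with t h1 h2
  rw [momentPath, hφ.integral_eval_sq hα h1 (by rwa [path_apply]), path_apply]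

/-- The geometric mean of two diagonal entries along a line through `G`. -/
noncomputable def diagMean (i j : Fin B) (T : SymG B) (t : ℝ) : ℝ :=
  √((gMat B i i + t * (T : Matrix (Fin B) (Fin B) ℝ) i i) *
    (gMat B j j + t * (T : Matrix (Fin B) (Fin B) ℝ) j j))

theorem diagMean_zero (hB : 4 ≤ B) (i j : Fin B) (T : SymG B) :
    diagMean i j T 0 = 1 - (B : ℝ)⁻¹ := by
  rw [diagMean, zero_mul, zero_mul, add_zero, add_zero, gMat_diag, gMat_diag,
    Real.sqrt_mul_self (one_sub_inv_pos hB).le]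

theorem hasDerivAt_diagMean (hB : 4 ≤ B) (i j : Fin B) (T : SymG B) :
    HasDerivAt (diagMean i j T) (((T : Matrix (Fin B) (Fin B) ℝ) i i +
      (T : Matrix (Fin B) (Fin B) ℝ) j j) / 2) 0 := by
  have hq := one_sub_inv_pos hB
  have h : ∀ k : Fin B, HasDerivAt (fun t : ℝ =>
      gMat B k k + t * (T : Matrix (Fin B) (Fin B) ℝ) k k)
      ((T : Matrix (Fin B) (Fin B) ℝ) k k) 0 := fun k => by
    simpa using ((hasDerivAt_id (0 : ℝ)).mul_const
      ((T : Matrix (Fin B) (Fin B) ℝ) k k)).const_add (gMat B k k)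
  have h2 := ((h i).mul (h j)).sqrt (by
    simp only [Pi.mul_apply, zero_mul, add_zero, gMat_diag]
    positivity)
  refine h2.congr_deriv ?_
  simp only [Pi.mul_apply, zero_mul, add_zero, gMat_diag]
  rw [Real.sqrt_mul_self hq.le]
  generalize 1 - (B : ℝ)⁻¹ = q at hq
  field_simp

theorem IsPosHom.momentPath_offDiag (hφ : IsPosHom α φ) (hα : -(1 / 2) < α) (hB : 4 ≤ B)
    {i j : Fin B} (hij : i ≠ j) (T : SymG B) : momentPath φ i j T =ᶠ[𝓝 0] fun t =>
      cAlpha α * diagMean i j T t ^ α *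
        jPhi α φ ((gMat B i j + t * (T : Matrix (Fin B) (Fin B) ℝ) i j) / diagMean i j T t) := by
  have hq := one_sub_inv_pos hB
  have hc := cB_mem hB
  have hd := (hasDerivAt_diagMean hB i j T).continuousAt
  have hcont : ContinuousAt (fun t : ℝ =>
      (gMat B i j + t * (T : Matrix (Fin B) (Fin B) ℝ) i j) / diagMean i j T t) 0 :=
    ContinuousAt.div (by fun_prop) hd (by rw [diagMean_zero hB]; exact hq.ne')
  have h0 : (gMat B i j + 0 * (T : Matrix (Fin B) (Fin B) ℝ) i j) / diagMean i j T 0 = cB B := by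
    rw [diagMean_zero hB, zero_mul, add_zero, gMat_offDiag hij, ← cB_mul hB,
      mul_div_cancel_right₀ _ hq.ne']
  rw [ContinuousAt, h0] at hcont
  filter_upwards [eventually_path_posSemidef hB T, eventually_path_diag_pos hB T i,
    eventually_path_diag_pos hB T j, hcont.eventually (lt_mem_nhds hc.1),
    hcont.eventually (gt_mem_nhds (show cB B < 1 by linarith [hc.2]))] with t h1 h2 h3 h4 h5
  have hs : √(gMat B i i + t * (T : Matrix (Fin B) (Fin B) ℝ) i i) *
      √(gMat B j j + t * (T : Matrix (Fin B) (Fin B) ℝ) j j) = diagMean i j T t := by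
    rw [diagMean, Real.sqrt_mul h2.le]
  have hpos : 0 < diagMean i j T t := Real.sqrt_pos.2 (mul_pos h2 h3)
  rw [momentPath, hφ.integral_eval_mul hα h1 (Real.sqrt_pos.2 h2) (Real.sqrt_pos.2 h3)
    (by rw [path_apply, Real.sq_sqrt h2.le]) (by rw [path_apply, Real.sq_sqrt h3.le])
    (by rw [path_apply, hs, div_mul_cancel₀ _ hpos.ne']) h4 h5, hs]

/-- The rank one direction changing only two coordinates. -/
theorem exists_rankOne {i j : Fin B} (hij : i ≠ j) : ∃ T : SymG B,
    (T : Matrix (Fin B) (Fin B) ℝ) i i = 1 ∧ (T : Matrix (Fin B) (Fin B) ℝ) j j = 1 ∧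
    (T : Matrix (Fin B) (Fin B) ℝ) i j = -1 := by
  let v : Fin B → ℝ := fun k => (if k = i then 1 else 0) - if k = j then 1 else 0
  have hv : ∑ k, v k = 0 := by simp [v]
  refine ⟨⟨Matrix.of fun k l => v k * v l, mem_SymG_of_sum_row ?_ ?_⟩, ?_, ?_, ?_⟩
  · ext k l
    simp [mul_comm]
  · intro k
    simp [← Finset.mul_sum, hv]
  · simp [v, hij]
  · simp [v, hij.symm]
  · simp [v, hij, hij.symm]

/-- Rather than differentiating the integral defining `J_α`, `J_φ` is recovered from a moment
already known to be differentiable: along a rank one line through `G` the moment is `c_α s^α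
J_φ(c)`, where `s` is the common variance, and the line can be parametrized by its correlation `c`.
-/
theorem IsPosHom.differentiableAt_jPhi (hφ : IsPosHom α φ) (hα : -(1 / 2) < α) (hB : 4 ≤ B) :
    DifferentiableAt ℝ (jPhi α φ) (cB B) := by
  have hB' : (4 : ℝ) ≤ B := by exact_mod_cast hB
  have hc := cB_mem hB
  have hq := one_sub_inv_pos hB
  have hcα := cAlpha_pos hα
  obtain ⟨i, j, hij⟩ : ∃ i j : Fin B, i ≠ j :=
    ⟨⟨0, by omega⟩, ⟨1, by omega⟩, by simp⟩
  obtain ⟨T, h1, h2, h3⟩ := exists_rankOne hij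
  -- Solution of `(-1/B - τ) / (1 - 1/B + τ) = c`, the correlation of coordinates `i, j` under `G +
  -- τT`.
  let τ : ℝ → ℝ := fun c => (-(B : ℝ)⁻¹ - c * (1 - (B : ℝ)⁻¹)) / (1 + c)
  have h1c : 1 + cB B ≠ 0 := by linarith [hc.1]
  have hτ0 : τ (cB B) = 0 := by
    simp only [τ]
    rw [cB_mul hB, sub_self, zero_div]
  have hτ : DifferentiableAt ℝ τ (cB B) := DifferentiableAt.div (by fun_prop) (by fun_prop) h1c
  have hm : DifferentiableAt ℝ (momentPath φ i j T) (τ (cB B)) := by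
    rw [hτ0]
    exact (hφ.hasFDerivAt_vtG_gElt hα hB).2 i j T
  have hm2 : DifferentiableAt ℝ (fun c => momentPath φ i j T (τ c)) (cB B) := hm.comp _ hτ
  have hp : DifferentiableAt ℝ (fun c => cAlpha α * (1 - (B : ℝ)⁻¹ + τ c) ^ α) (cB B) := by
    refine DifferentiableAt.const_mul (DifferentiableAt.rpow_const (by fun_prop) (Or.inl ?_)) _
    rw [hτ0, add_zero]
    exact hq.ne'
  have hne : cAlpha α * (1 - (B : ℝ)⁻¹ + τ (cB B)) ^ α ≠ 0 := by
    rw [hτ0, add_zero]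
    positivity
  refine (hm2.div hp hne).congr_of_eventuallyEq ?_
  have hev := hτ.continuousAt.tendsto
  rw [hτ0] at hev
  filter_upwards [hev.eventually (hφ.momentPath_offDiag hα hB hij T), lt_mem_nhds hc.1]
    with c he hc1
  have hc1' : 0 < 1 + c := by linarith
  -- The common variance at correlation `c`; it is positive since `B > 2` and `c > -1`.
  have hsum : 1 - (B : ℝ)⁻¹ + τ c = (1 - 2 * (B : ℝ)⁻¹) / (1 + c) := by
    simp only [τ]
    field_simp
    ring
  have h2B : 0 < 1 - 2 * (B : ℝ)⁻¹ := by
    have : (B : ℝ)⁻¹ ≤ 4⁻¹ := inv_anti₀ (by norm_num) hB'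
    linarith
  have hspos : 0 < 1 - (B : ℝ)⁻¹ + τ c := by
    rw [hsum]
    positivity
  have hdm : diagMean i j T (τ c) = 1 - (B : ℝ)⁻¹ + τ c := by
    rw [diagMean, h1, h2, gMat_diag, gMat_diag, mul_one, Real.sqrt_mul_self hspos.le]
  have hr : (gMat B i j + τ c * (T : Matrix (Fin B) (Fin B) ℝ) i j) / diagMean i j T (τ c) = c := by
    rw [hdm, h3, gMat_offDiag hij, div_eq_iff hspos.ne']
    simp only [τ]
    field_simp
    ring
  rw [hr, hdm] at he
  simp only [Pi.div_apply]
  rw [he, mul_div_cancel_left₀]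
  positivity

theorem IsPosHom.hasDerivAt_momentPath_diag (hφ : IsPosHom α φ) (hα : -(1 / 2) < α) (hB : 4 ≤ B)
    (i : Fin B) (T : SymG B) : HasDerivAt (momentPath φ i i T)
      (cAlpha α * (1 - (B : ℝ)⁻¹) ^ (α - 1) *
        (α * (T : Matrix (Fin B) (Fin B) ℝ) i i * jPhi α φ 1)) 0 := by
  have hq := one_sub_inv_pos hB
  have h : HasDerivAt (fun t : ℝ => gMat B i i + t * (T : Matrix (Fin B) (Fin B) ℝ) i i)
      ((T : Matrix (Fin B) (Fin B) ℝ) i i) 0 := by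
    simpa using ((hasDerivAt_id (0 : ℝ)).mul_const
      ((T : Matrix (Fin B) (Fin B) ℝ) i i)).const_add (gMat B i i)
  have h2 := ((h.rpow_const (p := α) (Or.inl (by
    rw [zero_mul, add_zero, gMat_diag]
    exact hq.ne'))).const_mul (cAlpha α)).mul_const (jPhi α φ 1)
  refine (h2.congr_of_eventuallyEq (hφ.momentPath_diag hα hB i T)).congr_deriv ?_
  rw [zero_mul, add_zero, gMat_diag]
  ring

theorem IsPosHom.hasDerivAt_momentPath_offDiag (hφ : IsPosHom α φ) (hα : -(1 / 2) < α)
    (hB : 4 ≤ B) {i j : Fin B} (hij : i ≠ j) (T : SymG B) : HasDerivAt (momentPath φ i j T)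
      (cAlpha α * (1 - (B : ℝ)⁻¹) ^ (α - 1) *
        (α * (((T : Matrix (Fin B) (Fin B) ℝ) i i + (T : Matrix (Fin B) (Fin B) ℝ) j j) / 2) *
            jPhi α φ (cB B) +
          deriv (jPhi α φ) (cB B) * ((T : Matrix (Fin B) (Fin B) ℝ) i j - cB B *
            (((T : Matrix (Fin B) (Fin B) ℝ) i i + (T : Matrix (Fin B) (Fin B) ℝ) j j) / 2)))) 0 := by
  have hq := one_sub_inv_pos hB
  have hd := hasDerivAt_diagMean hB i j T
  have hd0 := diagMean_zero hB i j T
  have hw : HasDerivAt (fun t : ℝ => gMat B i j + t * (T : Matrix (Fin B) (Fin B) ℝ) i j)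
      ((T : Matrix (Fin B) (Fin B) ℝ) i j) 0 := by
    simpa using ((hasDerivAt_id (0 : ℝ)).mul_const
      ((T : Matrix (Fin B) (Fin B) ℝ) i j)).const_add (gMat B i j)
  have hr := hw.div hd (by rw [hd0]; exact hq.ne')
  have h0 : (gMat B i j + 0 * (T : Matrix (Fin B) (Fin B) ℝ) i j) / diagMean i j T 0 = cB B := by
    rw [hd0, zero_mul, add_zero, gMat_offDiag hij, ← cB_mul hB, mul_div_cancel_right₀ _ hq.ne']
  have hJ : HasDerivAt (jPhi α φ) (deriv (jPhi α φ) (cB B))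
      ((gMat B i j + 0 * (T : Matrix (Fin B) (Fin B) ℝ) i j) / diagMean i j T 0) := by
    rw [h0]
    exact (hφ.differentiableAt_jPhi hα hB).hasDerivAt
  have hp := (hd.rpow_const (p := α) (Or.inl (by rw [hd0]; exact hq.ne'))).const_mul (cAlpha α)
  have h := hp.mul (hJ.comp (0 : ℝ) hr)
  refine (h.congr_of_eventuallyEq (hφ.momentPath_offDiag hα hB hij T)).congr_deriv ?_
  simp only [Function.comp_apply, Pi.div_apply]
  rw [h0, hd0, zero_mul, add_zero, gMat_offDiag hij, ← cB_mul hB]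
  have e : (1 - (B : ℝ)⁻¹) ^ α = (1 - (B : ℝ)⁻¹) ^ (α - 1) * (1 - (B : ℝ)⁻¹) := by
    rw [← Real.rpow_add_one hq.ne', sub_add_cancel]
  rw [e]
  generalize (1 - (B : ℝ)⁻¹) ^ (α - 1) = P
  generalize 1 - (B : ℝ)⁻¹ = q at hq
  field_simp

end ClosedForm


/-! ### Integrability, scaling and positivity -/

open scoped MatrixOrder in
theorem exists_symmetric_sqrt {ι : Type*} [Fintype ι] [DecidableEq ι] {S : Matrix ι ι ℝ}
    (hS : S.PosSemidef) : ∃ R : Matrix ι ι ℝ, R.transpose = R ∧ R * R = S := by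
  refine ⟨CFC.sqrt S, ?_, CFC.sqrt_mul_sqrt_self _ hS.nonneg⟩
  have h : IsSelfAdjoint (CFC.sqrt S) := (CFC.sqrt_nonneg S).isSelfAdjoint
  have h' : (CFC.sqrt S).conjTranspose = CFC.sqrt S := h
  rwa [Matrix.conjTranspose_eq_transpose_of_trivial] at h'

section

variable {B : ℕ} {W : Matrix (Fin B) (Fin (B - 1)) ℝ} {α : ℝ} {φ : ℝ → ℝ}

theorem IsPosHom.phiN_mul (hφ : IsPosHom α φ) (hB : 4 ≤ B) (i j : Fin B)
    {x : EuclideanSpace ℝ (Fin B)} (hx : x ≠ 0) :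
    phiN φ x i * phiN φ x j = (B : ℝ) ^ α * ‖x‖⁻¹ ^ (2 * α) * (φ (x i) * φ (x j)) := by
  have hn : 0 < ‖x‖⁻¹ := inv_pos.2 (norm_pos_iff.2 hx)
  have h1 : ‖‖x‖⁻¹ • x‖ = 1 := by
    rw [norm_smul, norm_inv, norm_norm, inv_mul_cancel₀ (norm_pos_iff.2 hx).ne']
  rw [← phiN_smul φ hn x i, ← phiN_smul φ hn x j, hφ.phiN_mul_of_norm_one hB i j h1,
    hφ.homogeneous_mul i j hn, mul_assoc]

/-- In standard coordinates `x = Mz`, the normalized product on the unit sphere is the unnormalized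
one times the continuous, hence bounded, factor `B^α ‖Mz‖^(-2α)`. Integrability therefore transfers
on the sphere and extends back in degree `0`. -/
theorem IsPosHom.integrable_phiN (hφ : IsPosHom α φ) (hα : -(1 / 2) < α) (hB : 4 ≤ B)
    (h1 : W.transpose * W = 1) (h2 : W * W.transpose = gMat B) {S : SymG B}
    (hS : (W.transpose * (S : Matrix (Fin B) (Fin B) ℝ) * W).PosDef)
    (hd : ∀ i, 0 < (S : Matrix (Fin B) (Fin B) ℝ) i i) (i j : Fin B) :
    Integrable (fun x => phiN φ x i * phiN φ x j)
      (multivariateGaussian 0 (S : Matrix (Fin B) (Fin B) ℝ)) := by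
  have := nontrivial_chart hB
  have hB' : (4 : ℝ) ≤ B := by exact_mod_cast hB
  obtain ⟨R, hR, hRR⟩ := exists_symmetric_sqrt hS.posSemidef
  obtain ⟨M, hM⟩ : ∃ M, M = W * R := ⟨_, rfl⟩
  have hMS : M * (1 : Matrix (Fin (B - 1)) (Fin (B - 1)) ℝ) * M.transpose =
      (S : Matrix (Fin B) (Fin B) ℝ) := by
    rw [Matrix.mul_one, hM, Matrix.transpose_mul, hR, ← Matrix.mul_assoc, Matrix.mul_assoc W R R,
      hRR, conj_chart h2]
  have hSp : (S : Matrix (Fin B) (Fin B) ℝ).PosSemidef := by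
    rw [← hMS]
    exact posSemidef_conj Matrix.PosSemidef.one M
  -- Injectivity of `M = WR`: a kernel vector would be killed by `R Wᵀ M = WᵀSW`, which is positive
  -- definite.
  have hM0 : ∀ z, z ≠ 0 → mulVecE M z ≠ 0 := by
    intro z hz h
    have h3 : mulVecE (W.transpose * (S : Matrix (Fin B) (Fin B) ℝ) * W) z = 0 := by
      rw [← hRR, show R * R = R * (W.transpose * W) * R by rw [h1, Matrix.mul_one],
        show R * (W.transpose * W) * R = (R * W.transpose) * M by
          rw [hM]; simp only [Matrix.mul_assoc], ← mulVecE_mulVecE, h]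
      ext k
      simp [mulVecE_apply]
    have h4 := hS.dotProduct_mulVec_pos (x := z.ofLp) (fun h0 => hz (by ext k; simp [h0]))
    have h5 : (W.transpose * (S : Matrix (Fin B) (Fin B) ℝ) * W).mulVec z.ofLp = 0 :=
      congrArg WithLp.ofLp h3
    rw [h5, dotProduct_zero] at h4
    exact lt_irrefl _ h4
  have key : ∀ {f : EuclideanSpace ℝ (Fin B) → ℝ}, Measurable f →
      (Integrable f (multivariateGaussian 0 (S : Matrix (Fin B) (Fin B) ℝ)) ↔
        Integrable (fun z => f (mulVecE M z))
          (stdGaussian (EuclideanSpace ℝ (Fin (B - 1))))) := by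
    intro f hf
    have h := integrable_map_multivariateGaussian
      (Matrix.PosSemidef.one (n := Fin (B - 1)) (R := ℝ)) M hf
    rwa [hMS, multivariateGaussian_zero_one] at h
  have hm : Measurable fun x : EuclideanSpace ℝ (Fin B) => phiN φ x i * phiN φ x j :=
    (hφ.measurable_phiN i).mul (hφ.measurable_phiN j)
  have hg := (key (hφ.measurable_eval_mul i j)).1 (hφ.integrable_eval_mul hφ hα hSp (hd i) (hd j))
  rw [key hm, integrable_stdGaussian_iff]
  have hgs := integrable_toSphere_of_homogeneous volume (β := 2 * α) (fun r z hr => by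
    rw [mulVecE_smul, hφ.homogeneous_mul i j hr]) ((integrable_stdGaussian_iff _).1 hg)
  refine integrable_of_integrable_toSphere volume (ε := 1 / 2) (β := 0) (by norm_num)
    (fun r z hr => by
      rw [mulVecE_smul, phiN_smul φ hr, phiN_smul φ hr, Real.rpow_zero, one_mul])
    (by rw [finrank_chart hB]; linarith) ?_
  have hc : Continuous fun u : Metric.sphere (0 : EuclideanSpace ℝ (Fin (B - 1))) 1 =>
      (B : ℝ) ^ α * ‖mulVecE M u‖⁻¹ ^ (2 * α) := by
    have hcm : Continuous fun u : Metric.sphere (0 : EuclideanSpace ℝ (Fin (B - 1))) 1 =>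
        ‖mulVecE M u‖ := ((continuous_mulVecE M).comp continuous_subtype_val).norm
    have hne : ∀ u : Metric.sphere (0 : EuclideanSpace ℝ (Fin (B - 1))) 1,
        ‖mulVecE M u‖ ≠ 0 := fun u =>
      norm_ne_zero_iff.2 (hM0 u (ne_zero_of_mem_unit_sphere u))
    exact continuous_const.mul ((hcm.inv₀ hne).rpow_const fun u => Or.inl (inv_ne_zero (hne u)))
  obtain ⟨C, hC⟩ := isCompact_univ.exists_bound_of_continuousOn hc.continuousOn
  refine (hgs.bdd_mul hc.aestronglyMeasurable
    (Eventually.of_forall fun u => hC u (Set.mem_univ u))).congr (Eventually.of_forall fun u => ?_)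
  exact (hφ.phiN_mul hB i j (hM0 u (ne_zero_of_mem_unit_sphere u))).symm

theorem IsPosHom.eventually_vtDefined (hφ : IsPosHom α φ) (hα : -(1 / 2) < α) (hB : 4 ≤ B) :
    ∀ᶠ S : SymG B in 𝓝 (gElt B), VtDefined (phiN φ) (S : Matrix (Fin B) (Fin B) ℝ) := by
  obtain ⟨W, h1, h2⟩ := exists_orthonormal_columns hB
  have hd : ∀ i, ∀ᶠ S : SymG B in 𝓝 (gElt B), 0 < (S : Matrix (Fin B) (Fin B) ℝ) i i := by
    intro i
    have hc : Continuous fun S : SymG B => (S : Matrix (Fin B) (Fin B) ℝ) i i :=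
      continuous_subtype_val.matrix_elem i i
    exact (hc.tendsto (gElt B)).eventually (lt_mem_nhds (gMat_diag_pos hB i))
  filter_upwards [eventually_posDef h1 h2, eventually_posSemidef h1 h2, eventually_all.2 hd]
    with S hS1 hS2 hS3
  exact ⟨hS2, fun i j => hφ.integrable_phiN hα hB h1 h2 hS1 hS3 i j⟩

/-! ### Scale invariance in the covariance. -/

theorem map_smul_multivariateGaussian {S : Matrix (Fin B) (Fin B) ℝ} (hS : S.PosSemidef) {t : ℝ}
    (ht : 0 < t) : multivariateGaussian 0 (t • S) =
      (multivariateGaussian 0 S).map (fun x => √t • x) := by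
  have h := map_multivariateGaussian hS ((√t) • (1 : Matrix (Fin B) (Fin B) ℝ))
  have e : ((√t) • (1 : Matrix (Fin B) (Fin B) ℝ)) * S *
      ((√t) • (1 : Matrix (Fin B) (Fin B) ℝ)).transpose = t • S := by
    simp [smul_smul, Real.mul_self_sqrt ht.le]
  rw [e] at h
  rw [← h]
  congr 1
  ext x
  simp [mulVecE, Matrix.smul_mulVec]

theorem IsPosHom.integrable_phiN_smul_iff (hφ : IsPosHom α φ) {S : Matrix (Fin B) (Fin B) ℝ}
    (hS : S.PosSemidef) {t : ℝ} (ht : 0 < t) (i j : Fin B) :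
    Integrable (fun x => phiN φ x i * phiN φ x j) (multivariateGaussian 0 (t • S)) ↔
      Integrable (fun x => phiN φ x i * phiN φ x j) (multivariateGaussian 0 S) := by
  have hm : Measurable fun x : EuclideanSpace ℝ (Fin B) => phiN φ x i * phiN φ x j :=
    (hφ.measurable_phiN i).mul (hφ.measurable_phiN j)
  rw [map_smul_multivariateGaussian hS ht, integrable_map_measure hm.aestronglyMeasurable
    (by fun_prop)]
  simp [Function.comp_def, phiN_smul φ (Real.sqrt_pos.2 ht)]

theorem IsPosHom.vt_phiN_smul (hφ : IsPosHom α φ) {S : Matrix (Fin B) (Fin B) ℝ}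
    (hS : S.PosSemidef) {t : ℝ} (ht : 0 < t) : vt (phiN φ) (t • S) = vt (phiN φ) S := by
  ext i j
  have hm : Measurable fun x : EuclideanSpace ℝ (Fin B) => phiN φ x i * phiN φ x j :=
    (hφ.measurable_phiN i).mul (hφ.measurable_phiN j)
  simp only [vt, Matrix.of_apply]
  rw [map_smul_multivariateGaussian hS ht, integral_map (by fun_prop) hm.aestronglyMeasurable]
  simp only [phiN_smul φ (Real.sqrt_pos.2 ht)]

theorem tendsto_inv_smul {υ : ℝ} (hυ : 0 < υ) :
    Tendsto (fun S : SymG B => υ⁻¹ • S) (𝓝 (υ • gElt B)) (𝓝 (gElt B)) := by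
  have h : Continuous fun S : SymG B => υ⁻¹ • S := by fun_prop
  have h2 := h.tendsto (υ • gElt B)
  rwa [inv_smul_smul₀ hυ.ne'] at h2

theorem IsPosHom.eventually_vtDefined_smul (hφ : IsPosHom α φ) (hα : -(1 / 2) < α) (hB : 4 ≤ B)
    {υ : ℝ} (hυ : 0 < υ) : ∀ᶠ S : SymG B in 𝓝 (υ • gElt B),
      VtDefined (phiN φ) (S : Matrix (Fin B) (Fin B) ℝ) := by
  filter_upwards [(tendsto_inv_smul hυ).eventually (hφ.eventually_vtDefined hα hB)] with S hS
  have e : (S : Matrix (Fin B) (Fin B) ℝ) =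
      υ • ((υ⁻¹ • S : SymG B) : Matrix (Fin B) (Fin B) ℝ) := by
    rw [Submodule.coe_smul, smul_inv_smul₀ hυ.ne']
  rw [e]
  exact ⟨hS.1.smul hυ.le, fun i j => (hφ.integrable_phiN_smul_iff hS.1 hυ i j).2 (hS.2 i j)⟩

attribute [local instance] Matrix.normedAddCommGroup Matrix.normedSpace

theorem hasFDerivAt_comp_inv_smul {V F : Type*} [NormedAddCommGroup V] [NormedSpace ℝ V]
    [NormedAddCommGroup F] [NormedSpace ℝ F] {f : V → F} {D : V →L[ℝ] F} {v : V}
    (hf : HasFDerivAt f D v) {υ : ℝ} (hυ : 0 < υ) :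
    HasFDerivAt (fun x => f (υ⁻¹ • x)) (υ⁻¹ • D) (υ • v) := by
  have h : HasFDerivAt (fun x : V => υ⁻¹ • x) (υ⁻¹ • ContinuousLinearMap.id ℝ V) (υ • v) :=
    (hasFDerivAt_id _).const_smul _
  have hf' : HasFDerivAt f D (υ⁻¹ • (υ • v)) := by rwa [inv_smul_smul₀ hυ.ne']
  refine (hf'.comp (υ • v) h).congr_fderiv ?_
  ext x
  simp

theorem IsPosHom.hasFDerivAt_vtG_smul (hφ : IsPosHom α φ) (hB : 4 ≤ B)
    {D : SymG B →L[ℝ] Sym B} (hD : HasFDerivAt (vtG B φ) D (gElt B)) {υ : ℝ} (hυ : 0 < υ) :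
    HasFDerivAt (vtG B φ) (υ⁻¹ • D) (υ • gElt B) := by
  obtain ⟨W, h1, h2⟩ := exists_orthonormal_columns hB
  refine (hasFDerivAt_comp_inv_smul hD hυ).congr_of_eventuallyEq ?_
  filter_upwards [(tendsto_inv_smul hυ).eventually (eventually_posSemidef h1 h2)] with S hS
  rw [vtG, vtG, ← hφ.vt_phiN_smul hS hυ, Submodule.coe_smul, smul_inv_smul₀ hυ.ne']

/-- The transform is constant along the ray through `G`, which is the source of the eigenvalue `0`.
-/
theorem IsPosHom.fderiv_gElt (hφ : IsPosHom α φ) {D : SymG B →L[ℝ] Sym B}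
    (hD : HasFDerivAt (vtG B φ) D (gElt B)) : D (gElt B) = 0 := by
  refine (hasDerivAt_line hD (gElt B)).unique ?_
  refine (hasDerivAt_const (0 : ℝ) (vtG B φ (gElt B))).congr_of_eventuallyEq ?_
  filter_upwards [lt_mem_nhds (show (-1 : ℝ) < 0 by norm_num)] with t ht
  have e : gElt B + t • gElt B = (1 + t) • gElt B := by rw [add_smul, one_smul]
  rw [e]
  exact hφ.vt_phiN_smul (gMat_posSemidef B) (by linarith)

end

/-! ### Positivity of `υ*`. -/

theorem isOpenPosMeasure_stdGaussian {E : Type*} [NormedAddCommGroup E] [InnerProductSpace ℝ E]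
    [FiniteDimensional ℝ E] [MeasurableSpace E] [BorelSpace E] :
    (stdGaussian E).IsOpenPosMeasure := by
  have hpos := gaussInt_one_one_pos (E := E)
  rw [stdGaussian_eq_withDensity]
  refine (withDensity_absolutelyContinuous' (by fun_prop)
    (Eventually.of_forall fun z => ?_)).isOpenPosMeasure
  rw [Ne, ENNReal.ofReal_eq_zero, not_le]
  positivity

theorem IsPosHom.continuousAt {α : ℝ} {φ : ℝ → ℝ} (hφ : IsPosHom α φ) {x : ℝ} (hx : x ≠ 0) :
    ContinuousAt φ x := by
  rcases lt_or_gt_of_ne hx with h | h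
  · have hc : ContinuousAt (fun y : ℝ => (-y) ^ α * φ (-1)) x :=
      (continuousAt_neg.rpow_const (Or.inl (neg_ne_zero.2 hx))).mul continuousAt_const
    refine hc.congr ?_
    filter_upwards [gt_mem_nhds h] with y hy
    rw [← hφ _ _ (neg_pos.2 hy), mul_neg_one, neg_neg]
  · have hc : ContinuousAt (fun y : ℝ => y ^ α * φ 1) x :=
      (continuousAt_id.rpow_const (Or.inl hx)).mul continuousAt_const
    refine hc.congr ?_
    filter_upwards [lt_mem_nhds h] with y hy
    rw [← hφ _ _ hy, mul_one]

/-- A third coordinate absorbs `-(x + y)`, so centering does not constrain any pair of coordinates.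
-/
theorem exists_mulVecE_eq {B : ℕ} (hB : 4 ≤ B) {W : Matrix (Fin B) (Fin (B - 1)) ℝ}
    (h2 : W * W.transpose = gMat B) {i j : Fin B} (hij : i ≠ j) (x y : ℝ) :
    ∃ z, mulVecE W z i = x ∧ mulVecE W z j = y := by
  obtain ⟨k, hki, hkj⟩ : ∃ k : Fin B, k ≠ i ∧ k ≠ j := by
    obtain ⟨k, hk⟩ : ∃ k, k ∉ ({i, j} : Finset (Fin B)) := by
      by_contra! h
      have := Finset.card_le_two (a := i) (b := j)
      rw [Finset.eq_univ_of_forall h, Finset.card_univ, Fintype.card_fin] at this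
      omega
    simp only [Finset.mem_insert, Finset.mem_singleton, not_or] at hk
    exact ⟨k, hk⟩
  let v : EuclideanSpace ℝ (Fin B) := WithLp.toLp 2 fun l =>
    (if l = i then x else 0) + (if l = j then y else 0) + if l = k then -(x + y) else 0
  have hv : ∑ l, v l = 0 := by
    simp [v, Finset.sum_add_distrib]
  have hG : ∀ l, mulVecE (gMat B) v l = v l := by
    intro l
    rw [mulVecE_apply]
    simp [gMat_apply, sub_mul, Finset.sum_sub_distrib, ← Finset.mul_sum, hv]
  refine ⟨mulVecE W.transpose v, ?_, ?_⟩
  · rw [mulVecE_mulVecE, h2, hG]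
    simp [v, hij, hki.symm]
  · rw [mulVecE_mulVecE, h2, hG]
    simp [v, hij.symm, hkj.symm]

/-- Under `N(0, G)`, `E[(φ(x_i) - φ(x_j))²]` is a positive multiple of the difference. It cannot
vanish: `φ` is continuous off `0`, so `φ(x_i) ≠ φ(x_j)` holds on a nonempty open set of chart
points, which has positive Gaussian measure. -/
theorem IsPosHom.jPhi_cB_lt {B : ℕ} {α : ℝ} {φ : ℝ → ℝ} (hφ : IsPosHom α φ) (hα : -(1 / 2) < α)
    (hB : 4 ≤ B) (hne : ∃ x y : ℝ, x ≠ 0 ∧ y ≠ 0 ∧ φ x ≠ φ y) :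
    jPhi α φ (cB B) < jPhi α φ 1 := by
  obtain ⟨x, y, hx, hy, hxy⟩ := hne
  obtain ⟨W, h1, h2⟩ := exists_orthonormal_columns hB
  obtain ⟨i, j, hij⟩ : ∃ i j : Fin B, i ≠ j := ⟨⟨0, by omega⟩, ⟨1, by omega⟩, by simp⟩
  have hm := hφ.measurable
  have hint := fun k l : Fin B =>
    hφ.integrable_eval_mul hφ hα (gMat_posSemidef B) (gMat_diag_pos hB k) (gMat_diag_pos hB l)
  have hval := fun k l : Fin B => hφ.integral_gMat hα hB k l
  have hsq : (fun v : EuclideanSpace ℝ (Fin B) => (φ (v i) - φ (v j)) ^ 2) =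
      fun v => (φ (v i) * φ (v i) - 2 * (φ (v i) * φ (v j))) + φ (v j) * φ (v j) := by
    ext v
    ring
  have hi1 : Integrable (fun v : EuclideanSpace ℝ (Fin B) =>
      φ (v i) * φ (v i) - 2 * (φ (v i) * φ (v j))) (multivariateGaussian 0 (gMat B)) :=
    (hint i i).sub ((hint i j).const_mul 2)
  have hI : Integrable (fun v : EuclideanSpace ℝ (Fin B) => (φ (v i) - φ (v j)) ^ 2)
      (multivariateGaussian 0 (gMat B)) := by
    rw [hsq]
    exact hi1.add (hint j j)
  have hE : ∫ v, (φ (v i) - φ (v j)) ^ 2 ∂(multivariateGaussian 0 (gMat B)) =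
      2 * (cAlpha α * (1 - (B : ℝ)⁻¹) ^ α) * (jPhi α φ 1 - jPhi α φ (cB B)) := by
    rw [hsq, integral_add hi1 (hint j j), integral_sub (hint i i) ((hint i j).const_mul 2),
      integral_const_mul, hval, hval, hval, if_pos rfl, if_pos rfl, if_neg hij]
    ring
  have hpos : 0 < ∫ v, (φ (v i) - φ (v j)) ^ 2 ∂(multivariateGaussian 0 (gMat B)) := by
    refine lt_of_le_of_ne (integral_nonneg fun v => sq_nonneg _) fun h0 => ?_
    have hae := (integral_eq_zero_iff_of_nonneg (fun v => sq_nonneg _) hI).1 h0.symm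
    have hmap := map_multivariateGaussian (Matrix.PosSemidef.one (n := Fin (B - 1)) (R := ℝ)) W
    rw [Matrix.mul_one, h2, multivariateGaussian_zero_one] at hmap
    rw [← hmap] at hae
    have hae' := ae_of_ae_map (continuous_mulVecE W).aemeasurable hae
    have := isOpenPosMeasure_stdGaussian (E := EuclideanSpace ℝ (Fin (B - 1)))
    have hc1 : ContinuousAt (fun p : ℝ × ℝ => φ p.1) (x, y) :=
      ContinuousAt.comp (f := Prod.fst) (hφ.continuousAt hx) continuousAt_fst
    have hc2 : ContinuousAt (fun p : ℝ × ℝ => φ p.2) (x, y) :=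
      ContinuousAt.comp (f := Prod.snd) (hφ.continuousAt hy) continuousAt_snd
    have hnhds : {p : ℝ × ℝ | φ p.1 ≠ φ p.2} ∈ 𝓝 (x, y) := by
      filter_upwards [(hc1.sub hc2).eventually_ne (sub_ne_zero.2 hxy)] with p hp
      exact sub_ne_zero.1 hp
    obtain ⟨U, hU, hUo, hxU⟩ := mem_nhds_iff.1 hnhds
    have hcont : Continuous fun z : EuclideanSpace ℝ (Fin (B - 1)) =>
        (mulVecE W z i, mulVecE W z j) := by
      have := continuous_mulVecE W
      fun_prop
    obtain ⟨z, hz1, hz2⟩ := exists_mulVecE_eq hB h2 hij x y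
    have hV := (hUo.preimage hcont).measure_pos (stdGaussian (EuclideanSpace ℝ (Fin (B - 1))))
      ⟨z, by simpa [hz1, hz2] using hxU⟩
    refine hV.ne' (measure_mono_null (t := {z | ¬ (φ (mulVecE W z i) - φ (mulVecE W z j)) ^ 2 = 0})
      (fun z hz h => ?_) hae')
    exact hU hz (sub_eq_zero.1 (pow_eq_zero_iff two_ne_zero |>.1 h))
  rw [hE] at hpos
  have hq := one_sub_inv_pos hB
  have hc := cAlpha_pos hα
  have : 0 < jPhi α φ 1 - jPhi α φ (cB B) := pos_of_mul_pos_right hpos (by positivity)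
  linarith

theorem IsPosHom.upsilonStar_pos {B : ℕ} {α : ℝ} {φ : ℝ → ℝ} (hφ : IsPosHom α φ)
    (hα : -(1 / 2) < α) (hB : 4 ≤ B) (hne : ∃ x y : ℝ, x ≠ 0 ∧ y ≠ 0 ∧ φ x ≠ φ y) :
    0 < upsilonStar α φ B :=
  mul_pos (kAlpha_pos hα hB) (sub_pos.2 (hφ.jPhi_cB_lt hα hB hne))


/-! ### The fixed point -/

section FixedPoint

variable {B : ℕ} {α : ℝ} {φ : ℝ → ℝ}

theorem conj_bsb1 (hB : 4 ≤ B) (a b : ℝ) :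
    gMat B * (bsb1 B a b : Matrix (Fin B) (Fin B) ℝ) * gMat B = (a - b) • gMat B := by
  have hB' : (B : ℝ) ≠ 0 := by positivity
  have e : (bsb1 B a b : Matrix (Fin B) (Fin B) ℝ) =
      (a - b) • (1 : Matrix (Fin B) (Fin B) ℝ) + Matrix.of fun _ _ => b := by
    ext i j
    simp only [bsb1, Matrix.of_apply, Matrix.add_apply, Matrix.smul_apply, Matrix.one_apply,
      smul_eq_mul]
    split_ifs <;> ring
  have h0 : gMat B * (Matrix.of fun _ _ => b : Matrix (Fin B) (Fin B) ℝ) * gMat B = 0 := by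
    ext i j
    rw [gMat_conj_apply]
    simp [hB']
  rw [e, mul_add, add_mul, h0, add_zero, mul_smul_comm, smul_mul_assoc, mul_one, gMat_mul_gMat]

theorem centerSym_bsb1 (hB : 4 ≤ B) (a b : ℝ) :
    centerSym B (bsb1 B a b) = (a - b) • gElt B :=
  Subtype.ext (conj_bsb1 hB a b)

theorem centerSym_sigmaStar (hB : 4 ≤ B) (α : ℝ) (φ : ℝ → ℝ) :
    centerSym B (sigmaStar α φ B) = upsilonStar α φ B • gElt B := by
  rw [sigmaStar, centerSym_bsb1 hB, upsilonStar, mul_sub]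

/-- Centering preserves semidefiniteness and gives `(a - b) G`. -/
theorem lt_of_posSemidef_bsb1 (hB : 4 ≤ B) {a b : ℝ} (hab : a ≠ b)
    (h : (bsb1 B a b : Matrix (Fin B) (Fin B) ℝ).PosSemidef) : b < a := by
  have h1 := (posSemidef_conj h (gMat B)).diag_nonneg (i := ⟨0, by omega⟩)
  rw [gMat_transpose, conj_bsb1 hB, Matrix.smul_apply, smul_eq_mul] at h1
  have h2 := gMat_diag_pos hB (⟨0, by omega⟩ : Fin B)
  have h3 : 0 ≤ a - b := nonneg_of_mul_nonneg_left h1 h2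
  exact lt_of_le_of_ne (by linarith) hab.symm

theorem map_gMat_bsb1 (hB : 4 ≤ B) {a b : ℝ}
    (h : (bsb1 B a b : Matrix (Fin B) (Fin B) ℝ).PosSemidef) :
    (multivariateGaussian 0 (bsb1 B a b : Matrix (Fin B) (Fin B) ℝ)).map (mulVecE (gMat B)) =
      multivariateGaussian 0 ((a - b) • gMat B) := by
  rw [map_multivariateGaussian h, gMat_transpose, conj_bsb1 hB]

/-- Batch normalization sees only the centered vector, with covariance `(a - b) G`, and scale
invariance removes `a - b`. -/
theorem IsPosHom.batchnorm_bsb1 (hφ : IsPosHom α φ) (hα : -(1 / 2) < α) (hB : 4 ≤ B) {a b : ℝ}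
    (hab : b < a) (h : (bsb1 B a b : Matrix (Fin B) (Fin B) ℝ).PosSemidef) :
    VtDefined (batchnorm φ) (bsb1 B a b : Matrix (Fin B) (Fin B) ℝ) ∧
      vt (batchnorm φ) (bsb1 B a b : Matrix (Fin B) (Fin B) ℝ) = sigmaStar α φ B := by
  have hm : ∀ i j, Measurable fun x : EuclideanSpace ℝ (Fin B) => phiN φ x i * phiN φ x j :=
    fun i j => (hφ.measurable_phiN i).mul (hφ.measurable_phiN j)
  have hmap := map_gMat_bsb1 hB h
  have hc := (continuous_mulVecE (gMat B)).aemeasurable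
    (μ := multivariateGaussian 0 (bsb1 B a b : Matrix (Fin B) (Fin B) ℝ))
  have hab' : 0 < a - b := by linarith
  refine ⟨⟨h, fun i j => ?_⟩, ?_⟩
  · have h1 := (hφ.integrable_phiN_smul_iff (gMat_posSemidef B) hab' i j).2
      ((hφ.eventually_vtDefined hα hB).self_of_nhds.2 i j)
    rw [← hmap, integrable_map_measure (hm i j).aestronglyMeasurable hc] at h1
    exact h1
  · rw [← hφ.vtG_gElt hα hB]
    have e : vtG B φ (gElt B) = vt (phiN φ) ((a - b) • gMat B) :=
      (hφ.vt_phiN_smul (gMat_posSemidef B) hab').symm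
    rw [e]
    ext i j
    simp only [vt, Matrix.of_apply]
    rw [← hmap, integral_map hc (hm i j).aestronglyMeasurable]
    rfl

theorem posSemidef_vt {Φ : EuclideanSpace ℝ (Fin B) → Fin B → ℝ} {S : Matrix (Fin B) (Fin B) ℝ}
    (h : ∀ i j, Integrable (fun x => Φ x i * Φ x j) (multivariateGaussian 0 S)) :
    ((vt Φ S : Sym B) : Matrix (Fin B) (Fin B) ℝ).PosSemidef := by
  refine Matrix.PosSemidef.of_dotProduct_mulVec_nonneg ?_ fun x => ?_
  · rw [Matrix.IsHermitian, Matrix.conjTranspose_eq_transpose_of_trivial]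
    exact (vt Φ S).2
  · have hi : ∀ i j, Integrable (fun y => x i * (Φ y i * Φ y j * x j))
        (multivariateGaussian 0 S) := fun i j => ((h i j).mul_const _).const_mul _
    have e : star x ⬝ᵥ ((vt Φ S : Sym B) : Matrix (Fin B) (Fin B) ℝ).mulVec x =
        ∫ y, (∑ i, x i * Φ y i) ^ 2 ∂(multivariateGaussian 0 S) := by
      have e1 : ∀ y, (∑ i, x i * Φ y i) ^ 2 = ∑ i, ∑ j, x i * (Φ y i * Φ y j * x j) := by
        intro y
        rw [sq, Finset.sum_mul_sum]
        refine Finset.sum_congr rfl fun i _ => Finset.sum_congr rfl fun j _ => ?_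
        ring
      simp_rw [e1]
      rw [integral_finsetSum _ fun i _ => integrable_finsetSum _ fun j _ => hi i j]
      simp only [dotProduct, Matrix.mulVec, Finset.mul_sum, star_trivial, vt, Matrix.of_apply]
      refine Finset.sum_congr rfl fun i _ => ?_
      rw [integral_finsetSum _ fun j _ => hi i j]
      refine Finset.sum_congr rfl fun j _ => ?_
      rw [integral_const_mul, integral_mul_const]
    rw [e]
    exact integral_nonneg fun y => sq_nonneg _

/-- The recursion sends every admissible BSB1 matrix to `Σ*`, so uniqueness is immediate. For
existence `Σ*` must be admissible: it is semidefinite as a second-moment matrix, and its two entries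
differ by `jPhi_cB_lt`. -/
theorem IsPosHom.isBSB1FixedPoint_iff (hφ : IsPosHom α φ) (hα : -(1 / 2) < α) (hB : 4 ≤ B)
    (hne : ∃ x y : ℝ, x ≠ 0 ∧ y ≠ 0 ∧ φ x ≠ φ y) (S : Sym B) :
    IsBSB1FixedPoint φ S ↔ S = sigmaStar α φ B := by
  constructor
  · rintro ⟨⟨a, b, hab, rfl⟩, hd, hS⟩
    rw [← hS]
    exact (hφ.batchnorm_bsb1 hα hB (lt_of_posSemidef_bsb1 hB hab hd.1) hd.1).2
  · rintro rfl
    have hlt : kAlpha α B * jPhi α φ (cB B) < kAlpha α B * jPhi α φ 1 :=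
      mul_lt_mul_of_pos_left (hφ.jPhi_cB_lt hα hB hne) (kAlpha_pos hα hB)
    have hps : ((sigmaStar α φ B : Sym B) : Matrix (Fin B) (Fin B) ℝ).PosSemidef := by
      rw [← hφ.vtG_gElt hα hB]
      exact posSemidef_vt fun i j => (hφ.eventually_vtDefined hα hB).self_of_nhds.2 i j
    have h := hφ.batchnorm_bsb1 hα hB hlt hps
    exact ⟨⟨_, _, hlt.ne', rfl⟩, h.1, h.2⟩

end FixedPoint

/-! ### The eigenvalues of the forward operator -/

section ForwardOp

variable {B : ℕ} {α : ℝ} {φ : ℝ → ℝ}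

theorem one_sub_inv_eq (hB : 4 ≤ B) : 1 - (B : ℝ)⁻¹ = ((B : ℝ) - 1) / B := by
  have hB' : (B : ℝ) ≠ 0 := by positivity
  field_simp

theorem lamM_eq_lamMG (hB : 4 ≤ B) (α : ℝ) (φ : ℝ → ℝ) : lamM α φ B =
    (B : ℝ) ^ α * (upsilonStar α φ B)⁻¹ * (2 : ℝ) ^ (-α) *
      (poch (((B : ℝ) + 1) / 2) α)⁻¹ * lamMG α φ B := by
  have h : (4 : ℝ) ≤ B := by exact_mod_cast hB
  have hB0 : (0 : ℝ) < B := by linarith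
  have hBa : (B : ℝ) ^ (α - 1) ≠ 0 := by positivity
  have e : (B : ℝ) ^ α = (B : ℝ) ^ (α - 1) * B := by
    rw [← Real.rpow_add_one hB0.ne', sub_add_cancel]
  rw [lamM, lamMG, Real.div_rpow (by linarith) hB0.le, e]
  field_simp

theorem lamL_eq_lamLG (hB : 4 ≤ B) (α : ℝ) (φ : ℝ → ℝ) : lamL α φ B =
    (B : ℝ) ^ α * (upsilonStar α φ B)⁻¹ * (2 : ℝ) ^ (-α) *
      (poch (((B : ℝ) + 1) / 2) α)⁻¹ * lamLG α φ B := by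
  have h : (4 : ℝ) ≤ B := by exact_mod_cast hB
  have hB0 : (0 : ℝ) < B := by linarith
  have hBa : (B : ℝ) ^ (α - 1) ≠ 0 := by positivity
  have e : (B : ℝ) ^ α = (B : ℝ) ^ (α - 1) * B := by
    rw [← Real.rpow_add_one hB0.ne', sub_add_cancel]
  rw [lamL, lamLG, Real.div_rpow (by linarith) hB0.le, e]
  generalize ((B : ℝ) - 2) * α * (jPhi α φ 1 - jPhi α φ (cB B)) +
      (B : ℝ) / ((B : ℝ) - 1) * deriv (jPhi α φ) (cB B) = X
  field_simp

theorem conj_sum_two (hB : 4 ≤ B) (u : Fin B → ℝ) :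
    gMat B * (Matrix.of fun i j => u i + u j : Matrix (Fin B) (Fin B) ℝ) * gMat B = 0 := by
  have hB' : (B : ℝ) ≠ 0 := by positivity
  ext i j
  rw [gMat_conj_apply]
  simp only [Matrix.of_apply, Finset.sum_add_distrib, Finset.sum_sub_distrib, ← Finset.mul_sum,
    Finset.sum_const, Finset.card_univ, Fintype.card_fin, nsmul_eq_mul, Matrix.zero_apply]
  field_simp
  ring

theorem IsPosHom.forwardOp_eq (hφ : IsPosHom α φ) (hα : -(1 / 2) < α) (hB : 4 ≤ B)
    (hυ : 0 < upsilonStar α φ B) : ∃ D : SymG B →L[ℝ] Sym B,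
      HasFDerivAt (vtG B φ) ((upsilonStar α φ B)⁻¹ • D) (upsilonStar α φ B • gElt B) ∧
      (∀ T, forwardOp φ (sigmaStar α φ B) T = (upsilonStar α φ B)⁻¹ • centerSym B (D T)) ∧
      D (gElt B) = 0 ∧
      ∀ T : SymG B, (T : Matrix (Fin B) (Fin B) ℝ).trace = 0 → ∀ i j,
        (D T : Matrix (Fin B) (Fin B) ℝ) i j =
          (B : ℝ) ^ α * (2 : ℝ) ^ (-α) * (poch (((B : ℝ) + 1) / 2) α)⁻¹ *
            (cAlpha α * (((B : ℝ) - 1) / B) ^ (α - 1) * if i = j then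
              α * (T : Matrix (Fin B) (Fin B) ℝ) i i * jPhi α φ 1 else
              (α * (((T : Matrix (Fin B) (Fin B) ℝ) i i +
                  (T : Matrix (Fin B) (Fin B) ℝ) j j) / 2) * jPhi α φ (cB B) +
                deriv (jPhi α φ) (cB B) * ((T : Matrix (Fin B) (Fin B) ℝ) i j - cB B *
                  (((T : Matrix (Fin B) (Fin B) ℝ) i i +
                    (T : Matrix (Fin B) (Fin B) ℝ) j j) / 2)))) := by
  obtain ⟨⟨D, hD, hDT⟩, -⟩ := hφ.hasFDerivAt_vtG_gElt hα hB
  have hDυ := hφ.hasFDerivAt_vtG_smul hB hD hυ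
  refine ⟨D, hDυ, fun T => ?_, hφ.fderiv_gElt hD, fun T hT i j => ?_⟩
  · rw [forwardOp, centerSym_sigmaStar hB, hDυ.fderiv]
    simp
  · rw [← one_sub_inv_eq hB]
    split_ifs with hij
    · subst hij
      rw [hDT T hT i i _ (hφ.hasDerivAt_momentPath_diag hα hB i T)]
    · rw [hDT T hT i j _ (hφ.hasDerivAt_momentPath_offDiag hα hB hij T)]

/-- A zero diagonal fixes the variances to first order, so each off-diagonal entry is multiplied by
the same `J_φ'` factor. -/
theorem IsPosHom.forwardOp_MSpace (hφ : IsPosHom α φ) (hα : -(1 / 2) < α) (hB : 4 ≤ B)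
    (hυ : 0 < upsilonStar α φ B) {T : SymG B} (hT : T ∈ MSpace B) :
    forwardOp φ (sigmaStar α φ B) T = lamM α φ B • T := by
  obtain ⟨D, -, hf, -, hDT⟩ := hφ.forwardOp_eq hα hB hυ
  have hd : ∀ i, (T : Matrix (Fin B) (Fin B) ℝ) i i = 0 := hT
  have e : (D T : Matrix (Fin B) (Fin B) ℝ) =
      ((B : ℝ) ^ α * (2 : ℝ) ^ (-α) * (poch (((B : ℝ) + 1) / 2) α)⁻¹ * lamMG α φ B) •
        (T : Matrix (Fin B) (Fin B) ℝ) := by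
    ext i j
    rw [hDT T (by simp [Matrix.trace, hd]) i j, Matrix.smul_apply, smul_eq_mul, lamMG]
    split_ifs with hij
    · rw [← hij, hd]
      ring
    · rw [hd, hd]
      ring
  rw [hf, lamM_eq_lamMG hB]
  refine Subtype.ext ?_
  change (upsilonStar α φ B)⁻¹ • (gMat B * (D T : Matrix (Fin B) (Fin B) ℝ) * gMat B) =
    _ • (T : Matrix (Fin B) (Fin B) ℝ)
  rw [e, mul_smul_comm, smul_mul_assoc, T.2.2, smul_smul]
  congr 1
  ring

/-- The image of `T = G D G` mixes `T`, `D` and a matrix `u_i + u_j`; after centering only multiples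
of `T` are left. -/
theorem IsPosHom.forwardOp_LSpace (hφ : IsPosHom α φ) (hα : -(1 / 2) < α) (hB : 4 ≤ B)
    (hυ : 0 < upsilonStar α φ B) {T : SymG B} (hT : T ∈ LSpace B) :
    forwardOp φ (sigmaStar α φ B) T = lamL α φ B • T := by
  obtain ⟨D, -, hf, -, hDT⟩ := hφ.forwardOp_eq hα hB hυ
  obtain ⟨d, hd, hTd⟩ := hT
  have h4 : (4 : ℝ) ≤ B := by exact_mod_cast hB
  have hB0 : (B : ℝ) ≠ 0 := by linarith
  have hB1 : (B : ℝ) - 1 ≠ 0 := by linarith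
  have hdiag : ∀ i, (T : Matrix (Fin B) (Fin B) ℝ) i i = (1 - 2 / (B : ℝ)) * d i := fun i => by
    rw [hTd, conj_diagonal_diag d hd]
  have htr : (T : Matrix (Fin B) (Fin B) ℝ).trace = 0 := by
    simp [Matrix.trace, hdiag, ← Finset.mul_sum, hd]
  obtain ⟨κ, hκ⟩ : ∃ κ : ℝ, κ = (B : ℝ) ^ α * (2 : ℝ) ^ (-α) * (poch (((B : ℝ) + 1) / 2) α)⁻¹ *
    (cAlpha α * (((B : ℝ) - 1) / B) ^ (α - 1)) := ⟨_, rfl⟩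
  obtain ⟨J', hJ'⟩ : ∃ J', J' = deriv (jPhi α φ) (cB B) := ⟨_, rfl⟩
  -- The off-diagonal formula is extended to the diagonal, and the multiple of `diagonal d` is the
  -- correction needed there.
  have e : (D T : Matrix (Fin B) (Fin B) ℝ) = κ • (J' • (T : Matrix (Fin B) (Fin B) ℝ) +
      ((1 - 2 / (B : ℝ)) * (α * (jPhi α φ 1 - jPhi α φ (cB B)) - J' * (1 - cB B))) •
        Matrix.diagonal d +
      Matrix.of fun i j => (α * jPhi α φ (cB B) - cB B * J') / 2 *
          ((1 - 2 / (B : ℝ)) * d i) +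
        (α * jPhi α φ (cB B) - cB B * J') / 2 * ((1 - 2 / (B : ℝ)) * d j)) := by
    ext i j
    rw [hDT T htr i j, hκ, ← hJ']
    simp only [Matrix.smul_apply, Matrix.add_apply, Matrix.of_apply, Matrix.diagonal_apply,
      smul_eq_mul]
    split_ifs with hij
    · rw [← hij, hdiag]
      ring
    · rw [hdiag, hdiag]
      ring
  rw [hf, lamL_eq_lamLG hB]
  refine Subtype.ext ?_
  change (upsilonStar α φ B)⁻¹ • (gMat B * (D T : Matrix (Fin B) (Fin B) ℝ) * gMat B) =
    _ • (T : Matrix (Fin B) (Fin B) ℝ)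
  rw [e, mul_smul_comm, smul_mul_assoc, mul_add, mul_add, add_mul, add_mul, conj_sum_two hB,
    mul_smul_comm, mul_smul_comm, smul_mul_assoc, smul_mul_assoc, T.2.2, ← hTd, add_zero,
    ← add_smul, smul_smul, smul_smul]
  congr 1
  rw [hκ, lamLG, ← hJ', cB]
  field_simp
  ring

theorem IsPosHom.forwardOp_lineG (hφ : IsPosHom α φ) (hα : -(1 / 2) < α) (hB : 4 ≤ B)
    (hυ : 0 < upsilonStar α φ B) {T : SymG B} (hT : T ∈ lineG B) :
    forwardOp φ (sigmaStar α φ B) T = 0 := by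
  obtain ⟨D, -, hf, h0, -⟩ := hφ.forwardOp_eq hα hB hυ
  obtain ⟨c, rfl⟩ := Submodule.mem_span_singleton.1 hT
  rw [hf, map_smul, h0, smul_zero, map_zero, smul_zero]

end ForwardOp


/-! ### ReLU eigenspaces on all symmetric matrices, and the full theorem. -/

theorem eigenspaces_forwardOpSym_relu {B : ℕ} (hB : 4 ≤ B) :
    Module.End.eigenspace (forwardOpSym relu (sigmaStar 1 relu B)) (lamL 1 relu B) =
        (LSpace B).map (inclG B) ∧
      Module.End.eigenspace (forwardOpSym relu (sigmaStar 1 relu B)) (lamM 1 relu B) =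
        (MSpace B).map (inclG B) := by
  have hα : -(1 / 2 : ℝ) < 1 := by norm_num
  have hυ := isPosHom_relu.upsilonStar_pos hα hB
    ⟨1, -1, by norm_num, by norm_num, by norm_num [relu]⟩
  have hl0 := (lamL_relu_pos hB).ne'
  have hm0 := (lamM_relu_pos hB).ne'
  obtain ⟨-, h1, h2⟩ := eigenspaces_of_scalar hB
    (fun S hS => isPosHom_relu.forwardOp_lineG hα hB hυ hS)
    (fun S hS => isPosHom_relu.forwardOp_LSpace hα hB hυ hS)
    (fun S hS => isPosHom_relu.forwardOp_MSpace hα hB hυ hS) hl0 hm0 (lamL_relu_ne_lamM_relu hB)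
  rw [forwardOpSym, eigenspace_incl_of_ne_zero hl0, eigenspace_incl_of_ne_zero hm0, h1, h2]
  exact ⟨rfl, rfl⟩

end BatchNorm

theorem mainTheorem9 :
    -- positive-homogeneous nonlinearities
    (∀ (B : ℕ) (α : ℝ) (φ : ℝ → ℝ), 4 ≤ B → -(1 / 2) < α → α < ((B : ℝ) - 1) / 2 →
      BatchNorm.IsPosHom α φ → (∃ x y : ℝ, x ≠ 0 ∧ y ≠ 0 ∧ φ x ≠ φ y) →
      -- the BSB1 fixed point
      (∀ S : BatchNorm.Sym B,
        BatchNorm.IsBSB1FixedPoint φ S ↔ S = BatchNorm.sigmaStar α φ B) ∧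
      0 < BatchNorm.upsilonStar α φ B ∧
      BatchNorm.centerSym B (BatchNorm.sigmaStar α φ B) =
        BatchNorm.upsilonStar α φ B • BatchNorm.gElt B ∧
      -- the derivatives involved exist
      (∀ᶠ S : BatchNorm.SymG B in 𝓝 (BatchNorm.upsilonStar α φ B • BatchNorm.gElt B),
        BatchNorm.VtDefined (BatchNorm.phiN φ) (S : Matrix (Fin B) (Fin B) ℝ)) ∧
      DifferentiableAt ℝ (BatchNorm.vtG B φ)
        (BatchNorm.upsilonStar α φ B • BatchNorm.gElt B) ∧
      DifferentiableAt ℝ (BatchNorm.jPhi α φ) (BatchNorm.cB B) ∧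
      -- the three spaces
      DirectSum.IsInternal ![BatchNorm.lineG B, BatchNorm.LSpace B, BatchNorm.MSpace B] ∧
      Module.finrank ℝ (BatchNorm.lineG B) = 1 ∧
      Module.finrank ℝ (BatchNorm.LSpace B) = B - 1 ∧
      Module.finrank ℝ (BatchNorm.MSpace B) = B * (B - 3) / 2 ∧
      -- the operator is scalar on each of them
      (∀ S ∈ BatchNorm.lineG B,
        BatchNorm.forwardOp φ (BatchNorm.sigmaStar α φ B) S = 0) ∧
      (∀ S ∈ BatchNorm.LSpace B,
        BatchNorm.forwardOp φ (BatchNorm.sigmaStar α φ B) S = BatchNorm.lamL α φ B • S) ∧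
      (∀ S ∈ BatchNorm.MSpace B,
        BatchNorm.forwardOp φ (BatchNorm.sigmaStar α φ B) S = BatchNorm.lamM α φ B • S) ∧
      (∀ μ : ℝ,
        Module.End.HasEigenvalue (BatchNorm.forwardOp φ (BatchNorm.sigmaStar α φ B)) μ ↔
          μ = 0 ∨ μ = BatchNorm.lamL α φ B ∨ μ = BatchNorm.lamM α φ B) ∧
      -- the same numbers in their other closed form
      BatchNorm.lamL α φ B =
        (B : ℝ) ^ α * (BatchNorm.upsilonStar α φ B)⁻¹ * (2 : ℝ) ^ (-α) *
          (BatchNorm.poch (((B : ℝ) + 1) / 2) α)⁻¹ * BatchNorm.lamLG α φ B ∧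
      BatchNorm.lamM α φ B =
        (B : ℝ) ^ α * (BatchNorm.upsilonStar α φ B)⁻¹ * (2 : ℝ) ^ (-α) *
          (BatchNorm.poch (((B : ℝ) + 1) / 2) α)⁻¹ * BatchNorm.lamMG α φ B ∧
      -- when the three numbers are distinct, the three spaces are the full eigenspaces
      (BatchNorm.lamL α φ B ≠ 0 → BatchNorm.lamM α φ B ≠ 0 →
        BatchNorm.lamL α φ B ≠ BatchNorm.lamM α φ B →
        Module.End.eigenspace (BatchNorm.forwardOp φ (BatchNorm.sigmaStar α φ B)) 0 =
            BatchNorm.lineG B ∧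
        Module.End.eigenspace (BatchNorm.forwardOp φ (BatchNorm.sigmaStar α φ B))
            (BatchNorm.lamL α φ B) = BatchNorm.LSpace B ∧
        Module.End.eigenspace (BatchNorm.forwardOp φ (BatchNorm.sigmaStar α φ B))
            (BatchNorm.lamM α φ B) = BatchNorm.MSpace B)) ∧
    -- ReLU, which is positive-homogeneous of degree 1
    BatchNorm.IsPosHom 1 BatchNorm.relu ∧
    (∀ c ∈ Set.Icc (-1 : ℝ) 1, BatchNorm.jAlpha 1 c =
      1 / Real.pi * (√(1 - c ^ 2) + (Real.pi - Real.arccos c) * c)) ∧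
    (∀ B : ℕ, 4 ≤ B →
      BatchNorm.upsilonStar 1 BatchNorm.relu B =
        1 / 2 * (1 - BatchNorm.jAlpha 1 (-1 / ((B : ℝ) - 1))) ∧
      BatchNorm.lamL 1 BatchNorm.relu B =
        1 / (2 * ((B : ℝ) + 1) * BatchNorm.upsilonStar 1 BatchNorm.relu B) *
          (((B : ℝ) - 2) * (1 - BatchNorm.jAlpha 1 (-1 / ((B : ℝ) - 1))) +
            (B : ℝ) / ((B : ℝ) - 1) *
              deriv (BatchNorm.jAlpha 1) (-1 / ((B : ℝ) - 1))) ∧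
      BatchNorm.lamM 1 BatchNorm.relu B =
        (B : ℝ) / (2 * ((B : ℝ) + 1) * BatchNorm.upsilonStar 1 BatchNorm.relu B) *
          deriv (BatchNorm.jAlpha 1) (-1 / ((B : ℝ) - 1)) ∧
      BatchNorm.lamL 1 BatchNorm.relu B ≠ 0 ∧
      BatchNorm.lamM 1 BatchNorm.relu B ≠ 0 ∧
      BatchNorm.lamL 1 BatchNorm.relu B ≠ BatchNorm.lamM 1 BatchNorm.relu B ∧
      Module.End.eigenspace
          (BatchNorm.forwardOpSym BatchNorm.relu (BatchNorm.sigmaStar 1 BatchNorm.relu B))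
          (BatchNorm.lamL 1 BatchNorm.relu B) =
        (BatchNorm.LSpace B).map (BatchNorm.inclG B) ∧
      Module.End.eigenspace
          (BatchNorm.forwardOpSym BatchNorm.relu (BatchNorm.sigmaStar 1 BatchNorm.relu B))
          (BatchNorm.lamM 1 BatchNorm.relu B) =
        (BatchNorm.MSpace B).map (BatchNorm.inclG B)) ∧
    -- increasing limits as the batch size grows
    StrictMonoOn (fun B : ℕ => BatchNorm.lamL 1 BatchNorm.relu B) (Set.Ici 4) ∧
    Tendsto (fun B : ℕ => BatchNorm.lamL 1 BatchNorm.relu B) atTop (𝓝 1) ∧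
    StrictMonoOn (fun B : ℕ => BatchNorm.lamM 1 BatchNorm.relu B) (Set.Ici 4) ∧
    Tendsto (fun B : ℕ => BatchNorm.lamM 1 BatchNorm.relu B) atTop
      (𝓝 (Real.pi / (2 * (Real.pi - 1)))) := by
  refine ⟨fun B α φ hB hα _ hφ hne => ?_, BatchNorm.isPosHom_relu,
    fun c hc => BatchNorm.jAlpha_one_eq hc, fun B hB => ?_, BatchNorm.lamL_relu_strictMonoOn,
    BatchNorm.tendsto_lamL_relu, BatchNorm.lamM_relu_strictMonoOn, BatchNorm.tendsto_lamM_relu⟩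
  · have hυ := hφ.upsilonStar_pos hα hB hne
    have h0 := fun S (hS : S ∈ BatchNorm.lineG B) => hφ.forwardOp_lineG hα hB hυ hS
    have hl := fun S (hS : S ∈ BatchNorm.LSpace B) => hφ.forwardOp_LSpace hα hB hυ hS
    have hm := fun S (hS : S ∈ BatchNorm.MSpace B) => hφ.forwardOp_MSpace hα hB hυ hS
    obtain ⟨D, hD, -⟩ := hφ.forwardOp_eq hα hB hυ
    exact ⟨hφ.isBSB1FixedPoint_iff hα hB hne, hυ, BatchNorm.centerSym_sigmaStar hB α φ,
      hφ.eventually_vtDefined_smul hα hB hυ, hD.differentiableAt,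
      hφ.differentiableAt_jPhi hα hB, BatchNorm.isInternal_decomposition hB,
      BatchNorm.finrank_lineG hB, BatchNorm.finrank_LSpace hB, BatchNorm.finrank_MSpace hB,
      h0, hl, hm, BatchNorm.hasEigenvalue_iff_of_scalar hB h0 hl hm,
      BatchNorm.lamL_eq_lamLG hB α φ, BatchNorm.lamM_eq_lamMG hB α φ,
      BatchNorm.eigenspaces_of_scalar hB h0 hl hm⟩
  · obtain ⟨h1, h2⟩ := BatchNorm.eigenspaces_forwardOpSym_relu hB
    exact ⟨BatchNorm.upsilonStar_relu hB, BatchNorm.lamL_relu hB, BatchNorm.lamM_relu hB,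
      (BatchNorm.lamL_relu_pos hB).ne', (BatchNorm.lamM_relu_pos hB).ne',
      BatchNorm.lamL_relu_ne_lamM_relu hB, h1, h2⟩
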